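/- **Conventions.** A $01$-word is a finite word on $\{0,1\}$; $|w|_\varepsilon$ is the number of letters $\varepsilon$ in $w$, and $I_\varepsilon(w)$ is the set of positions $i\in\{1,\dots,|w|\}$ with $w_i=\varepsilon$. Let $\mathcal D_n$ be the set of Dyck words of length $2n$ ($n$ zeros and $n$ ones, every prefix containing at least as many $0$s as $1$s). A word $\pi\in\mathcal D_n$ is identified with the noncrossing perfect matching of $\{1,\dots,2n\}$ whose openers are the positions of the $0$s and whose closers are the positions of the $1$s. The triangle $\mathcal T^n$ has vertices $(x,y)\in\mathbb Z^2$ with $x\ge y\ge 0$ and $x+y\le 4n-2$, all unit edges between them, and $2n$ external edges, the $i$-th one hanging below $(2i-2,0)$, $1\le i\le 2n$. Put $L_i=(i-1,i-1)$ and $R_i=(2n-2+i,2n-i)$ for $1\le i\le 2n$, so $L_{2n}=R_1$ is the apex. For $\sigma,\pi,\tau\in\mathcal D_n$, let $t^{\pi}_{\sigma,\tau}$ be the number of subgraphs $f$ of $\mathcal T^n$ (TFPL configurations) such that: $f$ contains all external edges; each vertex not of the form $L_i$ or $R_i$ has degree $2$ in $f$; $f$ contains the edge to the right of each $L_i$ ($i<2n$)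 and the edge to the left of each $R_i$ ($i>1$); the vertical edge below $L_i$ is in $f$ iff $\sigma_i=0$, and the vertical edge below $R_i$ is in $f$ iff $\tau_i=1$ (for $L_1$ and $R_{2n}$ this edge is the external one); the external edges $i$ and $j$ are joined by a path of $f$ iff $i,j$ are matched by $\pi$; and every path of $f$ starting at an $L_i$ with $\sigma_i=1$ ends at some $R_j$ with $\tau_j=0$ (the path may be the single vertex $L_{2n}=R_1$). Closed loops are allowed. **Theorem.** Let $\sigma,\pi,\tau\in\mathcal D_n$ and let $a,b\ge 0$ be such that $$\sigma=u\,\sigma'\,v,\qquad \pi=u\,1^b0^a\,v,\qquad \tau=0^{n-a}\,\tau'\,1^{n-b}$$ for $01$-words $u,v,\sigma',\tau'$, where $n-a=|u|_0+|v|_0$ and $n-b=|u|_1+|v|_1$; thus $\sigma'$ and $\tau'$ each have $a$ zeros and $b$ ones. Write $$I_1(\sigma')=\{i_1<\dots<i_b\},\quad I_1(\tau')=\{j_1>\dots>j_b\},\quad I_0(\sigma')=\{i'_1<\dots<i'_a\},\quad I_0(\tau')=\{j'_1>\dots>j'_a\},$$ and define the $b\times b$ matrix $M_1$ and the $a\times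 a$ matrix $M_0$ by $$M_1=\left(\binom{2n-|u|_1-2-(a+b)+j_e}{i_d+j_e-(a+b+1)}\right)_{d,e=1}^{b},\qquad M_0=\left(\binom{2n-|u|_1-1-i'_d}{(a+b+1)-i'_d-j'_e}\right)_{d,e=1}^{a},$$ where a binomial coefficient with negative lower entry is $0$ and the determinant of a $0\times0$ matrix is $1$. Then $$t^{\pi}_{\sigma,\tau}=\det(M_0)=\det(M_1).$$ -/

import Mathlib

namespace TFPL

/-- Words over the alphabet `{0, 1}`; the letter in (one-based) position `i` of a word `w`
is `w[i - 1]`. -/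
abbrev Word := List (Fin 2)

/-- Equally many `0`s and `1`s, and every prefix has at least as many `0`s as `1`s. -/
def IsBalanced (w : Word) : Prop :=
  w.count 0 = w.count 1 ∧ ∀ k : ℕ, (w.take k).count 1 ≤ (w.take k).count 0

/-- The set of Dyck words of length `2n`. -/
def dyckWords (n : ℕ) : Set Word :=
  {w | w.length = 2 * n ∧ IsBalanced w}

/-- `indexSet ε w` is the set of (one-based) positions of the letter `ε` in `w`. -/
def indexSet (ε : Fin 2) (w : Word) : Set ℕ :=
  {i | 1 ≤ i ∧ w[i - 1]? = some ε}

/-- The noncrossing matching encoded by a Dyck word: the zero-based positions `i < j` are matched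
if there is an opening letter `0` at `i`, a closing letter `1` at `j`, and the factor strictly
between them is well parenthesized. -/
def Matched (w : Word) (i j : ℕ) : Prop :=
  i < j ∧ w[i]? = some 0 ∧ w[j]? = some 1 ∧ IsBalanced ((w.take j).drop (i + 1))

/-- The vertices `(x, y)` of the triangle of size `n`. -/
def InTriangle (n : ℕ) (p : ℤ × ℤ) : Prop :=
  0 ≤ p.2 ∧ p.2 ≤ p.1 ∧ p.1 + p.2 ≤ 4 * (n : ℤ) - 2

/-- The free ends of the `2n` external edges, which hang below the vertices
`(0, 0), (2, 0), …, (4n - 2, 0)`. -/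
def IsExternalEnd (n : ℕ) (p : ℤ × ℤ) : Prop :=
  ∃ i : ℕ, i < 2 * n ∧ p = (2 * (i : ℤ), -1)

/-- The square grid on the triangle, together with its `2n` external edges. -/
def triangleGraph (n : ℕ) : SimpleGraph (ℤ × ℤ) where
  Adj p q := |p.1 - q.1| + |p.2 - q.2| = 1 ∧
    (InTriangle n p ∨ IsExternalEnd n p) ∧ (InTriangle n q ∨ IsExternalEnd n q)
  symm := ⟨fun p q ⟨h, hp, hq⟩ => ⟨by rw [abs_sub_comm q.1, abs_sub_comm q.2]; exact h, hq, hp⟩⟩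
  loopless := ⟨fun p ⟨h, _⟩ => by simp at h⟩

/-- The free end of the `i`-th external edge, for `i = 0, …, 2n - 1` from left to right. -/
def bottomEnd (i : ℕ) : ℤ × ℤ := (2 * (i : ℤ), -1)

/-- The vertices of the left boundary, for `i = 0, …, 2n - 1` from bottom to top. -/
def leftVertex (i : ℕ) : ℤ × ℤ := ((i : ℤ), (i : ℤ))

/-- The vertices of the right boundary, for `i = 0, …, 2n - 1` from top to bottom.
The apex of the triangle is both `leftVertex (2 * n - 1)` and `rightVertex n 0`. -/
def rightVertex (n i : ℕ) : ℤ × ℤ := (2 * (n : ℤ) - 1 + i, 2 * (n : ℤ) - 1 - i)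

/-- `f` is a fully packed loop configuration in the triangle with left, bottom and right
boundary conditions `σ`, `π` and `τ`. -/
structure IsTFPL (n : ℕ) (σ π τ : Word) (f : SimpleGraph (ℤ × ℤ)) : Prop where
  /-- `f` is a subgraph of the triangle with its external edges. -/
  le : f ≤ triangleGraph n
  /-- All external edges belong to `f`. -/
  external : ∀ i : ℕ, i < 2 * n → f.Adj (2 * (i : ℤ), 0) (bottomEnd i)
  /-- Vertices not on the left or right boundary have degree two. -/
  interior : ∀ p : ℤ × ℤ, InTriangle n p → p.1 ≠ p.2 → p.1 + p.2 ≠ 4 * (n : ℤ) - 2 →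
    (f.neighborSet p).ncard = 2
  /-- Every left boundary vertex except the apex has its right edge in `f`. -/
  left_horizontal : ∀ i : ℕ, i + 1 < 2 * n → f.Adj (leftVertex i) ((i : ℤ) + 1, (i : ℤ))
  /-- The edge below a left boundary vertex is in `f` exactly if the letter of `σ` is `0`. -/
  left_vertical : ∀ i : ℕ, i < 2 * n →
    (f.Adj (leftVertex i) ((i : ℤ), (i : ℤ) - 1) ↔ σ[i]? = some 0)
  /-- Every right boundary vertex except the apex has its left edge in `f`. -/
  right_horizontal : ∀ i : ℕ, 1 ≤ i → i < 2 * n →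
    f.Adj (rightVertex n i) (2 * (n : ℤ) - 2 + i, 2 * (n : ℤ) - 1 - i)
  /-- The edge below a right boundary vertex is in `f` exactly if the letter of `τ` is `1`. -/
  right_vertical : ∀ i : ℕ, i < 2 * n →
    (f.Adj (rightVertex n i) (2 * (n : ℤ) - 1 + i, 2 * (n : ℤ) - 2 - i) ↔ τ[i]? = some 1)
  /-- The paths of `f` connect the external edges according to the matching `π`. -/
  bottom_link : ∀ i j : ℕ, i < j → j < 2 * n →
    (f.Reachable (bottomEnd i) (bottomEnd j) ↔ Matched π i j)
  /-- A path of `f` that starts at a letter `1` of `σ` ends at a letter `0` of `τ`. -/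
  cross_link : ∀ i : ℕ, i < 2 * n → σ[i]? = some 1 →
    ∃ j : ℕ, j < 2 * n ∧ τ[j]? = some 0 ∧ f.Reachable (leftVertex i) (rightVertex n j)

/-- There are only finitely many configurations. -/
theorem finite_isTFPL (n : ℕ) (σ π τ : Word) : {f | IsTFPL n σ π τ f}.Finite := by
  let S : Set (ℤ × ℤ) := Set.Icc (0, -1) (4 * (n : ℤ), 4 * (n : ℤ))
  have hS : ∀ p : ℤ × ℤ, InTriangle n p ∨ IsExternalEnd n p → p ∈ S := by
    rintro p (⟨h1, h2, h3⟩ | ⟨i, hi, rfl⟩)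
    · simp only [S, Set.mem_Icc, Prod.le_def]; omega
    · simp only [S, Set.mem_Icc, Prod.le_def]; omega
  have hfin : (S ×ˢ S).Finite := (Set.finite_Icc _ _).prod (Set.finite_Icc _ _)
  refine Set.Finite.of_finite_image (f := fun f : SimpleGraph (ℤ × ℤ) =>
    {e : (ℤ × ℤ) × (ℤ × ℤ) | f.Adj e.1 e.2}) (hfin.finite_subsets.subset ?_) ?_
  · rintro _ ⟨f, hf, rfl⟩ e he
    have h := hf.le he
    exact ⟨hS _ h.2.1, hS _ h.2.2⟩
  · intro f _ g _ h
    ext p q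
    exact Set.ext_iff.mp h (p, q)

/-- The number of configurations with boundary data `σ`, `π`, `τ`. -/
noncomputable def t (n : ℕ) (σ π τ : Word) : ℕ :=
  {f | IsTFPL n σ π τ f}.ncard

/-- Binomial coefficient of integers, zero if the lower entry is negative. -/
noncomputable def binom (x k : ℤ) : ℤ :=
  if 0 ≤ k then Ring.choose x k.toNat else 0

end TFPL

/-!
# Fully packed loops in a triangle and a determinant

A configuration is read along the antidiagonals of the triangle, from the left corner on. On every
antidiagonal the lattice points alternate between `E p m` and `O p m` (`Site`), and a configuration
is a family of bits satisfying linear equations (`Bits.Local`) that express the degrees and the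
boundary edges, together with a condition on its paths (`Bits.Linked`).

*Rigidity.* In a graph of maximal degree two, paths that start at ends which are known not to be
linked never meet. Exploring such paths from suitable ends in a suitable order shows that most
edges are forced (`growth`, `shape_of_linked`): on the antidiagonals of `u` and `v`
the letter of `π` decides whether all edges to the left or all edges below are present, the middle
antidiagonals have all edges to the right in a strip along the left boundary, and all edges
below the points `E p m` away from the strip. Conversely, these edges determine the links. The open
paths that cross from one antidiagonal to the next one form a stack, from which a letter `1` of
`π` pops a path and onto which a letter `0` pushes one (`Datum.stack`, `Entering`,
`linked_of_shape`). So the condition on the paths is equivalent to the local condition `Shape`.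

*Particles.* The edges that remain free form a system of particles. They start at the letters `0` of
`σ'` and end, in reverse order, at those of `τ'`. In every time step each particle stays or jumps
from `x` to `x + 1`, where a jump from `x` at time `s` requires `x ≤ s`, and different particles
never share a position. In the strip, time runs along the antidiagonals, and later from one
antidiagonal to the next one (`isArray_of_shape`, `build_local`, `eq_of_arrB`).

*Determinants.* A single particle goes from `i` to `j` in time `T` in `(T - i).choose (j - i)` ways.
Expanding all columns of the determinant of these numbers by Pascal's rule sorts the histories by
the set of particles that jump last, and the terms with colliding particles vanish because two
columns agree. So the determinant counts the histories (`card_histories`, `ncard_linked`).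
This is `det M₀`. The matrix of all weights is inverse to the same matrix with alternating signs, so
`M₀` and `M₁` are complementary minors, up to signs, and Jacobi's identity gives
`det M₀ = ± det M₁`. As both determinants count histories, they are equal (`det_weight_compl`).

If `u` or `v` is empty, the middle part of `π` is constant and `σ = π`. This case is reduced to a
decomposition with `a = b = 0` (`Factored.t_eq_one_of_nil`).
-/

namespace TFPL

/-! ### Histories of jumping particles -/

section Histories

/-- The entry `(i, j)` of the matrix of weights at time `s`: the number of ways in which a single
particle starting at `i` can reach `j` by time `s`, where a particle at position `x` may
jump (to `x + 1`) at time `r` only if `x ≤ r`. -/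
def weight (s i j : ℕ) : ℤ := if i ≤ j then ((s - i).choose (j - i) : ℤ) else 0

theorem weight_succ (s i j : ℕ) :
    weight (s + 1) i (j + 1) = weight s i (j + 1) + if j ≤ s then weight s i j else 0 := by
  unfold weight
  rcases lt_trichotomy i (j + 1) with h | h | h
  · have h1 : i ≤ j := by omega
    have h2 : j + 1 - i = (j - i) + 1 := by omega
    rw [if_pos h.le, if_pos h.le, if_pos h1, h2]
    by_cases hs : j ≤ s
    · have h3 : s + 1 - i = (s - i) + 1 := by omega
      rw [if_pos hs, h3, Nat.choose_succ_succ]; push_cast; ring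
    · rw [if_neg hs, Nat.choose_eq_zero_of_lt (by omega), Nat.choose_eq_zero_of_lt (by omega)]; simp
  · subst h; simp
  · have h1 : ¬ i ≤ j + 1 := by omega
    have h2 : ¬ i ≤ j := by omega
    simp [h1, h2]

theorem weight_succ_zero (s i : ℕ) : weight (s + 1) i 0 = weight s i 0 := by
  unfold weight
  by_cases h : i = 0 <;> simp [h]

theorem weight_zero (i j : ℕ) : weight 0 i j = if i = j then 1 else 0 := by
  unfold weight
  rcases lt_trichotomy i j with h | h | h
  · rw [if_pos h.le, Nat.choose_eq_zero_of_lt (by omega), if_neg h.ne]; simp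
  · simp [h]
  · rw [if_neg (by omega), if_neg (by omega)]

variable {a : ℕ}

/-- Positions at time `s` of the particles `d : Fin a`, which start at `i d` and jump by one
at the times `r` with `d ∈ B r`. -/
def pos (i : Fin a → ℕ) (B : ℕ → Finset (Fin a)) : ℕ → Fin a → ℕ
  | 0 => i
  | s + 1 => fun d => pos i B s d + if d ∈ B s then 1 else 0

/-- The jump data `B` describe a history of length `s` with starting positions `i`: particles
never collide, and a particle at `x` jumps at time `r` only if `x ≤ r`. -/
structure IsHistory (i : Fin a → ℕ) (s : ℕ) (B : ℕ → Finset (Fin a)) : Prop where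
  eq_empty : ∀ r, s ≤ r → B r = ∅
  le : ∀ r < s, ∀ d ∈ B r, pos i B r d ≤ r
  mono : ∀ r ≤ s, StrictMono (pos i B r)

theorem pos_congr (i : Fin a → ℕ) {B B' : ℕ → Finset (Fin a)} {s : ℕ}
    (h : ∀ r < s, B r = B' r) : pos i B s = pos i B' s := by
  induction s with
  | zero => rfl
  | succ s ih =>
    funext d
    simp only [pos]
    rw [ih fun r hr => h r (by omega), h s (by omega)]

/-- Positions before the jumps in `S` that lead to `z`. -/
def unjump (z : Fin a → ℕ) (S : Finset (Fin a)) (d : Fin a) : ℕ := z d - if d ∈ S then 1 else 0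

/-- The histories of length `s` from `i` to `z`, sorted by their last jump set. -/
noncomputable def histories (i : Fin a → ℕ) : ℕ → (Fin a → ℕ) → Finset (ℕ → Finset (Fin a))
  | 0, z => open Classical in if z = i then {fun _ => ∅} else ∅
  | s + 1, z => open Classical in
    if StrictMono z then
      ((Finset.univ : Finset (Finset (Fin a))).filter fun S => ∀ d ∈ S, 1 ≤ z d ∧ z d ≤ s + 1).biUnion
        fun S => (histories i s (unjump z S)).image fun B => Function.update B s S
    else ∅

theorem mem_histories (i : Fin a → ℕ) (hi : StrictMono i) (s : ℕ) (z : Fin a → ℕ)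
    (B : ℕ → Finset (Fin a)) : B ∈ histories i s z ↔ IsHistory i s B ∧ pos i B s = z := by
  classical
  induction s generalizing z B with
  | zero =>
    simp only [histories, pos]
    constructor
    · intro h
      by_cases hz : z = i
      · rw [if_pos hz] at h
        have : B = fun _ => ∅ := by simpa using h
        subst this
        refine ⟨⟨fun _ _ => rfl, fun _ hr => absurd hr (by omega), fun r hr => ?_⟩, hz.symm⟩
        obtain rfl : r = 0 := by omega
        exact hi
      · simp [hz] at h
    · rintro ⟨h, rfl⟩
      simp only [if_true, Finset.mem_singleton]
      funext r
      exact h.eq_empty r (Nat.zero_le _)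
  | succ s ih =>
    simp only [histories]
    constructor
    · intro h
      split_ifs at h with hz
      · simp only [Finset.mem_biUnion, Finset.mem_filter, Finset.mem_univ, true_and,
          Finset.mem_image] at h
        obtain ⟨S, hS, B', hB', rfl⟩ := h
        obtain ⟨h1, h2⟩ := (ih _ _).1 hB'
        have hlt : ∀ r ≤ s, pos i (Function.update B' s S) r = pos i B' r := fun r hr =>
          pos_congr i fun q hq => by rw [Function.update_of_ne (by omega)]
        have hpos : pos i (Function.update B' s S) (s + 1) = z := by
          funext d
          simp only [pos]
          rw [hlt s le_rfl, h2, Function.update_self, unjump]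
          split_ifs with hd
          · have := (hS d hd).1; omega
          · omega
        refine ⟨⟨fun r hr => ?_, fun r hr d hd => ?_, fun r hr => ?_⟩, hpos⟩
        · rw [Function.update_of_ne (by omega)]; exact h1.eq_empty r (by omega)
        · rw [hlt r (by omega)]
          rcases eq_or_ne r s with rfl | hne
          · rw [Function.update_self] at hd
            rw [h2, unjump, if_pos hd]
            have := hS d hd; omega
          · rw [Function.update_of_ne hne] at hd
            exact h1.le r (by omega) d hd
        · rcases Nat.lt_or_ge s r with h' | h'
          · obtain rfl : r = s + 1 := by omega
            rw [hpos]; exact hz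
          · rw [hlt r h']; exact h1.mono r h'
      · simp at h
    · rintro ⟨h, rfl⟩
      rw [if_pos (h.mono _ le_rfl)]
      simp only [Finset.mem_biUnion, Finset.mem_filter, Finset.mem_univ, true_and,
          Finset.mem_image]
      have hlt : ∀ r ≤ s, pos i (Function.update B s ∅) r = pos i B r := fun r hr =>
          pos_congr i fun q hq => by rw [Function.update_of_ne (by omega)]
      refine ⟨B s, fun d hd => ?_, Function.update B s ∅, (ih _ _).2 ⟨⟨fun r hr => ?_, fun r hr d hd => ?_,
        fun r hr => ?_⟩, ?_⟩, ?_⟩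
      · have := h.le s (by omega) d hd
        simp only [pos, if_pos hd]; omega
      · rcases eq_or_ne r s with rfl | hne
        · simp
        · rw [Function.update_of_ne hne]; exact h.eq_empty r (by omega)
      · rw [hlt r hr.le]
        rw [Function.update_of_ne hr.ne] at hd
        exact h.le r (by omega) d hd
      · rw [hlt r hr]; exact h.mono r (by omega)
      · rw [hlt s le_rfl]
        funext d
        simp only [unjump, pos]
        split_ifs <;> omega
      · simp

theorem strictMono_or_not_injective {z : Fin a → ℕ} (hz : Monotone z) :
    StrictMono z ∨ ∃ d e, d ≠ e ∧ z d = z e := by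
  by_cases h : Function.Injective z
  · exact Or.inl (hz.strictMono_of_injective h)
  · right
    simp only [Function.Injective, not_forall] at h
    obtain ⟨d, e, h1, h2⟩ := h
    exact ⟨d, e, h2, h1⟩

theorem det_weight_eq_zero {i z : Fin a → ℕ} {s : ℕ} {d e : Fin a} (hne : d ≠ e)
    (h : z d = z e) : (Matrix.of fun d e => weight s (i d) (z e)).det = 0 :=
  Matrix.det_zero_of_column_eq hne fun k => by simp [h]

/-- Expanding every column of the weight matrix by Pascal's rule sorts histories by the
set of particles that jump last. -/
theorem det_weight_succ (i z : Fin a → ℕ) (s : ℕ) :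
    (Matrix.of fun d e => weight (s + 1) (i d) (z e)).det =
      ∑ S ∈ (Finset.univ : Finset (Finset (Fin a))).filter (fun S => ∀ d ∈ S, 1 ≤ z d ∧ z d ≤ s + 1),
        (Matrix.of fun d e => weight s (i d) (unjump z S e)).det := by
  classical
  let m' : Fin a → Fin a → ℤ := fun e d => weight s (i d) (z e)
  let m : Fin a → Fin a → ℤ := fun e d =>
    if 1 ≤ z e ∧ z e ≤ s + 1 then weight s (i d) (z e - 1) else 0
  have h1 : (Matrix.of fun d e => weight (s + 1) (i d) (z e)).det =
      (Matrix.detRowAlternating (m + m') : ℤ) := by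
    rw [← Matrix.det_transpose]
    change Matrix.det _ = Matrix.det _
    congr 1
    ext e d
    simp only [Matrix.transpose_apply, Matrix.of_apply, Pi.add_apply, m, m']
    rcases Nat.eq_zero_or_pos (z e) with h | h
    · simp [h, weight_succ_zero]
    · obtain ⟨j, hj⟩ : ∃ j, z e = j + 1 := ⟨z e - 1, by omega⟩
      rw [hj, weight_succ]
      simp [add_comm]
  rw [h1]
  have h2 := (Matrix.detRowAlternating (n := Fin a) (R := ℤ)).toMultilinearMap.map_add_univ m m'
  change Matrix.detRowAlternating (m + m') = ∑ S, Matrix.detRowAlternating _ at h2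
  rw [h2, ← Finset.sum_filter_add_sum_filter_not Finset.univ
    (fun S : Finset (Fin a) => ∀ d ∈ S, 1 ≤ z d ∧ z d ≤ s + 1)]
  rw [Finset.sum_eq_zero (s := Finset.univ.filter fun S : Finset (Fin a) =>
    ¬ ∀ d ∈ S, 1 ≤ z d ∧ z d ≤ s + 1), add_zero]
  · refine Finset.sum_congr rfl fun S hS => ?_
    rw [← Matrix.det_transpose (Matrix.of _)]
    change Matrix.det _ = Matrix.det _
    congr 1
    ext e d
    simp only [Finset.mem_filter, Finset.mem_univ, true_and] at hS
    simp only [Matrix.transpose_apply, Matrix.of_apply, unjump, m, m']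
    by_cases he : e ∈ S
    · simp [Finset.piecewise, he, hS e he]
    · simp [Finset.piecewise, he]
  · intro S hS
    simp only [Finset.mem_filter, Finset.mem_univ, true_and, not_forall] at hS
    obtain ⟨e, he, h⟩ := hS
    refine (Matrix.detRowAlternating (n := Fin a) (R := ℤ)).toMultilinearMap.map_coord_zero e ?_
    funext d
    simp only [Finset.piecewise, he, if_true, m]
    rw [if_neg h]; rfl

/-- Noncolliding histories are counted by a determinant of single particle weights. -/
theorem card_histories (i : Fin a → ℕ) (hi : StrictMono i) (s : ℕ) (z : Fin a → ℕ)
    (hz : StrictMono z) :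
    ((histories i s z).card : ℤ) = (Matrix.of fun d e => weight s (i d) (z e)).det := by
  classical
  induction s generalizing z with
  | zero =>
    simp only [histories, weight_zero]
    by_cases h : z = i
    · subst h
      rw [if_pos rfl]
      have : (Matrix.of fun d e => if z d = z e then (1 : ℤ) else 0) = 1 := by
        ext d e
        simp [Matrix.one_apply, hz.injective.eq_iff]
      rw [this]; simp
    · rw [if_neg h]
      have : ∃ e, z e ∉ Set.range i := by
        by_contra! hcon
        apply h
        refine (hz.range_inj hi).1 (Set.eq_of_subset_of_ncard_le ?_ ?_ (Set.finite_range _))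
        · rintro _ ⟨e, rfl⟩; exact hcon e
        · rw [← Set.image_univ, ← Set.image_univ, Set.ncard_image_of_injective _ hz.injective,
            Set.ncard_image_of_injective _ hi.injective]
      obtain ⟨e, he⟩ := this
      rw [Matrix.det_eq_zero_of_column_eq_zero e]
      · simp
      · intro d
        simp only [Matrix.of_apply]
        rw [if_neg fun h' => he ⟨d, h'⟩]
  | succ s ih =>
    simp only [histories]
    rw [if_pos hz, Finset.card_biUnion, det_weight_succ]
    · push_cast
      refine Finset.sum_congr rfl fun S hS => ?_
      simp only [Finset.mem_filter, Finset.mem_univ, true_and] at hS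
      rw [Finset.card_image_of_injOn]
      · have hmono : Monotone (unjump z S) := by
          intro d e hde
          rcases hde.eq_or_lt with rfl | hlt
          · exact le_rfl
          · have := hz hlt
            simp only [unjump]; split_ifs <;> omega
        rcases strictMono_or_not_injective hmono with h | ⟨d, e, hne, h⟩
        · exact ih _ h
        · rw [det_weight_eq_zero hne h]
          rw [Finset.card_eq_zero.2]; · rfl
          rw [Finset.eq_empty_iff_forall_notMem]
          intro B hB
          obtain ⟨h1, h2⟩ := (mem_histories i hi s _ B).1 hB
          have := (h1.mono s le_rfl).injective (a₁ := d) (a₂ := e) (by rw [h2]; exact h)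
          exact hne this
      · intro B hB B' hB' h
        obtain ⟨h1, -⟩ := (mem_histories i hi s _ B).1 hB
        obtain ⟨h2, -⟩ := (mem_histories i hi s _ B').1 hB'
        funext r
        rcases eq_or_ne r s with rfl | hne
        · rw [h1.eq_empty r le_rfl, h2.eq_empty r le_rfl]
        · have := congrFun h r
          simpa [Function.update_of_ne hne] using this
    · intro S _ S' _ hne
      rw [Function.onFun, Finset.disjoint_left]
      rintro B hB hB'
      simp only [Finset.mem_image] at hB hB'
      obtain ⟨_, _, rfl⟩ := hB
      obtain ⟨_, _, h⟩ := hB'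
      have := congrFun h s
      simp at this
      exact hne this.symm

end Histories

/-! ### Graphs of maximal degree two -/

section Graph

variable {V : Type*} {f : SimpleGraph V}

/-- Two paths from `x`, both avoiding a neighbor `y` of `x`, run together. -/
theorem end_eq_of_paths
    (hdeg : ∀ w x y z, f.Adj w x → f.Adj w y → f.Adj w z → x = y ∨ x = z ∨ y = z)
    {b c : V} (hb : ∀ x y, f.Adj b x → f.Adj b y → x = y)
    (hc : ∀ x y, f.Adj c x → f.Adj c y → x = y) {x : V} (p : f.Walk x b) (q : f.Walk x c)
    (hp : p.IsPath) (hq : q.IsPath) (y : V) (hy : f.Adj x y) (hyp : y ∉ p.support)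
    (hyq : y ∉ q.support) : b = c := by
  induction p generalizing y with
  | nil =>
    cases q with
    | nil => rfl
    | @cons _ v _ h q' =>
      exfalso
      apply hyq
      rw [hb _ _ hy h]
      simp
  | @cons x v b h p' ih =>
    cases q with
    | nil =>
      exfalso
      apply hyp
      rw [hc _ _ hy h]
      simp
    | @cons _ w _ h' q' =>
      have hv : v ≠ y := by rintro rfl; apply hyp; simp
      have hw : w ≠ y := by rintro rfl; apply hyq; simp
      have hvw : v = w := by
        rcases hdeg _ _ _ _ hy h h' with h1 | h1 | h1
        · exact absurd h1.symm hv
        · exact absurd h1.symm hw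
        · exact h1
      subst hvw
      rw [SimpleGraph.Walk.cons_isPath_iff] at hp hq
      exact ih hb q' hp.1 hq.1 x h.symm hp.2 hq.2

/-- A component of a graph of maximal degree two has at most two end points. -/
theorem eq_of_reachable_ends
    (hdeg : ∀ w x y z, f.Adj w x → f.Adj w y → f.Adj w z → x = y ∨ x = z ∨ y = z)
    {a b c : V} (ha : ∀ x y, f.Adj a x → f.Adj a y → x = y)
    (hb : ∀ x y, f.Adj b x → f.Adj b y → x = y) (hc : ∀ x y, f.Adj c x → f.Adj c y → x = y)
    (hab : f.Reachable a b) (hac : f.Reachable a c) (h1 : a ≠ b) (h2 : a ≠ c) : b = c := by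
  classical
  obtain ⟨p, hp⟩ := hab.exists_isPath
  obtain ⟨q, hq⟩ := hac.exists_isPath
  cases p with
  | nil => exact absurd rfl h1
  | @cons _ v _ h p' =>
    cases q with
    | nil => exact absurd rfl h2
    | @cons _ w _ h' q' =>
      obtain rfl := ha _ _ h h'
      rw [SimpleGraph.Walk.cons_isPath_iff] at hp hq
      exact end_eq_of_paths hdeg hb hc p' q' hp.1 hq.1 a h.symm hp.2 hq.2

/-- The subgraph spanned by `S`, on the same vertices. -/
def within (f : SimpleGraph V) (S : Set V) : SimpleGraph V where
  Adj x y := f.Adj x y ∧ x ∈ S ∧ y ∈ S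
  symm := ⟨fun _ _ h => ⟨h.1.symm, h.2.2, h.2.1⟩⟩
  loopless := ⟨fun _ h => f.loopless.irrefl _ h.1⟩

theorem within_le (S : Set V) : within f S ≤ f := fun _ _ h => h.1

/-- If every vertex of `S` is linked inside `S` to one of the pairwise unlinked end points in `E`,
then a vertex outside `S` has at most one neighbor in `S`, and none if it is in `E`. -/
theorem neighbor_unique_of_linked
    (hdeg : ∀ w x y z, f.Adj w x → f.Adj w y → f.Adj w z → x = y ∨ x = z ∨ y = z)
    {E S : Set V} (hE : ∀ x ∈ E, ∀ y ∈ E, f.Reachable x y → x = y)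
    (hE1 : ∀ e ∈ E, ∀ x y, f.Adj e x → f.Adj e y → x = y)
    (hS : ∀ v ∈ S, ∃ e ∈ E, e ∈ S ∧ (within f S).Reachable v e) {w : V} (hw : w ∉ S) :
    (∀ x ∈ S, ∀ y ∈ S, f.Adj w x → f.Adj w y → x = y) ∧ (w ∈ E → ∀ x ∈ S, ¬ f.Adj w x) := by
  refine ⟨fun x hx y hy hwx hwy => ?_, fun hwE x hx hwx => ?_⟩
  · obtain ⟨e, he, heS, hxe⟩ := hS x hx
    obtain ⟨e', he', heS', hye⟩ := hS y hy
    have h1 : e = e' := hE e he e' he' ((((hxe.mono (within_le S)).symm.trans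
      hwx.symm.reachable).trans hwy.reachable).trans (hye.mono (within_le S)))
    subst h1
    have key : ∀ z ∈ S, f.Adj w z → ∀ p q, (within f S).Adj z p → (within f S).Adj z q → p = q := by
      intro z _ hwz p q hp hq
      rcases hdeg _ _ _ _ hwz.symm hp.1 hq.1 with h | h | h
      · exact absurd (h ▸ hp.2.2) hw
      · exact absurd (h ▸ hq.2.2) hw
      · exact h
    by_cases hadj : f.Adj e w
    · have key2 : ∀ z, (within f S).Reachable z e → z = e := by
        intro z hz
        by_contra hne
        obtain ⟨p⟩ := hz.symm
        cases p with
        | nil => exact hne rfl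
        | cons h' _ => exact hw (hE1 e he _ _ hadj h'.1 ▸ h'.2.2)
      rw [key2 x hxe, key2 y hye]
    · have hxe' : e ≠ x := by rintro rfl; exact hadj hwx.symm
      have hye' : e ≠ y := by rintro rfl; exact hadj hwy.symm
      exact eq_of_reachable_ends (f := within f S)
        (fun w x y z h1 h2 h3 => hdeg w x y z h1.1 h2.1 h3.1)
        (fun p q h1 h2 => hE1 e he p q h1.1 h2.1) (key x hx hwx) (key y hy hwy)
        hxe.symm hye.symm hxe' hye'
  · obtain ⟨e, he, heS, hxe⟩ := hS x hx
    exact hw (hE w hwE e he (hwx.reachable.trans (hxe.mono (within_le S))) ▸ heS)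

/-- The vertices of a region `R` are visited in the lexicographic order of `(r₁, r₂)`. If each
one is in `E` or has a neighbor visited earlier, then this neighbor is unique. This
information can be used to establish a property `Q` along the way. -/
theorem growth
    (hdeg : ∀ w x y z, f.Adj w x → f.Adj w y → f.Adj w z → x = y ∨ x = z ∨ y = z)
    {E : Set V} (hE : ∀ x ∈ E, ∀ y ∈ E, f.Reachable x y → x = y)
    (hE1 : ∀ e ∈ E, ∀ x y, f.Adj e x → f.Adj e y → x = y)
    (R : Set V) (r₁ r₂ : V → ℕ) (Q : V → Prop)
    (step : ∀ w ∈ R,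
      (∀ v ∈ R, (r₁ v < r₁ w ∨ r₁ v = r₁ w ∧ r₂ v < r₂ w) → Q v) →
      (∀ v ∈ R, (r₁ v < r₁ w ∨ r₁ v = r₁ w ∧ r₂ v < r₂ w) → f.Adj w v →
        ∀ v' ∈ R, (r₁ v' < r₁ w ∨ r₁ v' = r₁ w ∧ r₂ v' < r₂ w) → f.Adj w v' → v = v') →
      (w ∈ E → ∀ v ∈ R, (r₁ v < r₁ w ∨ r₁ v = r₁ w ∧ r₂ v < r₂ w) → ¬ f.Adj w v) →
      Q w ∧ (w ∈ E ∨ ∃ v ∈ R, (r₁ v < r₁ w ∨ r₁ v = r₁ w ∧ r₂ v < r₂ w) ∧ f.Adj w v)) :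
    ∀ w ∈ R, Q w := by
  let lt : V → V → Prop := fun v w => r₁ v < r₁ w ∨ r₁ v = r₁ w ∧ r₂ v < r₂ w
  have hwf : WellFounded lt := by
    have : lt = InvImage (Prod.Lex (· < ·) (· < ·)) (fun v => (r₁ v, r₂ v)) := by
      funext v w
      simp [lt, InvImage, Prod.lex_def]
    rw [this]
    exact InvImage.wf _ (WellFounded.prod_lex wellFounded_lt wellFounded_lt)
  have htrans : ∀ {u v w}, lt u v → lt v w → lt u w := by
    intro u v w h1 h2; simp only [lt] at *; omega
  have hirr : ∀ v, ¬ lt v v := by intro v; simp only [lt]; omega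
  have main : ∀ w, w ∈ R → Q w ∧ (w ∈ E ∨ ∃ v ∈ R, lt v w ∧ f.Adj w v) := by
    intro w
    induction w using hwf.induction with
    | _ w ih =>
      intro hw
      let S : Set V := {v | v ∈ R ∧ lt v w}
      have hS : ∀ v, v ∈ S → ∃ e ∈ E, e ∈ S ∧ (within f S).Reachable v e := by
        intro v
        induction v using hwf.induction with
        | _ v ihv =>
          intro hv
          rcases (ih v hv.2 hv.1).2 with h | ⟨x, hx, hxv, hadj⟩
          · exact ⟨v, h, hv, SimpleGraph.Reachable.refl _⟩
          · have hxS : x ∈ S := ⟨hx, htrans hxv hv.2⟩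
            obtain ⟨e, he, heS, hr⟩ := ihv x hxv hxS
            have hadj' : (within f S).Adj v x := ⟨hadj, hv, hxS⟩
            exact ⟨e, he, heS, hadj'.reachable.trans hr⟩
      obtain ⟨h1, h2⟩ := neighbor_unique_of_linked hdeg hE hE1 hS (w := w) (fun h => hirr w h.2)
      exact step w hw (fun v hv hlt => (ih v hlt hv).1)
        (fun v hv hlt hadj v' hv' hlt' hadj' => h1 v ⟨hv, hlt⟩ v' ⟨hv', hlt'⟩ hadj hadj')
        (fun hwE v hv hlt => h2 hwE v ⟨hv, hlt⟩)
  exact fun w hw => (main w hw).1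

end Graph

/-! ### Configurations in coordinates -/

/-- The lattice points in diagonal coordinates: `E p m` is the `m`-th point, from below, on the
`p`-th antidiagonal with even coordinate sum, and `O p m` is the point directly below it. So
`O p 0` is the free end of the `p`-th external edge. -/
inductive Site : Type
  | E (p m : ℕ) : Site
  | O (p m : ℕ) : Site

/-- The lattice point named by a site. -/
def Site.pt : Site → ℤ × ℤ
  | .E p m => (2 * (p : ℤ) - m, m)
  | .O p m => (2 * (p : ℤ) - m, (m : ℤ) - 1)

theorem Site.pt_injective : Function.Injective Site.pt := by
  rintro (⟨p, m⟩ | ⟨p, m⟩) (⟨q, l⟩ | ⟨q, l⟩) h <;>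
    simp only [Site.pt, Prod.mk.injEq] at h <;>
    first
    | (exfalso; omega)
    | (obtain rfl : m = l := by omega
       obtain rfl : p = q := by omega
       rfl)

open Site

/-- A set of edges, given by the indicator functions of the four kinds of edges at the points
`E p m`: `LF p m` (left), `DN p m` (below), `RT p m` (right), while the edge above `E p m` has the
indicator `UA p (m + 1)`. The last shift lets the edges that arrive in `O (p + 1) (m + 1)`
from the antidiagonal of `E p m` have the indicators `RT p m` and `UA p m`. -/
@[ext] structure Bits where
  LF : ℕ → ℕ → ℕ
  DN : ℕ → ℕ → ℕ
  RT : ℕ → ℕ → ℕ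
  UA : ℕ → ℕ → ℕ

namespace Bits

/-- There is an edge between `E p m` and `O q l`. -/
def Link (c : Bits) (p m q l : ℕ) : Prop :=
  (q = p ∧ l = m ∧ c.DN p m = 1) ∨ (q = p ∧ l = m + 1 ∧ c.LF p m = 1) ∨
  (q = p + 1 ∧ l = m + 1 ∧ c.RT p m = 1) ∨ (q = p + 1 ∧ l = m + 2 ∧ c.UA p (m + 1) = 1)

/-- The adjacency relation of `Bits.graph`. -/
def Adjacent (c : Bits) : Site → Site → Prop
  | .E p m, .O q l => c.Link p m q l
  | .O q l, .E p m => c.Link p m q l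
  | _, _ => False

/-- The graph on sites with the given edges. -/
def graph (c : Bits) : SimpleGraph Site where
  Adj := c.Adjacent
  symm := ⟨by rintro (⟨p, m⟩ | ⟨p, m⟩) (⟨q, l⟩ | ⟨q, l⟩) h <;> exact h⟩
  loopless := ⟨by rintro (⟨p, m⟩ | ⟨p, m⟩) h <;> exact h⟩

variable {c : Bits}

theorem adj_EE {p m q l : ℕ} : ¬ c.graph.Adj (E p m) (E q l) := fun h => h
theorem adj_OO {p m q l : ℕ} : ¬ c.graph.Adj (O p m) (O q l) := fun h => h
theorem adj_EO {p m q l : ℕ} : c.graph.Adj (E p m) (O q l) ↔ c.Link p m q l := Iff.rfl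
theorem adj_OE {p m q l : ℕ} : c.graph.Adj (O q l) (E p m) ↔ c.Link p m q l := Iff.rfl

theorem adj_DN {p m : ℕ} : c.graph.Adj (E p m) (O p m) ↔ c.DN p m = 1 := by
  simp [adj_EO, Link]
theorem adj_LF {p m : ℕ} : c.graph.Adj (E p m) (O p (m + 1)) ↔ c.LF p m = 1 := by
  simp [adj_EO, Link]
theorem adj_RT {p m : ℕ} : c.graph.Adj (E p m) (O (p + 1) (m + 1)) ↔ c.RT p m = 1 := by
  simp [adj_EO, Link]
theorem adj_UA {p m : ℕ} : c.graph.Adj (E p m) (O (p + 1) (m + 2)) ↔ c.UA p (m + 1) = 1 := by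
  simp [adj_EO, Link]

/-- The indicators take the values `0` and `1`, and all edges are edges of the triangle of
size `n` or external edges. -/
structure Supp (c : Bits) (n : ℕ) : Prop where
  LF_le : ∀ p m, c.LF p m ≤ 1
  DN_le : ∀ p m, c.DN p m ≤ 1
  RT_le : ∀ p m, c.RT p m ≤ 1
  UA_le : ∀ p m, c.UA p m ≤ 1
  LF_supp : ∀ p m, c.LF p m ≠ 0 → m < p ∧ p < 2 * n
  DN_supp : ∀ p m, c.DN p m ≠ 0 → m ≤ p ∧ p < 2 * n
  RT_supp : ∀ p m, c.RT p m ≠ 0 → m ≤ p ∧ p + 1 < 2 * n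
  UA_supp : ∀ p m, c.UA p m ≠ 0 → 1 ≤ m ∧ m ≤ p ∧ p + 1 < 2 * n

/-- The local conditions on a configuration: degrees and boundary edges. Here `s i` says that the
`i`-th letter on the left boundary is `1`, and `z i` that the `i`-th letter on the right
boundary is `0`. -/
structure Local (c : Bits) (n : ℕ) (s z : ℕ → Prop) : Prop extends Supp c n where
  even : ∀ p m, m < p → p + 1 < 2 * n → c.LF p m + c.DN p m + c.RT p m + c.UA p (m + 1) = 2
  odd : ∀ p m, m ≤ p → p + 1 < 2 * n →
    c.DN (p + 1) (m + 1) + c.LF (p + 1) m + c.RT p m + c.UA p m = 2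
  DN_zero : ∀ p, p < 2 * n → c.DN p 0 = 1
  RT_left : ∀ p, p + 1 < 2 * n → c.RT p p = 1
  LF_right : ∀ m, m + 1 < 2 * n → c.LF (2 * n - 1) m = 1
  DN_left : ∀ p, p < 2 * n → (c.DN p p = 0 ↔ s p)
  DN_right : ∀ k, k < 2 * n → (c.DN (2 * n - 1) (2 * n - 1 - k) = 0 ↔ z k)

/-- The graph on lattice points with the given edges. -/
def pointGraph (c : Bits) : SimpleGraph (ℤ × ℤ) := c.graph.map Site.pt

theorem pointGraph_adj {x y : Site} : c.pointGraph.Adj x.pt y.pt ↔ c.graph.Adj x y :=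
  SimpleGraph.map_adj_apply (f := ⟨Site.pt, Site.pt_injective⟩)

theorem pointGraph_reachable {x y : Site} :
    c.pointGraph.Reachable x.pt y.pt ↔ c.graph.Reachable x y := by
  constructor
  · rintro ⟨w⟩
    have key : ∀ {a b : ℤ × ℤ} (_ : c.pointGraph.Walk a b), ∀ x : Site, x.pt = a →
        ∃ y : Site, y.pt = b ∧ c.graph.Reachable x y := by
      intro a b w
      induction w with
      | nil => intro x hx; exact ⟨x, hx, SimpleGraph.Reachable.refl _⟩
      | cons h _ ih =>
        intro x hx
        obtain ⟨-, u, v, huv, hu, rfl⟩ := h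
        obtain rfl : u = x := Site.pt_injective (hu.trans hx.symm)
        obtain ⟨y, hy, hr⟩ := ih v rfl
        exact ⟨y, hy, huv.reachable.trans hr⟩
    obtain ⟨y', hy', hr⟩ := key w x rfl
    obtain rfl := Site.pt_injective hy'
    exact hr
  · intro h
    exact h.map (SimpleGraph.Embedding.map ⟨Site.pt, Site.pt_injective⟩ c.graph).toHom

theorem pointGraph_neighborSet (x : Site) :
    (c.pointGraph.neighborSet x.pt).ncard = (c.graph.neighborSet x).ncard := by
  rw [← Set.ncard_image_of_injective (c.graph.neighborSet x) Site.pt_injective]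
  congr 1
  ext q
  constructor
  · rintro ⟨-, u, v, huv, hu, rfl⟩
    obtain rfl := Site.pt_injective hu
    exact ⟨v, huv, rfl⟩
  · rintro ⟨v, hv, rfl⟩
    exact pointGraph_adj.2 hv

theorem ncard_four {α : Type*} {a b c d : α} (hab : a ≠ b) (hac : a ≠ c) (had : a ≠ d)
    (hbc : b ≠ c) (hbd : b ≠ d) (hcd : c ≠ d) {w x y z : ℕ} (hw : w ≤ 1) (hx : x ≤ 1)
    (hy : y ≤ 1) (hz : z ≤ 1) :
    {q : α | (q = a ∧ w = 1) ∨ (q = b ∧ x = 1) ∨ (q = c ∧ y = 1) ∨ (q = d ∧ z = 1)}.ncard =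
      w + x + y + z := by
  classical
  have h : {q : α | (q = a ∧ w = 1) ∨ (q = b ∧ x = 1) ∨ (q = c ∧ y = 1) ∨ (q = d ∧ z = 1)} =
      ↑(({a, b, c, d} : Finset α).filter fun q =>
        (q = a ∧ w = 1) ∨ (q = b ∧ x = 1) ∨ (q = c ∧ y = 1) ∨ (q = d ∧ z = 1)) := by
    ext q
    simp only [Set.mem_ofPred_eq, Finset.coe_filter, Finset.mem_insert, Finset.mem_singleton]
    tauto
  have h' : ∀ {t : ℕ}, t ≤ 1 → (if t = 1 then 1 else 0) = t := by intro t ht; split_ifs <;> omega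
  rw [h, Set.ncard_coe_finset, Finset.card_filter, Finset.sum_insert (by simp [hab, hac, had]),
    Finset.sum_insert (by simp [hbc, hbd]), Finset.sum_insert (by simp [hcd]),
    Finset.sum_singleton]
  simp only [hab, hac, had, hbc, hbd, hcd, hab.symm, hac.symm, had.symm, hbc.symm, hbd.symm,
    hcd.symm, true_and, false_and, or_false, false_or, h' hw, h' hx, h' hy, h' hz]
  ring

theorem ncard_neighborSet_E {n : ℕ} (hc : c.Supp n) (p m : ℕ) :
    (c.graph.neighborSet (E p m)).ncard =
      c.LF p m + c.DN p m + c.RT p m + c.UA p (m + 1) := by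
  rw [← ncard_four (a := O p (m + 1)) (b := O p m) (c := O (p + 1) (m + 1)) (d := O (p + 1) (m + 2))
    (by simp) (by simp) (by simp) (by simp) (by simp) (by simp) (hc.LF_le _ _) (hc.DN_le _ _)
    (hc.RT_le _ _) (hc.UA_le _ _)]
  congr 1
  ext q
  rcases q with ⟨q, l⟩ | ⟨q, l⟩
  · simp [adj_EE]
  · simp only [SimpleGraph.mem_neighborSet, adj_EO, Link, Set.mem_ofPred_eq, O.injEq]
    tauto

theorem ncard_neighborSet_O {n : ℕ} (hc : c.Supp n) (p m : ℕ) :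
    (c.graph.neighborSet (O (p + 1) (m + 1))).ncard =
      c.DN (p + 1) (m + 1) + c.LF (p + 1) m + c.RT p m + c.UA p m := by
  rcases m with _ | m
  · have h0 : c.UA p 0 = 0 := by
      by_contra h
      have := hc.UA_supp p 0 h
      omega
    rw [← ncard_four (a := E (p + 1) 1) (b := E (p + 1) 0) (c := E p 0) (d := O 0 0)
      (by simp) (by simp) (by simp) (by simp) (by simp) (by simp) (hc.DN_le _ _) (hc.LF_le _ _)
      (hc.RT_le _ _) (hc.UA_le _ _)]
    congr 1
    ext q
    rcases q with ⟨q, l⟩ | ⟨q, l⟩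
    · simp only [SimpleGraph.mem_neighborSet, adj_OE, Link, Set.mem_ofPred_eq, E.injEq, h0]
      constructor
      · rintro (⟨h1, h2, h3⟩ | ⟨h1, h2, h3⟩ | ⟨h1, h2, h3⟩ | ⟨h1, h2, h3⟩)
        · subst h1; subst h2; simp_all
        · obtain rfl : l = 0 := by omega
          subst h1; simp_all
        · obtain rfl : l = 0 := by omega
          obtain rfl : q = p := by omega
          simp_all
        · omega
      · rintro (⟨⟨rfl, rfl⟩, h3⟩ | ⟨⟨rfl, rfl⟩, h3⟩ | ⟨⟨rfl, rfl⟩, h3⟩ | ⟨h1, h2⟩) <;> simp_all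
    · simp [adj_OO, h0]
  · rw [← ncard_four (a := E (p + 1) (m + 2)) (b := E (p + 1) (m + 1)) (c := E p (m + 1))
      (d := E p m)
      (by simp) (by simp) (by simp) (by simp) (by simp) (by simp) (hc.DN_le _ _) (hc.LF_le _ _)
      (hc.RT_le _ _) (hc.UA_le _ _)]
    congr 1
    ext q
    rcases q with ⟨q, l⟩ | ⟨q, l⟩
    · simp only [SimpleGraph.mem_neighborSet, adj_OE, Link, Set.mem_ofPred_eq, E.injEq]
      constructor
      · rintro (⟨h1, h2, h3⟩ | ⟨h1, h2, h3⟩ | ⟨h1, h2, h3⟩ | ⟨h1, h2, h3⟩)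
        · subst h1; subst h2; simp_all
        · obtain rfl : l = m + 1 := by omega
          subst h1; simp_all
        · obtain rfl : l = m + 1 := by omega
          obtain rfl : q = p := by omega
          simp_all
        · obtain rfl : l = m := by omega
          obtain rfl : q = p := by omega
          simp_all
      · rintro (⟨⟨rfl, rfl⟩, h3⟩ | ⟨⟨rfl, rfl⟩, h3⟩ | ⟨⟨rfl, rfl⟩, h3⟩ | ⟨⟨rfl, rfl⟩, h3⟩) <;> simp_all
    · simp [adj_OO]

end Bits

theorem inTriangle_E {n p m : ℕ} : InTriangle n (E p m).pt ↔ m ≤ p ∧ p < 2 * n := by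
  simp only [InTriangle, Site.pt]; omega

theorem inTriangle_O {n p m : ℕ} : InTriangle n (O p m).pt ↔ 1 ≤ m ∧ m ≤ p ∧ p < 2 * n := by
  simp only [InTriangle, Site.pt]; omega

theorem isExternalEnd_O {n p m : ℕ} : IsExternalEnd n (O p m).pt ↔ m = 0 ∧ p < 2 * n := by
  simp only [IsExternalEnd, Site.pt, Prod.mk.injEq]
  constructor
  · rintro ⟨i, h1, h2, h3⟩; omega
  · rintro ⟨rfl, h⟩; exact ⟨p, h, by simp, by simp⟩

theorem not_isExternalEnd_E {n p m : ℕ} : ¬ IsExternalEnd n (E p m).pt := by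
  simp only [IsExternalEnd, Site.pt, Prod.mk.injEq]
  rintro ⟨i, h1, h2, h3⟩; omega

theorem exists_site {n : ℕ} {q : ℤ × ℤ} (h : InTriangle n q ∨ IsExternalEnd n q) :
    ∃ x : Site, x.pt = q := by
  obtain ⟨x, y⟩ := q
  have h' : -1 ≤ y ∧ y ≤ x := by
    rcases h with h | ⟨i, hi, h⟩
    · simp only [InTriangle] at h; omega
    · simp only [Prod.mk.injEq] at h; omega
  rcases Int.even_or_odd' (x + y) with ⟨k, hk | hk⟩
  · refine ⟨E k.toNat y.toNat, ?_⟩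
    have : 0 ≤ y := by
      rcases h with h | ⟨i, hi, h⟩
      · exact h.1
      · simp only [Prod.mk.injEq] at h; omega
    simp only [Site.pt, Prod.mk.injEq]; omega
  · refine ⟨O (k + 1).toNat (y + 1).toNat, ?_⟩
    simp only [Site.pt, Prod.mk.injEq]; omega

theorem abs_add_abs_eq_one {x y : ℤ} (h : |x| + |y| = 1) :
    (x = 0 ∧ (y = 1 ∨ y = -1)) ∨ (y = 0 ∧ (x = 1 ∨ x = -1)) := by
  rcases abs_choice x with h1 | h1 <;> rcases abs_choice y with h2 | h2 <;>
    have := abs_nonneg x <;> have := abs_nonneg y <;> omega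

theorem exists_bits {n : ℕ} {f : SimpleGraph (ℤ × ℤ)} (hf : f ≤ triangleGraph n) :
    ∃ c : Bits, c.Supp n ∧ c.pointGraph = f := by
  classical
  let c : Bits :=
    { LF := fun p m => if m < p ∧ p < 2 * n ∧ f.Adj (E p m).pt (O p (m + 1)).pt then 1 else 0
      DN := fun p m => if m ≤ p ∧ p < 2 * n ∧ f.Adj (E p m).pt (O p m).pt then 1 else 0
      RT := fun p m => if m ≤ p ∧ p + 1 < 2 * n ∧ f.Adj (E p m).pt (O (p + 1) (m + 1)).pt
        then 1 else 0
      UA := fun p m => if 1 ≤ m ∧ m ≤ p ∧ p + 1 < 2 * n ∧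
        f.Adj (E p (m - 1)).pt (O (p + 1) (m + 1)).pt then 1 else 0 }
  have hEO : ∀ p m q l, f.Adj (E p m).pt (O q l).pt ↔ c.Link p m q l := by
    intro p m q l
    simp only [Bits.Link, c, ite_eq_left_iff, zero_ne_one, imp_false, not_not]
    constructor
    · intro h
      obtain ⟨h1, h2, h3⟩ := hf h
      have h2' : m ≤ p ∧ p < 2 * n := inTriangle_E.1 (h2.resolve_right not_isExternalEnd_E)
      have h3' : l ≤ q ∧ q < 2 * n := by
        rcases h3 with h3 | h3
        · exact (inTriangle_O.1 h3).2
        · have := isExternalEnd_O.1 h3; omega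
      simp only [Site.pt] at h1
      rcases abs_add_abs_eq_one h1 with ⟨h4, h5 | h5⟩ | ⟨h4, h5 | h5⟩
      · left
        obtain rfl : l = m := by omega
        obtain rfl : q = p := by omega
        exact ⟨rfl, rfl, by omega, by omega, h⟩
      · right; right; right
        obtain rfl : l = m + 2 := by omega
        obtain rfl : q = p + 1 := by omega
        exact ⟨rfl, rfl, by omega, by omega, by omega, h⟩
      · right; left
        obtain rfl : l = m + 1 := by omega
        obtain rfl : q = p := by omega
        exact ⟨rfl, rfl, by omega, by omega, h⟩
      · right; right; left
        obtain rfl : l = m + 1 := by omega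
        obtain rfl : q = p + 1 := by omega
        exact ⟨rfl, rfl, by omega, by omega, h⟩
    · rintro (⟨rfl, rfl, h⟩ | ⟨rfl, rfl, h⟩ | ⟨rfl, rfl, h⟩ | ⟨rfl, rfl, h⟩)
      exacts [h.2.2, h.2.2, h.2.2, h.2.2.2]
  refine ⟨c, ⟨?_, ?_, ?_, ?_, ?_, ?_, ?_, ?_⟩, ?_⟩
  iterate 4 (intro p m; simp only [c]; split_ifs <;> omega)
  iterate 4 (intro p m; simp only [c, ne_eq, ite_eq_right_iff, one_ne_zero, imp_false, not_not]; tauto)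
  ext x y
  constructor
  · rintro ⟨-, u, v, huv, rfl, rfl⟩
    rcases u with ⟨p, m⟩ | ⟨p, m⟩ <;> rcases v with ⟨q, l⟩ | ⟨q, l⟩
    · exact absurd huv Bits.adj_EE
    · exact (hEO _ _ _ _).2 huv
    · exact ((hEO _ _ _ _).2 huv).symm
    · exact absurd huv Bits.adj_OO
  · intro h
    obtain ⟨h1, h2, h3⟩ := hf h
    obtain ⟨u, rfl⟩ := exists_site h2
    obtain ⟨v, rfl⟩ := exists_site h3
    rw [Bits.pointGraph_adj]
    rcases u with ⟨p, m⟩ | ⟨p, m⟩ <;> rcases v with ⟨q, l⟩ | ⟨q, l⟩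
    · simp only [Site.pt] at h1
      have := abs_add_abs_eq_one h1
      omega
    · exact (hEO _ _ _ _).1 h
    · exact (hEO _ _ _ _).1 h.symm
    · simp only [Site.pt] at h1
      have := abs_add_abs_eq_one h1
      omega

theorem pointGraph_injOn (n : ℕ) : Set.InjOn Bits.pointGraph {c | c.Supp n} := by
  intro c hc d hd h
  have key : ∀ x y, c.graph.Adj x y ↔ d.graph.Adj x y := fun x y => by
    rw [← Bits.pointGraph_adj, ← Bits.pointGraph_adj, h]
  have h01 : ∀ {x y : ℕ}, x ≤ 1 → y ≤ 1 → (x = 1 ↔ y = 1) → x = y := by intros; omega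
  ext p m
  · exact h01 (hc.LF_le _ _) (hd.LF_le _ _) (Bits.adj_LF.symm.trans ((key _ _).trans Bits.adj_LF))
  · exact h01 (hc.DN_le _ _) (hd.DN_le _ _) (Bits.adj_DN.symm.trans ((key _ _).trans Bits.adj_DN))
  · exact h01 (hc.RT_le _ _) (hd.RT_le _ _) (Bits.adj_RT.symm.trans ((key _ _).trans Bits.adj_RT))
  · rcases m with _ | m
    · have h1 : c.UA p 0 = 0 := by
        by_contra h
        have := hc.UA_supp p 0 h
        omega
      have h2 : d.UA p 0 = 0 := by
        by_contra h
        have := hd.UA_supp p 0 h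
        omega
      rw [h1, h2]
    · exact h01 (hc.UA_le _ _) (hd.UA_le _ _) (Bits.adj_UA.symm.trans ((key _ _).trans Bits.adj_UA))

/-- The conditions on the paths of a configuration: the external edges are matched by `M`, and
a path that starts at a letter `1` on the left ends at a letter `0` on the right. -/
structure Bits.Linked (c : Bits) (n : ℕ) (s z : ℕ → Prop) (M : ℕ → ℕ → Prop) : Prop where
  bottom : ∀ i j, i < j → j < 2 * n → (c.graph.Reachable (O i 0) (O j 0) ↔ M i j)
  cross : ∀ i, i < 2 * n → s i →
    ∃ j, j < 2 * n ∧ z j ∧ c.graph.Reachable (E i i) (E (2 * n - 1) (2 * n - 1 - j))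

theorem letter_cases {w : Word} {i : ℕ} (h : i < w.length) : w[i]? = some 0 ∨ w[i]? = some 1 := by
  rw [List.getElem?_eq_getElem h]
  generalize w[i] = x
  fin_cases x <;> simp

theorem pointGraph_le_iff {n : ℕ} {c : Bits} (hc : c.Supp n) : c.pointGraph ≤ triangleGraph n := by
  have key : ∀ p m q l, c.Link p m q l → (triangleGraph n).Adj (E p m).pt (O q l).pt := by
    intro p m q l h
    have h1 : m ≤ p ∧ p < 2 * n ∧ l ≤ q ∧ q < 2 * n := by
      rcases h with ⟨rfl, rfl, h⟩ | ⟨rfl, rfl, h⟩ | ⟨rfl, rfl, h⟩ | ⟨rfl, rfl, h⟩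
      · have := hc.DN_supp _ _ (h.trans_ne one_ne_zero); omega
      · have := hc.LF_supp _ _ (h.trans_ne one_ne_zero); omega
      · have := hc.RT_supp _ _ (h.trans_ne one_ne_zero); omega
      · have := hc.UA_supp _ _ (h.trans_ne one_ne_zero); omega
    refine ⟨?_, Or.inl (inTriangle_E.2 ⟨h1.1, h1.2.1⟩), ?_⟩
    · simp only [Site.pt]
      rcases h with ⟨rfl, rfl, h⟩ | ⟨rfl, rfl, h⟩ | ⟨rfl, rfl, h⟩ | ⟨rfl, rfl, h⟩ <;> push_cast
      · ring_nf; simp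
      · ring_nf; simp
      · ring_nf; simp
      · ring_nf; simp
    · rcases Nat.eq_zero_or_pos l with rfl | hl
      · exact Or.inr (isExternalEnd_O.2 ⟨rfl, h1.2.2.2⟩)
      · exact Or.inl (inTriangle_O.2 ⟨hl, h1.2.2⟩)
  intro x y h
  obtain ⟨-, u, v, huv, rfl, rfl⟩ := h
  rcases u with ⟨p, m⟩ | ⟨p, m⟩ <;> rcases v with ⟨q, l⟩ | ⟨q, l⟩
  · exact absurd huv Bits.adj_EE
  · exact key _ _ _ _ huv
  · exact (key _ _ _ _ huv).symm
  · exact absurd huv Bits.adj_OO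

/-- The definition of a configuration in terms of its bits. -/
theorem isTFPL_pointGraph_iff {n : ℕ} {σ π τ : Word} (hσ : σ.length = 2 * n)
    (hτ : τ.length = 2 * n) {c : Bits} (hc : c.Supp n) :
    IsTFPL n σ π τ c.pointGraph ↔
      c.Local n (fun i => σ[i]? = some 1) (fun i => τ[i]? = some 0) ∧
      c.Linked n (fun i => σ[i]? = some 1) (fun i => τ[i]? = some 0) (Matched π) := by
  have hbot : ∀ i : ℕ, bottomEnd i = (O i 0).pt := fun i => by simp [bottomEnd, Site.pt]
  have hleft : ∀ i : ℕ, leftVertex i = (E i i).pt := fun i => by simp [leftVertex, Site.pt]; ring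
  have hext : ∀ i : ℕ, ((2 * (i : ℤ), 0) : ℤ × ℤ) = (E i 0).pt := fun i => by simp [Site.pt]
  have hlh : ∀ i : ℕ, (((i : ℤ) + 1, (i : ℤ)) : ℤ × ℤ) = (O (i + 1) (i + 1)).pt := fun i => by
    simp [Site.pt]; ring
  have hlv : ∀ i : ℕ, (((i : ℤ), (i : ℤ) - 1) : ℤ × ℤ) = (O i i).pt := fun i => by
    simp [Site.pt]; ring
  have hright : ∀ i : ℕ, i < 2 * n → rightVertex n i = (E (2 * n - 1) (2 * n - 1 - i)).pt :=
    fun i hi => by simp only [rightVertex, Site.pt, Prod.mk.injEq]; omega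
  have hrh : ∀ i : ℕ, 1 ≤ i → i < 2 * n →
      ((2 * (n : ℤ) - 2 + i, 2 * (n : ℤ) - 1 - i) : ℤ × ℤ) =
        (O (2 * n - 1) (2 * n - 1 - i + 1)).pt :=
    fun i h1 hi => by simp only [Site.pt, Prod.mk.injEq]; omega
  have hrv : ∀ i : ℕ, i < 2 * n →
      ((2 * (n : ℤ) - 1 + i, 2 * (n : ℤ) - 2 - i) : ℤ × ℤ) = (O (2 * n - 1) (2 * n - 1 - i)).pt :=
    fun i hi => by simp only [Site.pt, Prod.mk.injEq]; omega
  have h01 : ∀ i, i < 2 * n → (σ[i]? = some 0 ↔ ¬ σ[i]? = some 1) := fun i hi => by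
    rcases letter_cases (w := σ) (i := i) (by omega) with h | h <;> simp [h]
  have t01 : ∀ i, i < 2 * n → (τ[i]? = some 1 ↔ ¬ τ[i]? = some 0) := fun i hi => by
    rcases letter_cases (w := τ) (i := i) (by omega) with h | h <;> simp [h]
  constructor
  · intro h
    refine ⟨⟨hc, fun p m hmp hp => ?_, fun p m hmp hp => ?_, fun p hp => ?_, fun p hp => ?_,
      fun m hm => ?_, fun p hp => ?_, fun k hk => ?_⟩, ⟨fun i j hij hj => ?_, fun i hi hs => ?_⟩⟩
    · rw [← Bits.ncard_neighborSet_E hc, ← Bits.pointGraph_neighborSet]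
      refine h.interior _ (inTriangle_E.2 ⟨by omega, by omega⟩) ?_ ?_ <;>
        simp only [Site.pt] <;> omega
    · rw [← Bits.ncard_neighborSet_O hc, ← Bits.pointGraph_neighborSet]
      refine h.interior _ (inTriangle_O.2 ⟨by omega, by omega⟩) ?_ ?_ <;>
        simp only [Site.pt] <;> omega
    · have := h.external p hp
      rw [hext, hbot, Bits.pointGraph_adj, Bits.adj_DN] at this
      exact this
    · have := h.left_horizontal p hp
      rw [hleft, hlh, Bits.pointGraph_adj, Bits.adj_RT] at this
      exact this
    · have := h.right_horizontal (2 * n - 1 - m) (by omega) (by omega)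
      rw [hright _ (by omega), hrh _ (by omega) (by omega), Bits.pointGraph_adj, Bits.adj_LF] at this
      rwa [show 2 * n - 1 - (2 * n - 1 - m) = m by omega] at this
    · have h1 := h.left_vertical p hp
      rw [hleft, hlv, Bits.pointGraph_adj, Bits.adj_DN, h01 p hp] at h1
      have := hc.DN_le p p
      by_cases h2 : σ[p]? = some 1
      · simp only [h2, not_true, iff_false, iff_true] at h1 ⊢; omega
      · simp only [h2, not_false_eq_true, iff_true, iff_false] at h1 ⊢; omega
    · have h1 := h.right_vertical k hk
      rw [hright _ hk, hrv _ hk, Bits.pointGraph_adj, Bits.adj_DN, t01 k hk] at h1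
      have := hc.DN_le (2 * n - 1) (2 * n - 1 - k)
      by_cases h2 : τ[k]? = some 0
      · simp only [h2, not_true, iff_false, iff_true] at h1 ⊢; omega
      · simp only [h2, not_false_eq_true, iff_true, iff_false] at h1 ⊢; omega
    · rw [← h.bottom_link i j hij hj, hbot, hbot, Bits.pointGraph_reachable]
    · obtain ⟨j, hj, hz, hr⟩ := h.cross_link i hi hs
      rw [hleft, hright _ hj, Bits.pointGraph_reachable] at hr
      exact ⟨j, hj, hz, hr⟩
  · rintro ⟨h, hl⟩
    refine ⟨pointGraph_le_iff hc, fun i hi => ?_, fun q hq h1 h2 => ?_, fun i hi => ?_,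
      fun i hi => ?_, fun i h1 hi => ?_, fun i hi => ?_, fun i j hij hj => ?_, fun i hi hs => ?_⟩
    · rw [hext, hbot, Bits.pointGraph_adj, Bits.adj_DN]
      exact h.DN_zero i hi
    · obtain ⟨x, rfl⟩ := exists_site (Or.inl hq)
      rw [Bits.pointGraph_neighborSet]
      rcases x with ⟨p, m⟩ | ⟨p, m⟩
      · rw [Bits.ncard_neighborSet_E hc]
        rw [inTriangle_E] at hq
        simp only [Site.pt] at h1 h2
        exact h.even p m (by omega) (by omega)
      · rw [inTriangle_O] at hq
        obtain ⟨p, rfl⟩ : ∃ p', p = p' + 1 := ⟨p - 1, by omega⟩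
        obtain ⟨m, rfl⟩ : ∃ m', m = m' + 1 := ⟨m - 1, by omega⟩
        rw [Bits.ncard_neighborSet_O hc]
        exact h.odd p m (by omega) (by omega)
    · rw [hleft, hlh, Bits.pointGraph_adj, Bits.adj_RT]
      exact h.RT_left i hi
    · rw [hleft, hlv, Bits.pointGraph_adj, Bits.adj_DN, h01 i hi, ← h.DN_left i hi]
      have := hc.DN_le i i
      omega
    · rw [hright _ (by omega), hrh _ (by omega) (by omega), Bits.pointGraph_adj, Bits.adj_LF]
      exact h.LF_right _ (by omega)
    · rw [hright _ hi, hrv _ hi, Bits.pointGraph_adj, Bits.adj_DN, t01 i hi, ← h.DN_right i hi]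
      have := hc.DN_le (2 * n - 1) (2 * n - 1 - i)
      omega
    · rw [hbot, hbot, Bits.pointGraph_reachable]
      exact hl.bottom i j hij hj
    · obtain ⟨j, hj, hz, hr⟩ := hl.cross i hi hs
      refine ⟨j, hj, hz, ?_⟩
      rw [hleft, hright _ hj, Bits.pointGraph_reachable]
      exact hr

/-- Configurations may be counted in coordinates. -/
theorem t_eq_ncard_bits {n : ℕ} {σ π τ : Word} (hσ : σ.length = 2 * n) (hτ : τ.length = 2 * n) :
    t n σ π τ =
      {c : Bits | c.Local n (fun i => σ[i]? = some 1) (fun i => τ[i]? = some 0) ∧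
        c.Linked n (fun i => σ[i]? = some 1) (fun i => τ[i]? = some 0) (Matched π)}.ncard := by
  rw [t, ← Set.InjOn.ncard_image (f := Bits.pointGraph)
    (s := {c : Bits | c.Local n (fun i => σ[i]? = some 1) (fun i => τ[i]? = some 0) ∧
        c.Linked n (fun i => σ[i]? = some 1) (fun i => τ[i]? = some 0) (Matched π)})]
  · congr 1
    ext f
    constructor
    · intro hf
      have hf' : IsTFPL n σ π τ f := hf
      obtain ⟨c, hc, rfl⟩ := exists_bits hf'.le
      exact ⟨c, (isTFPL_pointGraph_iff hσ hτ hc).1 hf', rfl⟩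
    · rintro ⟨c, h, rfl⟩
      exact (isTFPL_pointGraph_iff hσ hτ h.1.toSupp).2 h
  · exact (pointGraph_injOn n).mono fun c h => h.1.toSupp

/-- The degree bound in coordinates. -/
theorem Bits.Local.degree_le {c : Bits} {n : ℕ} {s z : ℕ → Prop} (h : c.Local n s z)
    (w x y v : Site) (h1 : c.graph.Adj w x) (h2 : c.graph.Adj w y) (h3 : c.graph.Adj w v) :
    x = y ∨ x = v ∨ y = v := by
  have key : ∀ w, (c.graph.neighborSet w).Finite → (c.graph.neighborSet w).ncard ≤ 2 →
      ∀ x y v, c.graph.Adj w x → c.graph.Adj w y → c.graph.Adj w v → x = y ∨ x = v ∨ y = v := by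
    intro w hf hw x y v h1 h2 h3
    by_contra! hne
    have : ({x, y, v} : Set Site).ncard ≤ 2 :=
      (Set.ncard_le_ncard (by rintro q (rfl | rfl | rfl) <;> assumption) hf).trans hw
    rw [Set.ncard_eq_three.2 ⟨x, y, v, hne.1, hne.2.1, hne.2.2, rfl⟩] at this
    omega
  have hsupp := h.toSupp
  refine key w ?_ ?_ x y v h1 h2 h3
  · rcases w with ⟨p, m⟩ | ⟨p, m⟩
    · refine (Set.toFinite {O p m, O p (m + 1), O (p + 1) (m + 1), O (p + 1) (m + 2)}).subset ?_
      rintro (⟨q, l⟩ | ⟨q, l⟩) hq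
      · exact False.elim hq
      · rcases hq with ⟨rfl, rfl, -⟩ | ⟨rfl, rfl, -⟩ | ⟨rfl, rfl, -⟩ | ⟨rfl, rfl, -⟩ <;> simp
    · refine (Set.toFinite {E p m, E p (m - 1), E (p - 1) (m - 1), E (p - 1) (m - 2)}).subset ?_
      rintro (⟨q, l⟩ | ⟨q, l⟩) hq
      · rcases hq with ⟨rfl, rfl, -⟩ | ⟨rfl, rfl, -⟩ | ⟨rfl, rfl, -⟩ | ⟨rfl, rfl, -⟩ <;> simp
      · exact False.elim hq
  · rcases w with ⟨p, m⟩ | ⟨p, m⟩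
    · rw [ncard_neighborSet_E hsupp]
      have h1 := hsupp.LF_supp p m
      have h2 := hsupp.DN_supp p m
      have h3 := hsupp.RT_supp p m
      have h4 := hsupp.UA_supp p (m + 1)
      have h5 := hsupp.LF_le p m
      have h6 := hsupp.DN_le p m
      have h7 := hsupp.RT_le p m
      have h8 := hsupp.UA_le p (m + 1)
      by_cases h9 : m < p ∧ p + 1 < 2 * n
      · exact (h.even p m h9.1 h9.2).le
      · by_cases h10 : c.LF p m = 0
        · by_cases h11 : c.UA p (m + 1) = 0
          · omega
          · have := h4 h11; omega
        · have := h1 h10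
          by_cases h11 : c.UA p (m + 1) = 0
          · by_cases h12 : c.RT p m = 0
            · omega
            · have := h3 h12; omega
          · have := h4 h11; omega
    · rcases p with _ | p
      · have h0 : c.graph.neighborSet (O 0 m) ⊆ {E 0 m} := by
          rintro (⟨q, l⟩ | ⟨q, l⟩) hq
          · rcases hq with ⟨rfl, rfl, h9⟩ | ⟨rfl, rfl, h9⟩ | ⟨h9, -⟩ | ⟨h9, -⟩
            · rfl
            · have := hsupp.LF_supp _ _ (h9.trans_ne one_ne_zero); omega
            · omega
            · omega
          · exact False.elim hq
        have := Set.ncard_le_ncard h0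
        rw [Set.ncard_singleton] at this; omega
      · rcases m with _ | m
        · have h0 : c.graph.neighborSet (O (p + 1) 0) ⊆ {E (p + 1) 0} := by
            rintro (⟨q, l⟩ | ⟨q, l⟩) hq
            · rcases hq with ⟨rfl, rfl, h9⟩ | ⟨h9, h10, h11⟩ | ⟨h9, h10, h11⟩ | ⟨h9, h10, h11⟩
              · rfl
              all_goals omega
            · exact False.elim hq
          have := Set.ncard_le_ncard h0
          rw [Set.ncard_singleton] at this; omega
        · rw [ncard_neighborSet_O hsupp]
          by_cases h9 : m ≤ p ∧ p + 1 < 2 * n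
          · exact (h.odd p m h9.1 h9.2).le
          · have h1 := hsupp.LF_supp (p + 1) m
            have h2 := hsupp.DN_supp (p + 1) (m + 1)
            have h3 := hsupp.RT_supp p m
            have h4 := hsupp.UA_supp p m
            have h5 : c.LF (p + 1) m = 0 := by by_contra h; have := h1 h; omega
            have h6 : c.DN (p + 1) (m + 1) = 0 := by by_contra h; have := h2 h; omega
            have h7 : c.RT p m = 0 := by by_contra h; have := h3 h; omega
            have h8 : c.UA p m = 0 := by by_contra h; have := h4 h; omega
            omega

/-! ### The boundary data -/

/-- The boundary data of the configurations to be counted, in the form used by the proof. The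
positions `p < U` belong to the word `u`, the positions `U ≤ p < U + a + b` to the middle part
and the other ones below `2 * n` to `v`; `u0` and `u1` count the letters of `u`. -/
structure Datum where
  n : ℕ
  U : ℕ
  u0 : ℕ
  u1 : ℕ
  a : ℕ
  b : ℕ
  /-- The letter of `π` is `1`. -/
  one : ℕ → Prop
  /-- The letter of `σ` is `1`. -/
  s : ℕ → Prop
  /-- The letter of `τ` is `0`. -/
  z : ℕ → Prop
  /-- The number of letters `1` of `u` and `v` before a position. -/
  c : ℕ → ℕ
  /-- The number of letters `1` of `σ` before a position. -/
  sc : ℕ → ℕ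
  U_eq : U = u0 + u1
  U_pos : 0 < U
  P_lt : U + a + b < 2 * n
  c_zero : c 0 = 0
  c_one : ∀ p, p < 2 * n → (p < U ∨ U + a + b ≤ p) → one p → c (p + 1) = c p + 1
  c_not : ∀ p, p < 2 * n → (p < U ∨ U + a + b ≤ p) → ¬ one p → c (p + 1) = c p
  c_mid : ∀ p, U ≤ p → p < U + a + b → c (p + 1) = c p
  c_U : c U = u1
  c_end : c (2 * n) + b = n
  dyck_left : ∀ p, p ≤ U → 2 * c p ≤ p
  dyck_right : ∀ p, U + a + b ≤ p → p ≤ 2 * n → 2 * (c p + b) ≤ p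
  dyck_mid : 2 * (u1 + b) ≤ U + b
  mid_one : ∀ p, U ≤ p → p < U + b → one p
  mid_zero : ∀ p, U + b ≤ p → p < U + a + b → ¬ one p
  s_iff : ∀ p, p < 2 * n → (p < U ∨ U + a + b ≤ p) → (s p ↔ one p)
  one_last : one (2 * n - 1)
  z_left : ∀ k, k + a < n → z k
  z_right : ∀ k, n + b ≤ k → k < 2 * n → ¬ z k
  sc_zero : sc 0 = 0
  sc_one : ∀ p, p < 2 * n → s p → sc (p + 1) = sc p + 1
  sc_not : ∀ p, p < 2 * n → ¬ s p → sc (p + 1) = sc p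
  sc_P : sc (U + a + b) = u1 + b
  card_eq : {k | k < 2 * n ∧ z k}.ncard ≤ {i | i < 2 * n ∧ s i}.ncard

namespace Datum

variable (D : Datum)

theorem u0_pos : 0 < D.u0 := by
  have h1 := D.dyck_left D.U le_rfl
  have := D.c_U
  have := D.U_pos
  have := D.U_eq
  omega

theorem s_last : D.s (2 * D.n - 1) := by
  have := D.P_lt
  exact (D.s_iff _ (by omega) (by omega)).2 D.one_last

theorem c_of_mid {p : ℕ} (h1 : D.U ≤ p) (h2 : p ≤ D.U + D.a + D.b) : D.c p = D.u1 := by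
  induction p, h1 using Nat.le_induction with
  | base => exact D.c_U
  | succ p hp ih => rw [D.c_mid p hp (by omega)]; exact ih (by omega)

theorem c_lt {p : ℕ} (hp : p < 2 * D.n) (h : p < D.U ∨ D.U + D.a + D.b ≤ p) (h1 : D.one p) :
    D.c p < p := by
  have h2 := D.c_one p hp h h1
  rcases h with h | h
  · have := D.dyck_left (p + 1) h; omega
  · have := D.dyck_right (p + 1) (by omega) (by omega); omega

theorem c_le {p : ℕ} (hp : p ≤ 2 * D.n) : D.c p ≤ p := by
  rcases Nat.lt_or_ge p D.U with h | h
  · have := D.dyck_left p h.le; omega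
  · rcases Nat.lt_or_ge p (D.U + D.a + D.b) with h' | h'
    · rw [D.c_of_mid h h'.le]; have := D.U_eq; omega
    · have := D.dyck_right p h' hp; omega

end Datum

/-! ### Unlinked end points -/

section Unlinked

theorem eq_of_reachable_of_isolated {V : Type*} {f : SimpleGraph V} {x y : V}
    (hx : ∀ w, ¬ f.Adj x w) (h : f.Reachable x y) : x = y := by
  obtain ⟨w⟩ := h
  cases w with
  | nil => rfl
  | cons h' _ => exact absurd h' (hx _)

variable {D : Datum} {g : Bits} {M : ℕ → ℕ → Prop}

/-- External end points have one neighbor. -/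
theorem X_end {p : ℕ} {x y : Site} (h1 : g.graph.Adj (O p 0) x) (h2 : g.graph.Adj (O p 0) y) :
    x = y := by
  have key : ∀ x, g.graph.Adj (O p 0) x → x = E p 0 := by
    rintro (⟨q, l⟩ | ⟨q, l⟩) h
    · rcases h with ⟨rfl, rfl, -⟩ | ⟨h1, h2, -⟩ | ⟨h1, h2, -⟩ | ⟨h1, h2, -⟩
      · rfl
      all_goals omega
    · exact False.elim h
  rw [key x h1, key y h2]

/-- The only edge at a left end point with letter `1` goes to the right. -/
theorem L_adj (hL : g.Local D.n D.s D.z) {p : ℕ} (hp : p < 2 * D.n) (hs : D.s p) {x : Site}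
    (h : g.graph.Adj (E p p) x) : x = O (p + 1) (p + 1) ∧ p + 1 < 2 * D.n := by
  rcases x with ⟨q, l⟩ | ⟨q, l⟩
  · exact False.elim h
  · rcases h with ⟨rfl, rfl, h⟩ | ⟨rfl, rfl, h⟩ | ⟨rfl, rfl, h⟩ | ⟨rfl, rfl, h⟩
    · have := (hL.DN_left _ hp).2 hs; omega
    · have := hL.LF_supp _ _ (h.trans_ne one_ne_zero); omega
    · have := hL.RT_supp _ _ (h.trans_ne one_ne_zero); exact ⟨rfl, by omega⟩
    · have := hL.UA_supp _ _ (h.trans_ne one_ne_zero); omega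

/-- The only edge at a right end point with letter `0` goes to the left. -/
theorem R_adj (hL : g.Local D.n D.s D.z) {k : ℕ} (hk : k < 2 * D.n) (hz : D.z k) {x : Site}
    (h : g.graph.Adj (E (2 * D.n - 1) (2 * D.n - 1 - k)) x) :
    x = O (2 * D.n - 1) (2 * D.n - 1 - k + 1) := by
  rcases x with ⟨q, l⟩ | ⟨q, l⟩
  · exact False.elim h
  · rcases h with ⟨rfl, rfl, h⟩ | ⟨rfl, rfl, h⟩ | ⟨rfl, rfl, h⟩ | ⟨rfl, rfl, h⟩
    · have := (hL.DN_right _ hk).2 hz; omega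
    · rfl
    · have := hL.RT_supp _ _ (h.trans_ne one_ne_zero); omega
    · have := hL.UA_supp _ _ (h.trans_ne one_ne_zero); omega

theorem apex_isolated (hL : g.Local D.n D.s D.z) (w : Site) :
    ¬ g.graph.Adj (E (2 * D.n - 1) (2 * D.n - 1)) w := fun h => by
  have h1 := D.P_lt
  have := L_adj hL (p := 2 * D.n - 1) (by omega) D.s_last h
  omega

/-- A left end point with letter `1` is linked only to one other end point, on the right. -/
theorem eq_of_L_reachable (hL : g.Local D.n D.s D.z) (hK : g.Linked D.n D.s D.z M) {i : ℕ}
    (hi : i < 2 * D.n) (hs : D.s i) : ∃ j, j < 2 * D.n ∧ D.z j ∧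
      g.graph.Reachable (E i i) (E (2 * D.n - 1) (2 * D.n - 1 - j)) ∧
      ∀ x, (∀ y y', g.graph.Adj x y → g.graph.Adj x y' → y = y') → g.graph.Reachable (E i i) x →
        x = E i i ∨ x = E (2 * D.n - 1) (2 * D.n - 1 - j) := by
  obtain ⟨j, hj, hz, hr⟩ := hK.cross i hi hs
  refine ⟨j, hj, hz, hr, fun x hx hrx => ?_⟩
  by_cases h1 : i = 2 * D.n - 1
  · subst h1
    left
    exact (eq_of_reachable_of_isolated (apex_isolated hL) hrx).symm
  · by_cases h2 : E i i = x
    · exact Or.inl h2.symm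
    right
    refine eq_of_reachable_ends hL.degree_le (a := E i i) ?_ hx ?_ hrx hr h2 ?_
    · intro p q hp hq
      rw [(L_adj hL hi hs hp).1, (L_adj hL hi hs hq).1]
    · intro p q hp hq
      rw [R_adj hL hj hz hp, R_adj hL hj hz hq]
    · intro h
      simp only [E.injEq] at h
      omega

theorem L_end (hL : g.Local D.n D.s D.z) {i : ℕ} (hi : i < 2 * D.n) (hs : D.s i) (y y' : Site)
    (h : g.graph.Adj (E i i) y) (h' : g.graph.Adj (E i i) y') : y = y' := by
  rw [(L_adj hL hi hs h).1, (L_adj hL hi hs h').1]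

theorem R_end (hL : g.Local D.n D.s D.z) {i : ℕ} (hi : i < 2 * D.n) (hs : D.z i) (y y' : Site)
    (h : g.graph.Adj (E (2 * D.n - 1) (2 * D.n - 1 - i)) y)
    (h' : g.graph.Adj (E (2 * D.n - 1) (2 * D.n - 1 - i)) y') : y = y' := by
  rw [R_adj hL hi hs h, R_adj hL hi hs h']

theorem L_unlinked (hL : g.Local D.n D.s D.z) (hK : g.Linked D.n D.s D.z M) {i j : ℕ}
    (hi : i < 2 * D.n) (hs : D.s i) (hj : j < 2 * D.n) (hs' : D.s j)
    (h : g.graph.Reachable (E i i) (E j j)) : i = j := by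
  obtain ⟨k, hk, hz, hr, huniq⟩ := eq_of_L_reachable hL hK hi hs
  rcases huniq _ (L_end hL hj hs') h with h1 | h1
  · simp only [E.injEq] at h1; omega
  · simp only [E.injEq] at h1
    obtain rfl : j = 2 * D.n - 1 := h1.1
    have := eq_of_reachable_of_isolated (apex_isolated hL) h.symm
    simp only [E.injEq] at this; omega

theorem X_L_unlinked (hL : g.Local D.n D.s D.z) (hK : g.Linked D.n D.s D.z M) {i p : ℕ}
    (hi : i < 2 * D.n) (hs : D.s i) : ¬ g.graph.Reachable (O p 0) (E i i) := fun h => by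
  obtain ⟨k, hk, hz, hr, huniq⟩ := eq_of_L_reachable hL hK hi hs
  rcases huniq _ (fun _ _ => X_end) h.symm with h1 | h1 <;> simp at h1

/-- By counting, every right end point with letter `0` is linked to a left end point. -/
theorem exists_L_reachable (hL : g.Local D.n D.s D.z) (hK : g.Linked D.n D.s D.z M) {k : ℕ}
    (hk : k < 2 * D.n) (hz : D.z k) :
    ∃ i, i < 2 * D.n ∧ D.s i ∧
      g.graph.Reachable (E i i) (E (2 * D.n - 1) (2 * D.n - 1 - k)) := by
  classical
  have hc : ∀ i, ∃ j, i < 2 * D.n ∧ D.s i → j < 2 * D.n ∧ D.z j ∧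
      g.graph.Reachable (E i i) (E (2 * D.n - 1) (2 * D.n - 1 - j)) := by
    intro i
    by_cases h : i < 2 * D.n ∧ D.s i
    · obtain ⟨j, hj⟩ := hK.cross i h.1 h.2
      exact ⟨j, fun _ => hj⟩
    · exact ⟨0, fun h' => absurd h' h⟩
  choose φ hφ using hc
  have hfin : {k | k < 2 * D.n ∧ D.z k}.Finite := (Set.finite_lt_nat (2 * D.n)).subset fun _ h => h.1
  have himg : φ '' {i | i < 2 * D.n ∧ D.s i} = {k | k < 2 * D.n ∧ D.z k} := by
    apply Set.eq_of_subset_of_ncard_le _ _ hfin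
    · rintro _ ⟨i, hi, rfl⟩
      exact ⟨(hφ i hi).1, (hφ i hi).2.1⟩
    · rw [Set.InjOn.ncard_image]
      · exact D.card_eq
      · intro i hi j hj hij
        refine L_unlinked hL hK hi.1 hi.2 hj.1 hj.2 ((hφ i hi).2.2.trans ?_)
        rw [hij]
        exact (hφ j hj).2.2.symm
  have : k ∈ φ '' {i | i < 2 * D.n ∧ D.s i} := himg ▸ ⟨hk, hz⟩
  obtain ⟨i, hi, rfl⟩ := this
  exact ⟨i, hi.1, hi.2, (hφ i hi).2.2⟩

theorem R_unlinked (hL : g.Local D.n D.s D.z) (hK : g.Linked D.n D.s D.z M) {k l : ℕ}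
    (hk : k < 2 * D.n) (hz : D.z k) (hl : l < 2 * D.n) (hz' : D.z l)
    (h : g.graph.Reachable (E (2 * D.n - 1) (2 * D.n - 1 - k))
      (E (2 * D.n - 1) (2 * D.n - 1 - l))) : k = l := by
  obtain ⟨i, hi, hs, hr⟩ := exists_L_reachable hL hK hk hz
  obtain ⟨j, hj, hs', hr'⟩ := exists_L_reachable hL hK hl hz'
  obtain rfl := L_unlinked hL hK hi hs hj hs' ((hr.trans h).trans hr'.symm)
  obtain ⟨m, hm, hzm, hrm, huniq⟩ := eq_of_L_reachable hL hK hi hs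
  have h0 : ∀ k, k < 2 * D.n → E (2 * D.n - 1) (2 * D.n - 1 - k) = E i i →
      i = 2 * D.n - 1 ∧ k = 0 := fun k hk h => by
    simp only [E.injEq] at h; omega
  have h1 := huniq _ (R_end hL hk hz) hr
  have h2 := huniq _ (R_end hL hl hz') hr'
  by_cases hi' : i = 2 * D.n - 1
  · subst hi'
    have h1 := eq_of_reachable_of_isolated (apex_isolated hL) hr
    have h2 := eq_of_reachable_of_isolated (apex_isolated hL) hr'
    simp only [E.injEq] at h1 h2; omega
  · rcases h1 with h1 | h1
    · exact absurd (h0 k hk h1).1 hi'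
    rcases h2 with h2 | h2
    · exact absurd (h0 l hl h2).1 hi'
    simp only [E.injEq] at h1 h2; omega

theorem X_R_unlinked (hL : g.Local D.n D.s D.z) (hK : g.Linked D.n D.s D.z M) {k p : ℕ}
    (hk : k < 2 * D.n) (hz : D.z k) :
    ¬ g.graph.Reachable (O p 0) (E (2 * D.n - 1) (2 * D.n - 1 - k)) := fun h => by
  obtain ⟨i, hi, hs, hr⟩ := exists_L_reachable hL hK hk hz
  exact X_L_unlinked hL hK hi hs (h.trans hr.symm)

end Unlinked

/-! ### The corner and the left strip -/

section Corner

variable (D : Datum) (g : Bits)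

/-- The antidiagonals of `u`, and the strip of width `u0` along the left boundary. -/
def cornerRegion : Site → Prop
  | .E p m => m ≤ p ∧ p < 2 * D.n ∧ (p < D.U ∨ p < m + D.u0)
  | .O p m => (m = 0 ∧ p < D.U ∧ ¬ D.one p) ∨
      (1 ≤ m ∧ m ≤ p ∧ p < 2 * D.n ∧ (p < D.U ∨ p < m + D.u0))

open Classical in
/-- The primary rank: the antidiagonals of `u` come first, then the lines parallel to the left
boundary. -/
noncomputable def cornerRank₁ : Site → ℕ
  | .E p m => if p < D.U then 2 * p else 2 * D.U + 1 + (p - m)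
  | .O p m => if p < D.U then (if D.c p < m then 2 * p - 1 else 2 * p)
      else if p = D.U then 2 * D.U - 1 else 2 * D.U + 1 + (p - m)

open Classical in
/-- The secondary rank: antidiagonals with letter `0` are visited upwards, the other ones
downwards, and lines parallel to the left boundary upwards. -/
noncomputable def cornerRank₂ : Site → ℕ
  | .E p m => if p < D.U then (if D.one p then 2 * (2 * D.n - m) else 2 * m + 1) else 2 * p
  | .O p m => if p < D.U then (if D.c p < m then 2 * D.n - m else
        if D.one p then 2 * (2 * D.n - m) + 1 else 2 * m)
      else if p = D.U then 2 * D.n - m else 2 * p - 1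

/-- The end points from which the corner and the left strip are reached. -/
def cornerEnds : Set Site :=
  {x | (∃ p, p < D.U ∧ ¬ D.one p ∧ x = O p 0) ∨ ∃ p, p < 2 * D.n ∧ D.s p ∧ x = E p p}

/-- The edges in the corner and in the left strip. -/
def CornerEdges : Site → Prop
  | .E p m => (p < D.U → (m < D.c (p + 1) → g.RT p m = 0 ∧ g.UA p (m + 1) = 0) ∧
      (¬ D.one p → g.DN p m = 1 ∧ (m < D.c p → g.LF p m = 1) ∧ (D.c p ≤ m → g.LF p m = 0)) ∧
      (D.one p → (m < p → g.LF p m = 1) ∧ (m ≤ D.c p → g.DN p m = 1) ∧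
        (D.c p < m → g.DN p m = 0))) ∧ (D.U ≤ p → p + 1 < 2 * D.n → g.RT p m = 1)
  | .O p m => ∀ q l, p = q + 1 → m = l + 1 → p ≤ D.U → D.c p ≤ l → g.RT q l = 1 ∧ g.UA q l = 0

variable {D g} {M : ℕ → ℕ → Prop}

theorem Bits.Local.UA_zero {n : ℕ} {s z : ℕ → Prop} (hL : g.Local n s z) (p : ℕ) :
    g.UA p 0 = 0 := by
  by_contra h
  have := hL.UA_supp p 0 h
  omega

/-- The corner and the left strip are explored from the external ends with letter `0` in `u` and
from the left end points with letter `1` of `σ`, which are pairwise unlinked. -/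
theorem corner_edges (hL : g.Local D.n D.s D.z) (hK : g.Linked D.n D.s D.z M)
    (hM : ∀ i j, i < j → j < 2 * D.n → M i j → ¬ D.one i ∧ D.one j) :
    ∀ w, cornerRegion D w → CornerEdges D g w := by
  classical
  have hUP := D.P_lt
  have hUe := D.U_eq
  have hXX : ∀ p q, p < D.U → ¬ D.one p → q < D.U → ¬ D.one q →
      g.graph.Reachable (O p 0) (O q 0) → p = q := by
    intro p q hp hp1 hq hq1 hr
    rcases lt_trichotomy p q with h | h | h
    · exact absurd (hM p q h (by omega) ((hK.bottom p q h (by omega)).1 hr)).2 hq1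
    · exact h
    · exact absurd (hM q p h (by omega) ((hK.bottom q p h (by omega)).1 hr.symm)).2 hp1
  refine growth hL.degree_le (E := cornerEnds D) ?_ ?_ {w | cornerRegion D w} (cornerRank₁ D)
    (cornerRank₂ D) (CornerEdges D g) ?_
  · rintro x (⟨p, hp, hp1, rfl⟩ | ⟨p, hp, hp1, rfl⟩) y (⟨q, hq, hq1, rfl⟩ | ⟨q, hq, hq1, rfl⟩) hr
    · rw [hXX p q hp hp1 hq hq1 hr]
    · exact absurd hr (X_L_unlinked hL hK hq hq1)
    · exact absurd hr.symm (X_L_unlinked hL hK hp hp1)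
    · rw [L_unlinked hL hK hp hp1 hq hq1 hr]
  · rintro x (⟨p, hp, hp1, rfl⟩ | ⟨p, hp, hp1, rfl⟩)
    · exact fun _ _ => X_end
    · exact L_end hL hp hp1
  intro w hw ih hu _
  -- the edges between an antidiagonal and the next one are known when the latter is visited
  have hodd : ∀ p, p < D.U → (∀ v, cornerRegion D v → cornerRank₁ D v < 2 * p → CornerEdges D g v) →
      ∀ l, l < p → (l < D.c p → g.DN p (l + 1) = 1 ∧ g.LF p l = 1) ∧
        (D.c p ≤ l → g.DN p (l + 1) + g.LF p l = 1) := by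
    intro p hp ih l hl
    obtain ⟨q, rfl⟩ : ∃ q, p = q + 1 := ⟨p - 1, by omega⟩
    have h1 := hL.odd q l (by omega) (by omega)
    have hd := hL.DN_le (q + 1) (l + 1)
    have hf := hL.LF_le (q + 1) l
    refine ⟨fun hlc => ?_, fun hlc => ?_⟩
    · have h2 := ((ih (E q l) (by simp only [cornerRegion]; omega)
        (by simp only [cornerRank₁]; split_ifs <;> omega)).1 (by omega)).1 hlc
      have h3 : g.UA q l = 0 := by
        rcases l with _ | l
        · exact hL.UA_zero q
        · exact (((ih (E q l) (by simp only [cornerRegion]; omega)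
            (by simp only [cornerRank₁]; split_ifs <;> omega)).1 (by omega)).1 (by omega)).2
      omega
    · have h2 := ih (O (q + 1) (l + 1)) (by simp only [cornerRegion]; omega)
        (by simp only [cornerRank₁]; split_ifs <;> omega) q l rfl rfl (by omega) hlc
      omega
  rcases w with ⟨p, m⟩ | ⟨p, m⟩
  · have hw' : m ≤ p ∧ p < 2 * D.n ∧ (p < D.U ∨ p < m + D.u0) := hw
    have hDN := hL.DN_le p m
    have hLF := hL.LF_le p m
    have hRT := hL.RT_le p m
    have hUA := hL.UA_le p (m + 1)
    have hLFp : m = p → g.LF p m = 0 := by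
      intro h; by_contra h'
      have := hL.LF_supp _ _ h'; omega
    by_cases hp : p < D.U
    · have hodd := hodd p hp (fun v hv hv' => ih v hv (Or.inl (by
        simp only [cornerRank₁]; rw [if_pos hp]; exact hv')))
      have hcp := D.c_le hw'.2.1.le
      by_cases h1 : D.one p
      · have hc1 := D.c_one p hw'.2.1 (Or.inl hp) h1
        have hcl := D.c_lt hw'.2.1 (Or.inl hp) h1
        have hnext : D.c p ≤ m → m < p → g.LF p m = 1 := by
          intro h2 h3
          have h4 := (((ih (E p (m + 1)) (by simp only [cornerRegion, Set.mem_ofPred_eq]; omega)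
            (by simp only [cornerRank₁, cornerRank₂]; split_ifs; omega)).1 hp).2.2 h1).2.2
            (by omega)
          have := (hodd m h3).2 h2
          omega
        have hlow : ∀ l, l = m + 1 → l ≤ p → cornerRegion D (O p l) ∧
            (cornerRank₁ D (O p l) < cornerRank₁ D (E p m) ∨
              cornerRank₁ D (O p l) = cornerRank₁ D (E p m) ∧
              cornerRank₂ D (O p l) < cornerRank₂ D (E p m)) := by
          intro l hl hlp
          refine ⟨by simp only [cornerRegion]; omega, ?_⟩
          simp only [cornerRank₁, cornerRank₂]; split_ifs <;> omega
        have hparent : m < p → g.LF p m = 1 → E p m ∈ cornerEnds D ∨ ∃ v ∈ {w | cornerRegion D w},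
            (cornerRank₁ D v < cornerRank₁ D (E p m) ∨
              cornerRank₁ D v = cornerRank₁ D (E p m) ∧
              cornerRank₂ D v < cornerRank₂ D (E p m)) ∧ g.graph.Adj (E p m) v := by
          intro hmp h2
          obtain ⟨h3, h4⟩ := hlow (m + 1) rfl (by omega)
          exact Or.inr ⟨_, h3, h4, Bits.adj_LF.2 h2⟩
        rcases Nat.lt_or_ge (D.c p) m with h2 | h2
        · rcases hw'.1.lt_or_eq with h3 | h3
          · have h4 := hnext h2.le h3
            have h5 : g.DN p m = 0 := by
              by_contra h5
              obtain ⟨h6, h7⟩ := hlow (m + 1) rfl (by omega)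
              have := hu _ h6 h7 (Bits.adj_LF.2 h4) (O p m)
                (by simp only [cornerRegion, Set.mem_ofPred_eq]; omega)
                (by simp only [cornerRank₁, cornerRank₂]; split_ifs <;> omega)
                (Bits.adj_DN.2 (by omega))
              simp at this
            exact ⟨⟨fun _ => ⟨by omega, fun h => absurd h1 h, fun _ => ⟨by omega, by omega, by omega⟩⟩,
              by omega⟩, hparent h3 h4⟩
          · subst h3
            have h4 := (D.s_iff m hw'.2.1 (Or.inl hp)).2 h1
            have h5 := (hL.DN_left m hw'.2.1).2 h4
            exact ⟨⟨fun _ => ⟨by omega, fun h => absurd h1 h, fun _ => ⟨by omega, by omega, by omega⟩⟩,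
              by omega⟩, Or.inl (Or.inr ⟨m, hw'.2.1, h4, rfl⟩)⟩
        · have h4 : g.LF p m = 1 := by
            rcases h2.lt_or_eq with h3 | h3
            · exact ((hodd m (by omega)).1 h3).2
            · exact hnext h3.ge (by omega)
          have h5 : g.DN p m = 1 := by
            rcases m with _ | m
            · exact hL.DN_zero p hw'.2.1
            · exact ((hodd m (by omega)).1 (by omega)).1
          have h6 := hL.even p m (by omega) (by omega)
          exact ⟨⟨fun _ => ⟨by omega, fun h => absurd h1 h, fun _ => ⟨by omega, by omega, by omega⟩⟩,
              by omega⟩, hparent (by omega) h4⟩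
      · have hc1 := D.c_not p hw'.2.1 (Or.inl hp) h1
        have h5 : g.DN p m = 1 := by
          rcases m with _ | m
          · exact hL.DN_zero p hw'.2.1
          · rcases Nat.lt_or_ge m (D.c p) with h2 | h2
            · exact ((hodd m (by omega)).1 h2).1
            · have h4 := (((ih (E p m) (by simp only [cornerRegion, Set.mem_ofPred_eq]; omega)
                (by simp only [cornerRank₁, cornerRank₂]; split_ifs; omega)).1 hp).2.1 h1).2.2 h2
              have := (hodd m (by omega)).2 h2
              omega
        have hlowR : cornerRegion D (O p m) := by
          simp only [cornerRegion]
          rcases Nat.eq_zero_or_pos m with h | h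
          · exact Or.inl ⟨h, hp, h1⟩
          · right; omega
        have hlow : cornerRank₁ D (O p m) < cornerRank₁ D (E p m) ∨
              cornerRank₁ D (O p m) = cornerRank₁ D (E p m) ∧
              cornerRank₂ D (O p m) < cornerRank₂ D (E p m) := by
          simp only [cornerRank₁, cornerRank₂]; split_ifs <;> omega
        refine ⟨⟨fun _ => ⟨?_, fun _ => ⟨h5, fun h2 => ?_, fun h2 => ?_⟩, fun h => absurd h h1⟩, by omega⟩,
          Or.inr ⟨O p m, hlowR, hlow, Bits.adj_DN.2 h5⟩⟩
        · intro h2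
          have := ((hodd m (by omega)).1 (by omega)).2
          have h6 := hL.even p m (by omega) (by omega)
          omega
        · exact ((hodd m (by omega)).1 h2).2
        · by_contra h3
          have h4 : m ≠ p := fun h => h3 (hLFp h)
          have := hu _ hlowR hlow (Bits.adj_DN.2 h5) (O p (m + 1))
            (by simp only [cornerRegion, Set.mem_ofPred_eq]; omega)
            (by simp only [cornerRank₁, cornerRank₂]; split_ifs <;> omega)
            (Bits.adj_LF.2 (by omega))
          simp at this
    · have hlow0 : cornerRegion D (O p m) := by simp only [cornerRegion]; omega
      have hlt0 : cornerRank₁ D (O p m) < cornerRank₁ D (E p m) ∨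
              cornerRank₁ D (O p m) = cornerRank₁ D (E p m) ∧
              cornerRank₂ D (O p m) < cornerRank₂ D (E p m) := by
          simp only [cornerRank₁, cornerRank₂]; split_ifs <;> omega
      rcases hw'.1.eq_or_lt with h1 | h1
      · subst h1
        refine ⟨⟨by omega, fun _ h => hL.RT_left m h⟩, ?_⟩
        by_cases h2 : D.s m
        · exact Or.inl (Or.inr ⟨m, hw'.2.1, h2, rfl⟩)
        · have h3 : g.DN m m = 1 := by
            have := (hL.DN_left m hw'.2.1).not.2 h2
            omega
          exact Or.inr ⟨_, hlow0, hlt0, Bits.adj_DN.2 h3⟩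
      · have hlow1 : cornerRegion D (O p (m + 1)) := by simp only [cornerRegion]; omega
        have hlt1 : cornerRank₁ D (O p (m + 1)) < cornerRank₁ D (E p m) ∨
                cornerRank₁ D (O p (m + 1)) = cornerRank₁ D (E p m) ∧
                cornerRank₂ D (O p (m + 1)) < cornerRank₂ D (E p m) := by
            simp only [cornerRank₁, cornerRank₂]; split_ifs <;> omega
        by_cases h2 : p + 1 < 2 * D.n
        · have hlow2 : cornerRegion D (O (p + 1) (m + 2)) := by simp only [cornerRegion]; omega
          have hlt2 : cornerRank₁ D (O (p + 1) (m + 2)) < cornerRank₁ D (E p m) ∨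
                  cornerRank₁ D (O (p + 1) (m + 2)) = cornerRank₁ D (E p m) ∧
                  cornerRank₂ D (O (p + 1) (m + 2)) < cornerRank₂ D (E p m) := by
              simp only [cornerRank₁, cornerRank₂]; split_ifs <;> omega
          have h3 := hL.even p m h1 h2
          have h01 : ¬ (g.DN p m = 1 ∧ g.LF p m = 1) := fun h => by
            have := hu _ hlow0 hlt0 (Bits.adj_DN.2 h.1) _ hlow1 hlt1 (Bits.adj_LF.2 h.2)
            simp at this
          have h02 : ¬ (g.DN p m = 1 ∧ g.UA p (m + 1) = 1) := fun h => by
            have := hu _ hlow0 hlt0 (Bits.adj_DN.2 h.1) _ hlow2 hlt2 (Bits.adj_UA.2 h.2)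
            simp at this
          have h12 : ¬ (g.LF p m = 1 ∧ g.UA p (m + 1) = 1) := fun h => by
            have := hu _ hlow1 hlt1 (Bits.adj_LF.2 h.1) _ hlow2 hlt2 (Bits.adj_UA.2 h.2)
            simp at this
          refine ⟨⟨by omega, fun _ _ => by omega⟩, Or.inr ?_⟩
          by_cases hd : g.DN p m = 1
          · exact ⟨_, hlow0, hlt0, Bits.adj_DN.2 hd⟩
          by_cases hf : g.LF p m = 1
          · exact ⟨_, hlow1, hlt1, Bits.adj_LF.2 hf⟩
          · exact ⟨_, hlow2, hlt2, Bits.adj_UA.2 (by omega)⟩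
        · refine ⟨⟨by omega, by omega⟩, Or.inr ⟨_, hlow1, hlt1, Bits.adj_LF.2 ?_⟩⟩
          obtain rfl : p = 2 * D.n - 1 := by omega
          exact hL.LF_right m (by omega)
  · rcases hw with ⟨rfl, hp, h1⟩ | hw
    · exact ⟨fun q l _ h => by omega, Or.inl (Or.inl ⟨p, hp, h1, rfl⟩)⟩
    obtain ⟨q, rfl⟩ : ∃ q, p = q + 1 := ⟨p - 1, by omega⟩
    obtain ⟨l, rfl⟩ : ∃ l, m = l + 1 := ⟨m - 1, by omega⟩
    by_cases hp : q + 1 ≤ D.U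
    · rcases Nat.lt_or_ge l (D.c (q + 1)) with h1 | h1
      · have hqU : q + 1 < D.U := by
          rcases hp.lt_or_eq with h | h
          · exact h
          · rw [h, D.c_U] at h1; omega
        refine ⟨fun q' l' h2 h3 h4 h5 => ?_, Or.inr ?_⟩
        · obtain rfl : l = l' := by omega
          omega
        · by_cases h2 : D.one (q + 1)
          · refine ⟨E (q + 1) (l + 1), ?_, ?_, ?_⟩
            · simp only [cornerRegion, Set.mem_ofPred_eq]; omega
            · simp only [cornerRank₁, cornerRank₂]; split_ifs <;> omega
            · rw [SimpleGraph.adj_comm, Bits.adj_DN]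
              exact (((ih (E (q + 1) (l + 1)) (by simp only [cornerRegion, Set.mem_ofPred_eq]; omega)
                (by simp only [cornerRank₁, cornerRank₂]; split_ifs <;> omega)).1
                hqU).2.2 h2).2.1 (by omega)
          · refine ⟨E (q + 1) l, ?_, ?_, ?_⟩
            · simp only [cornerRegion, Set.mem_ofPred_eq]; omega
            · simp only [cornerRank₁, cornerRank₂]; split_ifs <;> omega
            · rw [SimpleGraph.adj_comm, Bits.adj_LF]
              exact (((ih (E (q + 1) l) (by simp only [cornerRegion, Set.mem_ofPred_eq]; omega)
                (by simp only [cornerRank₁, cornerRank₂]; split_ifs <;> omega)).1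
                hqU).2.1 h2).2.1 (by omega)
      · have hcU : q + 1 = D.U → D.c (q + 1) = D.u1 := fun h => by rw [h, D.c_U]
        have hlowR : ∀ l', l' ≤ l → cornerRegion D (E q l') := by
          intro l' hl'
          simp only [cornerRegion]; omega
        have hlt : ∀ l', cornerRank₁ D (E q l') < cornerRank₁ D (O (q + 1) (l + 1)) ∨
                cornerRank₁ D (E q l') = cornerRank₁ D (O (q + 1) (l + 1)) ∧
                cornerRank₂ D (E q l') < cornerRank₂ D (O (q + 1) (l + 1)) := by
          intro l'
          simp only [cornerRank₁, cornerRank₂]; split_ifs <;> omega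
        have hRT : g.RT q l = 1 := by
          have hRT := hL.RT_le q l
          rcases Nat.lt_or_ge l q with h2 | h2
          · have h3 := hL.even q l h2 (by omega)
            have h4 : g.UA q (l + 1) = 0 := by
              refine (ih (O (q + 1) (l + 2)) ?_ ?_ q (l + 1) rfl rfl hp (by omega)).2
              · simp only [cornerRegion, Set.mem_ofPred_eq]; omega
              · simp only [cornerRank₁, cornerRank₂]; split_ifs <;> omega
            have h5 := (ih (E q l) (hlowR l le_rfl) (hlt l)).1 (by omega)
            by_cases h6 : D.one q
            · have := D.c_one q (by omega) (Or.inl (by omega)) h6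
              have h7 := h5.2.2 h6
              have := h7.1 h2
              have := h7.2.2 (by omega)
              omega
            · have := D.c_not q (by omega) (Or.inl (by omega)) h6
              have h7 := h5.2.1 h6
              have := h7.1
              have := h7.2.2 (by omega)
              omega
          · obtain rfl : l = q := by omega
            exact hL.RT_left l (by omega)
        refine ⟨fun q' l' h2 h3 h4 h5 => ?_, Or.inr ⟨E q l, hlowR l le_rfl, hlt l, ?_⟩⟩
        · obtain rfl : l = l' := by omega
          obtain rfl : q = q' := by omega
          refine ⟨hRT, ?_⟩
          by_contra h6
          have h7 := hL.UA_supp q l h6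
          obtain ⟨l', rfl⟩ : ∃ l', l = l' + 1 := ⟨l - 1, by omega⟩
          have h8 := hL.UA_le q (l' + 1)
          have := hu _ (hlowR (l' + 1) le_rfl) (hlt _) (Bits.adj_RT.2 hRT).symm _
            (hlowR l' (by omega)) (hlt _) (Bits.adj_UA.2 (by omega)).symm
          simp at this
        · exact (Bits.adj_RT.2 hRT).symm
    · have hlowR : cornerRegion D (E q l) := by simp only [cornerRegion]; omega
      have hlt : cornerRank₁ D (E q l) < cornerRank₁ D (O (q + 1) (l + 1)) ∨
              cornerRank₁ D (E q l) = cornerRank₁ D (O (q + 1) (l + 1)) ∧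
              cornerRank₂ D (E q l) < cornerRank₂ D (O (q + 1) (l + 1)) := by
        simp only [cornerRank₁, cornerRank₂]; split_ifs <;> omega
      refine ⟨fun q' l' h2 h3 h4 h5 => by omega, Or.inr ⟨E q l, hlowR, hlt, ?_⟩⟩
      exact (Bits.adj_RT.2 ((ih _ hlowR hlt).2 (by omega) (by omega))).symm

end Corner

/-! ### The middle and the right part -/

section Shape

/-- The rigid part of a configuration. On the antidiagonals of `u` and `v`, all edges below the
points `E p m` are present if the letter is `0`, and all edges to their left if it is `1`. On the
middle antidiagonals, all edges to the right are present in the strip `p < m + u0` along the left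
boundary, and all edges below the points `E p m` outside of it. Between `u` and the middle part,
the paths cross exactly to the right of the points `E (U - 1) m` with `u1 ≤ m`. -/
structure Shape (D : Datum) (g : Bits) : Prop where
  DN_outer : ∀ p m, p < 2 * D.n → (p < D.U ∨ D.U + D.a + D.b ≤ p) → ¬ D.one p → m ≤ p →
    g.DN p m = 1
  LF_outer : ∀ p m, p < 2 * D.n → (p < D.U ∨ D.U + D.a + D.b ≤ p) → D.one p → m < p →
    g.LF p m = 1
  DN_center : ∀ p m, D.U ≤ p → p < D.U + D.a + D.b → m + D.u0 ≤ p → g.DN p m = 1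
  RT_strip : ∀ p m, D.U ≤ p → p < D.U + D.a + D.b → m ≤ p → p < m + D.u0 → g.RT p m = 1
  RT_U : ∀ p m, p + 1 = D.U → m ≤ p → D.u1 ≤ m → g.RT p m = 1
  RT_U' : ∀ p m, p + 1 = D.U → m < D.u1 → g.RT p m = 0
  UA_U : ∀ p m, p + 1 = D.U → g.UA p m = 0

variable (D : Datum)

/-- The middle antidiagonals without the strip along the left boundary. -/
def centerRegion : Site → Prop
  | .E p m => D.U ≤ p ∧ p < D.U + D.a + D.b ∧ m + D.u0 ≤ p
  | .O p m => D.U ≤ p ∧ p < D.U + D.a + D.b ∧ m + D.u0 ≤ p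

/-- The central part is visited by rows. -/
def centerRank : Site → ℕ
  | .E _ m => 2 * m + 1
  | .O _ m => 2 * m

/-- The antidiagonals of `v`. -/
def rightRegion : Site → Prop
  | .E p m => D.U + D.a + D.b ≤ p ∧ p < 2 * D.n ∧ m ≤ p
  | .O p m => D.U + D.a + D.b ≤ p ∧ p < 2 * D.n ∧ m ≤ p ∧ (1 ≤ m ∨ D.one p)

/-- The antidiagonals of `v` are visited from right to left. -/
def rightRank₁ : Site → ℕ
  | .E p _ => 2 * D.n - p
  | .O p _ => 2 * D.n - p

open Classical in
/-- The antidiagonals of `v` with letter `1` are visited upwards, the other ones downwards. -/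
noncomputable def rightRank₂ : Site → ℕ
  | .E p m => if D.one p then 2 * m + 1 else 2 * (p - m)
  | .O p m => if D.one p then 2 * m else 2 * (p - m) + 1

variable {D} {g : Bits} {M : ℕ → ℕ → Prop}

/-- The central part is explored from the external ends `U ≤ p < U + a + b`. They are pairwise
unlinked as their letters are `1 ⋯ 1 0 ⋯ 0`. -/
theorem center_edges (hL : g.Local D.n D.s D.z) (hK : g.Linked D.n D.s D.z M)
    (hM : ∀ i j, i < j → j < 2 * D.n → M i j → ¬ D.one i ∧ D.one j)
    (hU0 : ∀ p m, p + 1 = D.U → m < D.u1 → g.RT p m = 0)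
    (hUA : ∀ p m, p + 1 = D.U → g.UA p m = 0) :
    ∀ w, centerRegion D w → match w with
      | .E p m => g.DN p m = 1
      | .O p m => ∀ q l, p = q + 1 → m = l + 1 → g.LF p l + g.RT q l + g.UA q l ≤ 1 := by
  have hUP := D.P_lt
  have hUe := D.U_eq
  have hXX : ∀ p q, D.U ≤ p → p < q → q < D.U + D.a + D.b →
      ¬ g.graph.Reachable (O p 0) (O q 0) := by
    intro p q hp hpq hq hr
    have h1 := hM p q hpq (by omega) ((hK.bottom p q hpq (by omega)).1 hr)
    rcases Nat.lt_or_ge p (D.U + D.b) with h2 | h2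
    · exact h1.1 (D.mid_one p hp h2)
    · exact D.mid_zero q (by omega) (by omega) h1.2
  refine growth hL.degree_le (E := {x | ∃ p, D.U ≤ p ∧ p < D.U + D.a + D.b ∧ x = O p 0}) ?_ ?_
    {w | centerRegion D w} centerRank (fun _ => 0) _ ?_
  · rintro x ⟨p, hp, hp1, rfl⟩ y ⟨q, hq, hq1, rfl⟩ hr
    rcases lt_trichotomy p q with h | h | h
    · exact absurd hr (hXX p q hp h hq1)
    · rw [h]
    · exact absurd hr.symm (hXX q p hq h hp1)
  · rintro x ⟨p, hp, hp1, rfl⟩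
    exact fun _ _ => X_end
  intro w hw ih hu _
  rcases w with ⟨p, m⟩ | ⟨p, m⟩
  · obtain ⟨h1, h2, h3⟩ := hw
    have hlow : centerRegion D (O p m) := ⟨h1, h2, h3⟩
    have hlt : centerRank (O p m) < centerRank (E p m) := by simp only [centerRank]; omega
    have hd : g.DN p m = 1 := by
      rcases m with _ | l
      · exact hL.DN_zero p (by omega)
      · obtain ⟨q, rfl⟩ : ∃ q, p = q + 1 := ⟨p - 1, by omega⟩
        have h4 : g.LF (q + 1) l + g.RT q l + g.UA q l ≤ 1 := ih _ hlow (Or.inl hlt) q l rfl rfl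
        have := hL.odd q l (by omega) (by omega)
        have := hL.DN_le (q + 1) (l + 1)
        omega
    exact ⟨hd, Or.inr ⟨_, hlow, Or.inl hlt, Bits.adj_DN.2 hd⟩⟩
  · obtain ⟨h1, h2, h3⟩ := hw
    rcases m with _ | l
    · exact ⟨fun q l _ h => by omega, Or.inl ⟨p, h1, h2, rfl⟩⟩
    obtain ⟨q, rfl⟩ : ∃ q, p = q + 1 := ⟨p - 1, by omega⟩
    have hodd := hL.odd q l (by omega) (by omega)
    have hDN := hL.DN_le (q + 1) (l + 1)
    have hLF := hL.LF_le (q + 1) l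
    have hRT := hL.RT_le q l
    have hUAle := hL.UA_le q l
    have hR1 : centerRegion D (E (q + 1) l) := ⟨h1, h2, by omega⟩
    have hlt1 : centerRank (E (q + 1) l) < centerRank (O (q + 1) (l + 1)) := by
      simp only [centerRank]; omega
    by_cases hq : q + 1 = D.U
    · have h4 := hU0 q l hq (by omega)
      have h5 := hUA q l hq
      refine ⟨fun q' l' h6 h7 => ?_, Or.inr ⟨_, hR1, Or.inl hlt1,
        (Bits.adj_LF.2 (by omega)).symm⟩⟩
      obtain rfl : q = q' := by omega
      obtain rfl : l = l' := by omega
      omega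
    · have hR2 : centerRegion D (E q l) := ⟨by omega, by omega, by omega⟩
      have hlt2 : centerRank (E q l) < centerRank (O (q + 1) (l + 1)) := by
        simp only [centerRank]; omega
      have hR3 : centerRegion D (E q (l - 1)) := ⟨by omega, by omega, by omega⟩
      have hlt3 : centerRank (E q (l - 1)) < centerRank (O (q + 1) (l + 1)) := by
        simp only [centerRank]; omega
      have hadj3 : g.UA q l = 1 → g.graph.Adj (O (q + 1) (l + 1)) (E q (l - 1)) ∧ 1 ≤ l := by
        intro h
        have := hL.UA_supp q l (by omega)
        obtain ⟨l', rfl⟩ : ∃ l', l = l' + 1 := ⟨l - 1, by omega⟩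
        exact ⟨(Bits.adj_UA.2 h).symm, by omega⟩
      have h12 : ¬ (g.LF (q + 1) l = 1 ∧ g.RT q l = 1) := fun h => by
        have := hu _ hR1 (Or.inl hlt1) (Bits.adj_LF.2 h.1).symm _ hR2 (Or.inl hlt2)
          (Bits.adj_RT.2 h.2).symm
        simp at this
      have h13 : ¬ (g.LF (q + 1) l = 1 ∧ g.UA q l = 1) := fun h => by
        have := hu _ hR1 (Or.inl hlt1) (Bits.adj_LF.2 h.1).symm _ hR3 (Or.inl hlt3)
          (hadj3 h.2).1
        simp at this
      have h23 : ¬ (g.RT q l = 1 ∧ g.UA q l = 1) := fun h => by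
        have := hu _ hR2 (Or.inl hlt2) (Bits.adj_RT.2 h.1).symm _ hR3 (Or.inl hlt3)
          (hadj3 h.2).1
        have h4 := (hadj3 h.2).2
        simp at this
        omega
      refine ⟨fun q' l' h6 h7 => ?_, Or.inr ?_⟩
      · obtain rfl : q = q' := by omega
        obtain rfl : l = l' := by omega
        omega
      · by_cases h4 : g.LF (q + 1) l = 1
        · exact ⟨_, hR1, Or.inl hlt1, (Bits.adj_LF.2 h4).symm⟩
        by_cases h5 : g.RT q l = 1
        · exact ⟨_, hR2, Or.inl hlt2, (Bits.adj_RT.2 h5).symm⟩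
        · exact ⟨_, hR3, Or.inl hlt3, (hadj3 (by omega)).1⟩

/-- The antidiagonals of `v` are explored from the external ends with letter `1` and from the
right end points with letter `0` of `τ`, which are pairwise unlinked. -/
theorem right_edges (hL : g.Local D.n D.s D.z) (hK : g.Linked D.n D.s D.z M)
    (hM : ∀ i j, i < j → j < 2 * D.n → M i j → ¬ D.one i ∧ D.one j) :
    ∀ w, rightRegion D w → match w with
      | .E p m => (D.one p → m < p → g.LF p m = 1) ∧ (¬ D.one p → g.DN p m = 1)
      | .O _ _ => True := by
  classical
  have hUP := D.P_lt
  have hXX : ∀ p q, D.one p → p < q → q < 2 * D.n → ¬ g.graph.Reachable (O p 0) (O q 0) :=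
    fun p q hp hpq hq hr => (hM p q hpq hq ((hK.bottom p q hpq hq).1 hr)).1 hp
  refine growth hL.degree_le (E := {x | (∃ p, p < 2 * D.n ∧ D.one p ∧ x = O p 0) ∨
    ∃ k, k < 2 * D.n ∧ D.z k ∧ x = E (2 * D.n - 1) (2 * D.n - 1 - k)}) ?_ ?_
    {w | rightRegion D w} (rightRank₁ D) (rightRank₂ D) _ ?_
  · rintro x (⟨p, hp, hp1, rfl⟩ | ⟨p, hp, hp1, rfl⟩) y (⟨q, hq, hq1, rfl⟩ | ⟨q, hq, hq1, rfl⟩) hr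
    · rcases lt_trichotomy p q with h | h | h
      · exact absurd hr (hXX p q hp1 h hq)
      · rw [h]
      · exact absurd hr.symm (hXX q p hq1 h hp)
    · exact absurd hr (X_R_unlinked hL hK hq hq1)
    · exact absurd hr.symm (X_R_unlinked hL hK hp hp1)
    · rw [R_unlinked hL hK hp hp1 hq hq1 hr]
  · rintro x (⟨p, hp, hp1, rfl⟩ | ⟨p, hp, hp1, rfl⟩)
    · exact fun _ _ => X_end
    · exact R_end hL hp hp1
  intro w hw ih hu _
  rcases w with ⟨p, m⟩ | ⟨p, m⟩
  · have hw' : D.U + D.a + D.b ≤ p ∧ p < 2 * D.n ∧ m ≤ p := hw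
    obtain ⟨hp1, hp2, hm⟩ := hw'
    have hDN := hL.DN_le p m
    have hLF := hL.LF_le p m
    have hRT := hL.RT_le p m
    have hUA := hL.UA_le p (m + 1)
    have hR3 : g.RT p m = 1 → rightRegion D (O (p + 1) (m + 1)) ∧
        rightRank₁ D (O (p + 1) (m + 1)) < rightRank₁ D (E p m) := fun h => by
      have := hL.RT_supp p m (by omega)
      simp only [rightRegion, rightRank₁]; omega
    have hR4 : g.UA p (m + 1) = 1 → rightRegion D (O (p + 1) (m + 2)) ∧
        rightRank₁ D (O (p + 1) (m + 2)) < rightRank₁ D (E p m) := fun h => by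
      have := hL.UA_supp p (m + 1) (by omega)
      simp only [rightRegion, rightRank₁]; omega
    have h34 : ¬ (g.RT p m = 1 ∧ g.UA p (m + 1) = 1) := fun h => by
      have := hu _ (hR3 h.1).1 (Or.inl (hR3 h.1).2) (Bits.adj_RT.2 h.1) _ (hR4 h.2).1
        (Or.inl (hR4 h.2).2) (Bits.adj_UA.2 h.2)
      simp at this
    by_cases h1 : D.one p
    · have hR2 : rightRegion D (O p m) := ⟨hp1, hp2, hm, Or.inr h1⟩
      have hlt2 : rightRank₁ D (O p m) < rightRank₁ D (E p m) ∨
          rightRank₁ D (O p m) = rightRank₁ D (E p m) ∧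
          rightRank₂ D (O p m) < rightRank₂ D (E p m) := by
        exact Or.inr ⟨rfl, by simp only [rightRank₂, if_pos h1]; omega⟩
      have h23 : ¬ (g.DN p m = 1 ∧ g.RT p m = 1) := fun h => by
        have := hu _ hR2 hlt2 (Bits.adj_DN.2 h.1) _ (hR3 h.2).1
          (Or.inl (hR3 h.2).2) (Bits.adj_RT.2 h.2)
        simp at this
      have h24 : ¬ (g.DN p m = 1 ∧ g.UA p (m + 1) = 1) := fun h => by
        have := hu _ hR2 hlt2 (Bits.adj_DN.2 h.1) _ (hR4 h.2).1
          (Or.inl (hR4 h.2).2) (Bits.adj_UA.2 h.2)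
        simp at this
      by_cases hpN : p + 1 < 2 * D.n
      · rcases hm.lt_or_eq with h2 | h2
        · have h3 := hL.even p m h2 hpN
          refine ⟨⟨fun _ _ => by omega, fun h => absurd h1 h⟩, Or.inr ?_⟩
          by_cases h4 : g.DN p m = 1
          · exact ⟨_, hR2, hlt2, Bits.adj_DN.2 h4⟩
          by_cases h5 : g.RT p m = 1
          · exact ⟨_, (hR3 h5).1, Or.inl (hR3 h5).2, Bits.adj_RT.2 h5⟩
          · have h6 : g.UA p (m + 1) = 1 := by omega
            exact ⟨_, (hR4 h6).1, Or.inl (hR4 h6).2, Bits.adj_UA.2 h6⟩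
        · subst h2
          have h5 := hL.RT_left m hpN
          exact ⟨⟨fun _ h => by omega, fun h => absurd h1 h⟩,
            Or.inr ⟨_, (hR3 h5).1, Or.inl (hR3 h5).2, Bits.adj_RT.2 h5⟩⟩
      · obtain rfl : p = 2 * D.n - 1 := by omega
        refine ⟨⟨fun _ h => hL.LF_right m (by omega), fun h => absurd h1 h⟩, ?_⟩
        by_cases h4 : g.DN (2 * D.n - 1) m = 1
        · exact Or.inr ⟨_, hR2, hlt2, Bits.adj_DN.2 h4⟩
        · left; right
          have hk : 2 * D.n - 1 - (2 * D.n - 1 - m) = m := by omega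
          refine ⟨2 * D.n - 1 - m, by omega, ?_, by rw [hk]⟩
          rw [← hL.DN_right _ (by omega), hk]
          omega
    · have hpN : p + 1 < 2 * D.n := by
        by_contra h
        obtain rfl : p = 2 * D.n - 1 := by omega
        exact h1 D.one_last
      rcases hm.lt_or_eq with h2 | h2
      · have hR2 : rightRegion D (O p (m + 1)) := by simp only [rightRegion]; omega
        have hlt2 : rightRank₁ D (O p (m + 1)) < rightRank₁ D (E p m) ∨
            rightRank₁ D (O p (m + 1)) = rightRank₁ D (E p m) ∧
            rightRank₂ D (O p (m + 1)) < rightRank₂ D (E p m) := by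
          exact Or.inr ⟨rfl, by simp only [rightRank₂, if_neg h1]; omega⟩
        have h23 : ¬ (g.LF p m = 1 ∧ g.RT p m = 1) := fun h => by
          have := hu _ hR2 hlt2 (Bits.adj_LF.2 h.1) _ (hR3 h.2).1
            (Or.inl (hR3 h.2).2) (Bits.adj_RT.2 h.2)
          simp at this
        have h24 : ¬ (g.LF p m = 1 ∧ g.UA p (m + 1) = 1) := fun h => by
          have := hu _ hR2 hlt2 (Bits.adj_LF.2 h.1) _ (hR4 h.2).1
            (Or.inl (hR4 h.2).2) (Bits.adj_UA.2 h.2)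
          simp at this
        have h3 := hL.even p m h2 hpN
        refine ⟨⟨fun h => absurd h h1, fun _ => by omega⟩, Or.inr ?_⟩
        by_cases h4 : g.LF p m = 1
        · exact ⟨_, hR2, hlt2, Bits.adj_LF.2 h4⟩
        by_cases h5 : g.RT p m = 1
        · exact ⟨_, (hR3 h5).1, Or.inl (hR3 h5).2, Bits.adj_RT.2 h5⟩
        · have h6 : g.UA p (m + 1) = 1 := by omega
          exact ⟨_, (hR4 h6).1, Or.inl (hR4 h6).2, Bits.adj_UA.2 h6⟩
      · subst h2
        have h5 := hL.RT_left m hpN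
        have h6 := (hL.DN_left m hp2).not.2 fun h => h1 ((D.s_iff m hp2 (Or.inr hp1)).1 h)
        exact ⟨⟨fun h => absurd h h1, fun _ => by omega⟩,
          Or.inr ⟨_, (hR3 h5).1, Or.inl (hR3 h5).2, Bits.adj_RT.2 h5⟩⟩
  · have hw' : D.U + D.a + D.b ≤ p ∧ p < 2 * D.n ∧ m ≤ p ∧ (1 ≤ m ∨ D.one p) := hw
    obtain ⟨hp1, hp2, hm, hm1⟩ := hw'
    refine ⟨trivial, ?_⟩
    by_cases h1 : D.one p
    · rcases m with _ | l
      · exact Or.inl (Or.inl ⟨p, hp2, h1, rfl⟩)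
      · right
        have hR : rightRegion D (E p l) := by simp only [rightRegion]; omega
        have hlt : rightRank₁ D (E p l) < rightRank₁ D (O p (l + 1)) ∨
            rightRank₁ D (E p l) = rightRank₁ D (O p (l + 1)) ∧
            rightRank₂ D (E p l) < rightRank₂ D (O p (l + 1)) := by
          exact Or.inr ⟨rfl, by simp only [rightRank₂, if_pos h1]; omega⟩
        exact ⟨_, hR, hlt, (Bits.adj_LF.2 ((ih _ hR hlt).1 h1 (by omega))).symm⟩
    · right
      have hR : rightRegion D (E p m) := by simp only [rightRegion]; omega
      have hlt : rightRank₁ D (E p m) < rightRank₁ D (O p m) ∨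
          rightRank₁ D (E p m) = rightRank₁ D (O p m) ∧
          rightRank₂ D (E p m) < rightRank₂ D (O p m) := by
        exact Or.inr ⟨rfl, by simp only [rightRank₂, if_neg h1]; omega⟩
      exact ⟨_, hR, hlt, (Bits.adj_DN.2 ((ih _ hR hlt).2 h1)).symm⟩

/-- The paths of a configuration force its rigid part. -/
theorem shape_of_linked (hL : g.Local D.n D.s D.z) (hK : g.Linked D.n D.s D.z M)
    (hM : ∀ i j, i < j → j < 2 * D.n → M i j → ¬ D.one i ∧ D.one j) : Shape D g := by
  have hUP := D.P_lt
  have hUe := D.U_eq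
  have hu0 := D.u0_pos
  have hcor := corner_edges hL hK hM
  have hUp : ∀ p m, p + 1 = D.U → m ≤ p → D.u1 ≤ m → g.RT p m = 1 ∧ g.UA p m = 0 := by
    intro p m hp hm hm1
    have hc := D.c_U
    rw [← hp] at hc
    exact hcor (O (p + 1) (m + 1)) (by simp only [cornerRegion]; omega) p m rfl rfl (by omega)
      (by omega)
  have hlow : ∀ p m, p + 1 = D.U → m < D.u1 → g.RT p m = 0 ∧ g.UA p (m + 1) = 0 := by
    intro p m hp hm
    have hc := D.c_U
    rw [← hp] at hc
    exact ((hcor (E p m) (by simp only [cornerRegion]; omega)).1 (by omega)).1 (by omega)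
  have hUA : ∀ p m, p + 1 = D.U → g.UA p m = 0 := by
    intro p m hp
    by_contra h
    have h1 := hL.UA_supp p m h
    rcases Nat.lt_or_ge m D.u1 with h2 | h2
    · obtain ⟨l, rfl⟩ : ∃ l, m = l + 1 := ⟨m - 1, by omega⟩
      exact h (hlow p l hp (by omega)).2
    · exact h (hUp p m hp (by omega) h2).2
  have hcen := center_edges hL hK hM (fun p m hp hm => (hlow p m hp hm).1) hUA
  have hrig := right_edges hL hK hM
  refine ⟨fun p m hp hp' h1 hm => ?_, fun p m hp hp' h1 hm => ?_, fun p m h1 h2 h3 => ?_,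
    fun p m h1 h2 h3 h4 => ?_, fun p m hp hm h1 => (hUp p m hp hm h1).1,
    fun p m hp hm => (hlow p m hp hm).1, hUA⟩
  · rcases Nat.lt_or_ge p D.U with h2 | h2
    · exact (((hcor (E p m) (by simp only [cornerRegion]; omega)).1 h2).2.1 h1).1
    · exact (hrig (E p m) ⟨by omega, hp, hm⟩).2 h1
  · rcases Nat.lt_or_ge p D.U with h2 | h2
    · exact (((hcor (E p m) (by simp only [cornerRegion]; omega)).1 h2).2.2 h1).1 hm
    · exact (hrig (E p m) ⟨by omega, hp, by omega⟩).1 h1 hm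
  · exact hcen (E p m) ⟨h1, h2, h3⟩
  · exact (hcor (E p m) (by simp only [cornerRegion]; omega)).2 h1 (by omega)

end Shape

/-! ### The stack of open paths -/

namespace Datum

variable (D : Datum)

/-- The number of letters `1` of `π` before a position. -/
def pc (p : ℕ) : ℕ := D.c p + (min p (D.U + D.b) - D.U)

theorem pc_zero : D.pc 0 = 0 := by simp [pc, D.c_zero]

theorem pc_one {p : ℕ} (hp : p < 2 * D.n) (h : D.one p) : D.pc (p + 1) = D.pc p + 1 := by
  unfold pc
  by_cases h1 : p < D.U ∨ D.U + D.a + D.b ≤ p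
  · rw [D.c_one p hp h1 h]; omega
  · have h2 : p < D.U + D.b := by
      by_contra h3
      exact D.mid_zero p (by omega) (by omega) h
    rw [D.c_mid p (by omega) (by omega)]; omega

theorem pc_not {p : ℕ} (hp : p < 2 * D.n) (h : ¬ D.one p) : D.pc (p + 1) = D.pc p := by
  unfold pc
  by_cases h1 : p < D.U ∨ D.U + D.a + D.b ≤ p
  · rw [D.c_not p hp h1 h]; omega
  · have h2 : D.U + D.b ≤ p := by
      by_contra h3
      exact h (D.mid_one p (by omega) (by omega))
    rw [D.c_mid p (by omega) (by omega)]; omega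

theorem pc_of_le {p : ℕ} (hp : p ≤ D.U) : D.pc p = D.c p := by unfold pc; omega

theorem pc_of_ge {p : ℕ} (hp : D.U + D.a + D.b ≤ p) : D.pc p = D.c p + D.b := by
  unfold pc; omega

theorem two_mul_pc_le {p : ℕ} (hp : p ≤ 2 * D.n) : 2 * D.pc p ≤ p := by
  rcases Nat.lt_or_ge p D.U with h | h
  · rw [D.pc_of_le h.le]; exact D.dyck_left p h.le
  · rcases Nat.lt_or_ge p (D.U + D.a + D.b) with h' | h'
    · have := D.dyck_mid
      have := D.U_eq
      unfold pc
      rw [D.c_of_mid h h'.le]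
      omega
    · rw [D.pc_of_ge h']; exact D.dyck_right p h' hp

theorem sc_of_le {p : ℕ} (hp : p ≤ D.U) : D.sc p = D.pc p := by
  induction p with
  | zero => rw [D.sc_zero, D.pc_zero]
  | succ p ih =>
    have h1 := ih (by omega)
    have h2 := D.P_lt
    by_cases h : D.one p
    · rw [D.pc_one (by omega) h, D.sc_one p (by omega)
        ((D.s_iff p (by omega) (Or.inl (by omega))).2 h), h1]
    · rw [D.pc_not (by omega) h, D.sc_not p (by omega) (fun h' => h
        ((D.s_iff p (by omega) (Or.inl (by omega))).1 h')), h1]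

theorem sc_of_ge {p : ℕ} (hp : D.U + D.a + D.b ≤ p) (hp' : p ≤ 2 * D.n) : D.sc p = D.pc p := by
  induction p, hp using Nat.le_induction with
  | base => rw [D.sc_P, D.pc_of_ge le_rfl, D.c_of_mid (by omega) le_rfl]
  | succ p hp ih =>
    have h1 := ih (by omega)
    by_cases h : D.one p
    · rw [D.pc_one (by omega) h, D.sc_one p (by omega)
        ((D.s_iff p (by omega) (Or.inr (by omega))).2 h), h1]
    · rw [D.pc_not (by omega) h, D.sc_not p (by omega) (fun h' => h
        ((D.s_iff p (by omega) (Or.inr (by omega))).1 h')), h1]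

theorem pc_end : D.pc (2 * D.n) = D.n := by
  rw [D.pc_of_ge (by have := D.P_lt; omega)]
  exact D.c_end

theorem sc_mono {p q : ℕ} (h : p ≤ q) (hq : q ≤ 2 * D.n) : D.sc p ≤ D.sc q := by
  induction q, h using Nat.le_induction with
  | base => exact le_rfl
  | succ q hpq ih =>
    refine (ih (by omega)).trans ?_
    by_cases h : D.s q
    · rw [D.sc_one q (by omega) h]; omega
    · rw [D.sc_not q (by omega) h]

/-- The position of the `r`-th letter `1` of `σ`, counted from `0`. -/
noncomputable def source (r : ℕ) : ℕ := sInf {q | q < 2 * D.n ∧ D.s q ∧ D.sc q = r}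

theorem source_sc {q : ℕ} (hq : q < 2 * D.n) (hs : D.s q) : D.source (D.sc q) = q := by
  obtain ⟨h1, h2, h3⟩ := Nat.sInf_mem (s := {q' | q' < 2 * D.n ∧ D.s q' ∧ D.sc q' = D.sc q})
    ⟨q, hq, hs, rfl⟩
  change D.source (D.sc q) < 2 * D.n at h1
  change D.s (D.source (D.sc q)) at h2
  change D.sc (D.source (D.sc q)) = D.sc q at h3
  rcases lt_trichotomy (D.source (D.sc q)) q with h | h | h
  · have := D.sc_mono (p := D.source (D.sc q) + 1) h (by omega)
    rw [D.sc_one _ h1 h2] at this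
    omega
  · exact h
  · have := D.sc_mono (p := q + 1) h (by omega)
    rw [D.sc_one _ hq hs] at this
    omega

open Classical in
/-- The stack of the paths that are open before the antidiagonal `p`. At first, it holds the left
end points with letter `1` of `σ`. A letter `0` of `π` pushes an external end, a letter `1` of
`π` pops the top of the stack, at index `0`. -/
noncomputable def stack : ℕ → ℕ → Site
  | 0, r => E (D.source r) (D.source r)
  | p + 1, r => if D.one p then stack p (r + 1) else
      match r with
      | 0 => O p 0
      | r + 1 => stack p r

variable {D}

theorem stack_one {p : ℕ} (h : D.one p) (r : ℕ) : D.stack (p + 1) r = D.stack p (r + 1) := by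
  simp [stack, h]

theorem stack_not_zero {p : ℕ} (h : ¬ D.one p) : D.stack (p + 1) 0 = O p 0 := by
  simp [stack, h]

theorem stack_not_succ {p : ℕ} (h : ¬ D.one p) (r : ℕ) :
    D.stack (p + 1) (r + 1) = D.stack p r := by
  simp [stack, h]

/-- The lower part of the stack is unchanged as long as its height does not drop below. -/
theorem stack_eq_of_height {k l : ℕ} (hkl : k ≤ l) (hl : l ≤ 2 * D.n)
    (h : ∀ q, k ≤ q → q ≤ l → k + 2 * D.pc q ≤ q + 2 * D.pc k) (e r : ℕ)
    (he : e + k + 2 * D.pc l = l + 2 * D.pc k) : D.stack l (e + r) = D.stack k r := by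
  induction l, hkl using Nat.le_induction generalizing e with
  | base =>
    obtain rfl : e = 0 := by omega
    rw [Nat.zero_add]
  | succ l hkl ih =>
    have h1 := h l hkl (by omega)
    by_cases h2 : D.one l
    · rw [D.pc_one (by omega) h2] at he
      rw [stack_one h2, show e + r + 1 = (e + 1) + r by omega]
      exact ih (by omega) (fun q h3 h4 => h q h3 (by omega)) _ (by omega)
    · rw [D.pc_not (by omega) h2] at he
      obtain ⟨e, rfl⟩ : ∃ e', e = e' + 1 := ⟨e - 1, by omega⟩
      rw [show e + 1 + r = (e + r) + 1 by omega, stack_not_succ h2]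
      exact ih (by omega) (fun q h3 h4 => h q h3 (by omega)) _ (by omega)

/-- Below the open external ends, the stack holds the left end points. -/
theorem stack_source {p e r : ℕ} (hp : p ≤ 2 * D.n) (he : e + 2 * D.pc p = p) :
    D.stack p (e + r) = D.stack 0 r :=
  stack_eq_of_height (Nat.zero_le p) hp (fun q _ hq => by
    have := D.two_mul_pc_le (p := q) (by omega)
    rw [D.pc_zero]; omega) e r (by rw [D.pc_zero]; omega)

theorem stack_source_eq {p e : ℕ} (hp : p < 2 * D.n) (hs : D.s p) (he : e + 2 * D.pc p = p) :
    D.stack p (e + D.sc p) = E p p := by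
  rw [stack_source hp.le he, stack, D.source_sc hp hs]

end Datum

/-! ### Paths through an antidiagonal of `u` or `v` -/

section Line

/-- The partial sums of a sequence of zeros and ones take all values up to the last one. -/
theorem exists_sum_eq {f : ℕ → ℕ} (hf : ∀ l, f l ≤ 1) {K r : ℕ}
    (h : r < ∑ l ∈ Finset.range K, f l) :
    ∃ l < K, f l = 1 ∧ ∑ i ∈ Finset.range l, f i = r := by
  induction K with
  | zero => simp at h
  | succ K ih =>
    rw [Finset.sum_range_succ] at h
    by_cases h1 : r < ∑ l ∈ Finset.range K, f l
    · obtain ⟨l, h2, h3⟩ := ih h1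
      exact ⟨l, by omega, h3⟩
    · have := hf K
      exact ⟨K, by omega, by omega, by omega⟩

/-- The number of edges of `O p (m + 1)` that come from the previous antidiagonal. -/
def Bits.inc (g : Bits) : ℕ → ℕ → ℕ
  | 0, _ => 0
  | p + 1, m => g.RT p m + g.UA p m

/-- The number of paths that enter the antidiagonal `p` below `O p (m + 1)`. -/
def Bits.rho (g : Bits) (p m : ℕ) : ℕ := ∑ l ∈ Finset.range m, g.inc p l

theorem Bits.inc_succ (g : Bits) (p m : ℕ) : g.inc (p + 1) m = g.RT p m + g.UA p m := rfl

theorem Bits.rho_zero (g : Bits) (p : ℕ) : g.rho p 0 = 0 := rfl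

theorem Bits.rho_succ (g : Bits) (p m : ℕ) : g.rho p (m + 1) = g.rho p m + g.inc p m :=
  Finset.sum_range_succ _ _

variable {D : Datum} {g : Bits}

/-- The paths that enter the antidiagonal `p` are, from below, those on the stack. -/
structure Entering (D : Datum) (g : Bits) (p : ℕ) : Prop where
  reach : ∀ m, m < p → g.inc p m = 1 → g.graph.Reachable (O p (m + 1)) (D.stack p (g.rho p m))
  total : g.rho p p + D.pc p = p

theorem odd_inc (hL : g.Local D.n D.s D.z) {p m : ℕ} (hp : p < 2 * D.n) (hm : m < p) :
    g.DN p (m + 1) + g.LF p m + g.inc p m = 2 := by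
  obtain ⟨q, rfl⟩ : ∃ q, p = q + 1 := ⟨p - 1, by omega⟩
  have := hL.odd q m (by omega) hp
  simp only [Bits.inc_succ]; omega

/-- A letter `0` pushes an external end on the stack. -/
theorem entering_push (hL : g.Local D.n D.s D.z) (hS : Shape D g) {p : ℕ} (hp : p + 1 < 2 * D.n)
    (hout : p < D.U ∨ D.U + D.a + D.b ≤ p) (h1 : ¬ D.one p) (hE : Entering D g p) :
    Entering D g (p + 1) := by
  have hDN : ∀ m, m ≤ p → g.DN p m = 1 := fun m hm => hS.DN_outer p m (by omega) hout h1 hm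
  have hodd : ∀ m, m < p → g.LF p m + g.inc p m = 1 := fun m hm => by
    have := odd_inc hL (p := p) (by omega) hm
    have := hDN (m + 1) hm
    omega
  have hreach : ∀ m, m ≤ p → g.graph.Reachable (E p m) (D.stack (p + 1) (g.rho p m)) := by
    intro m
    induction m with
    | zero =>
      intro _
      rw [Bits.rho_zero, Datum.stack_not_zero h1]
      exact (Bits.adj_DN.2 (hDN 0 (by omega))).reachable
    | succ m ih =>
      intro hm
      refine (Bits.adj_DN.2 (hDN (m + 1) hm)).reachable.trans ?_
      have := hodd m hm
      by_cases h : g.inc p m = 1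
      · rw [Bits.rho_succ, h, Datum.stack_not_succ h1]
        exact hE.reach m hm h
      · rw [Bits.rho_succ, show g.inc p m = 0 by omega]
        exact (Bits.adj_LF.2 (by omega)).symm.reachable.trans (ih (by omega))
  have hrho : ∀ m, m ≤ p → g.rho (p + 1) m + g.UA p m = g.rho p m := by
    intro m
    induction m with
    | zero => intro _; simp [Bits.rho_zero, hL.UA_zero]
    | succ m ih =>
      intro hm
      have h2 := ih (by omega)
      have h3 := hL.even p m hm hp
      have h4 := hDN m (by omega)
      have h5 := hodd m hm
      rw [Bits.rho_succ, Bits.rho_succ]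
      simp only [Bits.inc_succ]
      omega
  refine ⟨fun m hm h => ?_, ?_⟩
  · have h2 := hrho m (by omega)
    simp only [Bits.inc_succ] at h
    by_cases h3 : g.RT p m = 1
    · rw [show g.rho (p + 1) m = g.rho p m by omega]
      exact (Bits.adj_RT.2 h3).symm.reachable.trans (hreach m (by omega))
    · obtain ⟨l, rfl⟩ : ∃ l, m = l + 1 := by
        have := hL.UA_supp p m (by omega)
        exact ⟨m - 1, by omega⟩
      have h4 := hL.even p l (by omega) hp
      have h5 := hDN l (by omega)
      have h6 := hodd l (by omega)
      have h7 := g.rho_succ p l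
      rw [show g.rho (p + 1) (l + 1) = g.rho p l by omega]
      exact (Bits.adj_UA.2 (by omega)).symm.reachable.trans (hreach l (by omega))
  · have h2 := hrho p le_rfl
    have h3 := hE.total
    rw [D.pc_not (by omega) h1, Bits.rho_succ]
    simp only [Bits.inc_succ]
    rw [hL.RT_left p hp]
    omega

/-- On an antidiagonal with letter `1`, the paths leave in the order of the stack. -/
theorem reachable_of_one (hL : g.Local D.n D.s D.z) (hS : Shape D g) {p : ℕ} (hp : p < 2 * D.n)
    (hout : p < D.U ∨ D.U + D.a + D.b ≤ p) (h1 : D.one p) (hE : Entering D g p) {m : ℕ}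
    (hm : m ≤ p) : g.graph.Reachable (E p m) (D.stack p (g.rho p m)) := by
  induction hm using Nat.decreasingInduction with
  | self =>
    have h2 := hE.total
    have h3 := D.two_mul_pc_le hp.le
    have h4 : D.sc p = D.pc p := by
      rcases hout with h | h
      · exact D.sc_of_le h.le
      · exact D.sc_of_ge h hp.le
    have h5 := Datum.stack_source_eq (D := D) (e := p - 2 * D.pc p) hp ((D.s_iff p hp hout).2 h1)
      (by omega)
    rw [show g.rho p p = p - 2 * D.pc p + D.sc p by omega, h5]
  | of_succ m hm ih =>
    have h2 := hS.LF_outer p m hp hout h1 hm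
    have h3 := odd_inc hL hp hm
    refine (Bits.adj_LF.2 h2).reachable.trans ?_
    by_cases h : g.inc p m = 1
    · exact hE.reach m hm h
    · have h4 := hL.DN_le p (m + 1)
      rw [Bits.rho_succ, show g.inc p m = 0 by omega] at ih
      exact (Bits.adj_DN.2 (by omega)).symm.reachable.trans ih

/-- A letter `1` pops the stack. -/
theorem entering_pop (hL : g.Local D.n D.s D.z) (hS : Shape D g) {p : ℕ} (hp : p + 1 < 2 * D.n)
    (hout : p < D.U ∨ D.U + D.a + D.b ≤ p) (h1 : D.one p) (hE : Entering D g p) :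
    Entering D g (p + 1) := by
  have hLF : ∀ m, m < p → g.LF p m = 1 := fun m hm => hS.LF_outer p m (by omega) hout h1 hm
  have hodd : ∀ m, m < p → g.DN p (m + 1) + g.inc p m = 1 := fun m hm => by
    have := odd_inc hL (p := p) (by omega) hm
    have := hLF m hm
    omega
  have hDN0 := hL.DN_zero p (by omega)
  have hrho : ∀ m, m ≤ p → g.rho (p + 1) m + g.UA p m = g.rho p (m - 1) := by
    intro m
    induction m with
    | zero => intro _; simp [Bits.rho_zero, hL.UA_zero]
    | succ m ih =>
      intro hm
      have h2 := ih (by omega)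
      have h3 := hL.even p m hm hp
      have h4 := hLF m hm
      rw [Bits.rho_succ]
      simp only [Bits.inc_succ]
      rcases m with _ | l
      · simp only [Nat.zero_add, Nat.sub_self, Nat.zero_sub] at *; omega
      · have h5 := hodd l (by omega)
        have h6 := g.rho_succ p l
        simp only [Nat.add_sub_cancel] at *
        omega
  have hstep : ∀ m, m ≤ p → g.DN p m = 0 → g.rho p m = g.rho p (m - 1) + 1 := by
    intro m hm h
    rcases m with _ | l
    · omega
    · have := hodd l (by omega)
      rw [Bits.rho_succ, Nat.add_sub_cancel]; omega
  have hDNp := (hL.DN_left p (by omega)).2 ((D.s_iff p (by omega) hout).2 h1)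
  refine ⟨fun m hm h => ?_, ?_⟩
  · have h2 := hrho m (by omega)
    simp only [Bits.inc_succ] at h
    rw [Datum.stack_one h1]
    by_cases h3 : g.RT p m = 1
    · have h4 : g.DN p m = 0 := by
        rcases (Nat.lt_succ_iff.1 hm).lt_or_eq with h5 | h5
        · have := hL.even p m h5 hp
          have := hLF m h5
          omega
        · rw [h5]; exact hDNp
      have := hstep m (by omega) h4
      rw [show g.rho (p + 1) m + 1 = g.rho p m by omega]
      exact (Bits.adj_RT.2 h3).symm.reachable.trans
        (reachable_of_one hL hS (by omega) hout h1 hE (by omega))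
    · obtain ⟨l, rfl⟩ : ∃ l, m = l + 1 := by
        have := hL.UA_supp p m (by omega)
        exact ⟨m - 1, by omega⟩
      rw [Nat.add_sub_cancel] at h2
      rw [show g.rho (p + 1) (l + 1) + 1 = g.rho p l by omega]
      exact (Bits.adj_UA.2 (by omega)).symm.reachable.trans
        (reachable_of_one hL hS (by omega) hout h1 hE (by omega))
  · have h2 := hrho p le_rfl
    have h3 := hE.total
    have h4 := hstep p le_rfl hDNp
    rw [D.pc_one (by omega) h1, Bits.rho_succ]
    simp only [Bits.inc_succ]
    rw [hL.RT_left p hp]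
    omega

theorem entering_U (hL : g.Local D.n D.s D.z) (hS : Shape D g) {p : ℕ} (hp : p ≤ D.U) :
    Entering D g p := by
  have := D.P_lt
  induction p with
  | zero => exact ⟨by omega, by simp [Bits.rho_zero, D.pc_zero]⟩
  | succ p ih =>
    by_cases h : D.one p
    · exact entering_pop hL hS (by omega) (Or.inl hp) h (ih (by omega))
    · exact entering_push hL hS (by omega) (Or.inl hp) h (ih (by omega))

theorem entering_right (hL : g.Local D.n D.s D.z) (hS : Shape D g)
    (hP : Entering D g (D.U + D.a + D.b)) {p : ℕ} (hp : D.U + D.a + D.b ≤ p) (hp' : p < 2 * D.n) :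
    Entering D g p := by
  induction p, hp using Nat.le_induction with
  | base => exact hP
  | succ p hp ih =>
    by_cases h : D.one p
    · exact entering_pop hL hS (by omega) (Or.inr hp) h (ih (by omega))
    · exact entering_push hL hS (by omega) (Or.inr hp) h (ih (by omega))

theorem reachable_X_of_outer (hL : g.Local D.n D.s D.z) (hS : Shape D g) {p : ℕ}
    (hp : p < 2 * D.n) (hout : p < D.U ∨ D.U + D.a + D.b ≤ p) (h1 : D.one p)
    (hE : Entering D g p) : g.graph.Reachable (O p 0) (D.stack p 0) :=
  (Bits.adj_DN.2 (hL.DN_zero p hp)).symm.reachable.trans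
    (reachable_of_one hL hS hp hout h1 hE (Nat.zero_le p))

end Line

/-! ### Paths through the middle part -/

section Middle

variable {D : Datum} {g : Bits}

/-- The number of points on the `k`-th line parallel to the left boundary, on the first `t`
antidiagonals of the middle part, at which no edge goes down. -/
def Bits.lam (g : Bits) (U t k : ℕ) : ℕ := ∑ i ∈ Finset.range t, (1 - g.DN (U + i) (U + i - k))

theorem Bits.lam_succ (g : Bits) (U t k : ℕ) :
    g.lam U (t + 1) k = g.lam U t k + (1 - g.DN (U + t) (U + t - k)) :=
  Finset.sum_range_succ _ _

/-- The number of points below `E p m` on its antidiagonal at which no edge goes to the left. -/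
def Bits.zeta (g : Bits) (p m : ℕ) : ℕ := ∑ l ∈ Finset.range m, (1 - g.LF p l)

theorem Bits.zeta_succ (g : Bits) (p m : ℕ) :
    g.zeta p (m + 1) = g.zeta p m + (1 - g.LF p m) :=
  Finset.sum_range_succ _ _

/-- The edges to the right of the strip and those that lead into it are all present. -/
theorem RT_strip_pred (hS : Shape D g) {q m : ℕ} (h1 : D.U ≤ q + 1)
    (h2 : q < D.U + D.a + D.b) (hm : m ≤ q) (h3 : q < m + D.u0) : g.RT q m = 1 := by
  have := D.U_eq
  rcases h1.lt_or_eq with h | h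
  · exact hS.RT_strip q m (by omega) h2 hm h3
  · exact hS.RT_U q m h.symm hm (by omega)

/-- On the left boundary, the points without an edge below are the letters `1` of `σ`. -/
theorem sc_middle (hL : g.Local D.n D.s D.z) {t : ℕ} (ht : t ≤ D.a + D.b) :
    D.sc (D.U + t) = D.u1 + g.lam D.U t 0 := by
  have h0 := D.P_lt
  induction t with
  | zero =>
    rw [Nat.add_zero, D.sc_of_le le_rfl, D.pc_of_le le_rfl, D.c_U]
    simp [Bits.lam]
  | succ t ih =>
    have h1 := ih (by omega)
    have h2 := hL.DN_left (D.U + t) (by omega)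
    have h3 := hL.DN_le (D.U + t) (D.U + t)
    rw [Bits.lam_succ, Nat.sub_zero]
    by_cases h : D.s (D.U + t)
    · rw [← Nat.add_assoc, D.sc_one _ (by omega) h, h1, h2.2 h]
      omega
    · have h4 := h2.not.2 h
      rw [← Nat.add_assoc, D.sc_not _ (by omega) h, h1]
      omega

/-- The line parallel to the left boundary passes its paths on to the next one, up to the path that
is on its way between them. -/
theorem lam_succ_right (hL : g.Local D.n D.s D.z) (hS : Shape D g) {t k : ℕ} (ht : t ≤ D.a + D.b)
    (hk : k + 1 < D.u0) :
    g.lam D.U t (k + 1) = g.lam D.U t k + g.UA (D.U + t - 1) (D.U + t - 1 - k) := by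
  have h0 := D.P_lt
  have hU := D.U_pos
  have hUe := D.U_eq
  induction t with
  | zero =>
    rw [Nat.add_zero, hS.UA_U _ _ (by omega)]
    simp [Bits.lam]
  | succ t ih =>
    have h1 := ih (by omega)
    obtain ⟨q, hq⟩ : ∃ q, D.U + t = q + 1 := ⟨D.U + t - 1, by omega⟩
    rw [Bits.lam_succ, Bits.lam_succ, h1]
    rw [show D.U + (t + 1) - 1 = q + 1 by omega, hq]
    simp only [Nat.add_sub_cancel]
    obtain ⟨m, hm⟩ : ∃ m, q + 1 - (k + 1) = m := ⟨_, rfl⟩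
    rw [show q + 1 - k = m + 1 by omega, show q - k = m by omega, hm]
    have h2 := hL.odd q m (by omega) (by omega)
    have h3 := RT_strip_pred hS (q := q) (m := m) (by omega) (by omega) (by omega) (by omega)
    have h4 := hS.RT_strip (q + 1) m (by omega) (by omega) (by omega) (by omega)
    have h5 := hL.even (q + 1) m (by omega) (by omega)
    have h6 := hL.DN_le (q + 1) m
    have h7 := hL.DN_le (q + 1) (m + 1)
    omega

/-- The paths along the left strip come from the stack. -/
theorem strip_reachable (hL : g.Local D.n D.s D.z) (hS : Shape D g) (hE : Entering D g D.U)
    {k : ℕ} (hk : k < D.u0) {t : ℕ} (ht : t ≤ D.a + D.b) :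
    g.graph.Reachable (O (D.U + t) (D.U + t - k))
      (D.stack D.U (D.u0 - 1 - k + g.lam D.U t k)) := by
  have h0 := D.P_lt
  have hU := D.U_pos
  have hUe := D.U_eq
  have hincU : ∀ m, m < D.U → g.inc D.U m = if D.u1 ≤ m then 1 else 0 := by
    intro m hm
    obtain ⟨q, hq⟩ : ∃ q, D.U = q + 1 := ⟨D.U - 1, by omega⟩
    rw [hq, Bits.inc_succ, hS.UA_U _ _ hq.symm]
    split_ifs with h
    · rw [hS.RT_U _ _ hq.symm (by omega) h]
    · rw [hS.RT_U' _ _ hq.symm (by omega)]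
  have hrhoU : ∀ m, m ≤ D.U → g.rho D.U m = m - D.u1 := by
    intro m
    induction m with
    | zero => intro _; rw [Bits.rho_zero]; omega
    | succ m ih =>
      intro hm
      rw [Bits.rho_succ, ih (by omega), hincU m hm]
      split_ifs <;> omega
  induction k generalizing t with
  | zero =>
    induction t with
    | zero =>
      have h1 := hE.reach (D.U - 1) (by omega) (by rw [hincU _ (by omega), if_pos (by omega)])
      rw [hrhoU _ (by omega)] at h1
      simpa [Bits.lam, show D.U - 1 + 1 = D.U by omega,
        show D.U - 1 - D.u1 = D.u0 - 1 by omega] using h1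
    | succ t ih =>
      have h1 := ih (by omega)
      rw [Nat.sub_zero] at h1 ⊢
      have h2 := hL.RT_left (D.U + t) (by omega)
      rw [Nat.sub_zero]
      refine (Bits.adj_RT.2 h2).symm.reachable.trans ?_
      rw [Bits.lam_succ, Nat.sub_zero]
      have h4 := hL.DN_le (D.U + t) (D.U + t)
      by_cases h3 : g.DN (D.U + t) (D.U + t) = 1
      · rw [h3]
        exact (Bits.adj_DN.2 h3).reachable.trans h1
      · have h5 : D.s (D.U + t) := (hL.DN_left _ (by omega)).1 (by omega)
        have h6 := Datum.stack_source (D := D) (p := D.U) (e := D.u0 - D.u1)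
          (r := D.sc (D.U + t)) (by omega)
          (by have := D.two_mul_pc_le (p := D.U) (by omega)
              rw [D.pc_of_le le_rfl, D.c_U] at this ⊢; omega)
        have h7 : D.stack 0 (D.sc (D.U + t)) = E (D.U + t) (D.U + t) := by
          rw [Datum.stack, D.source_sc (by omega) h5]
        have h8 := sc_middle (g := g) hL (t := t) (by omega)
        have h9 := D.two_mul_pc_le (p := D.U) (by omega)
        rw [D.pc_of_le le_rfl, D.c_U] at h9
        rw [show D.u0 - 1 + (g.lam D.U t 0 + (1 - g.DN (D.U + t) (D.U + t))) =
          D.u0 - D.u1 + D.sc (D.U + t) by omega, h6, h7]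
  | succ k ihk =>
    induction t with
    | zero =>
      have h1 := hE.reach (D.U - (k + 1) - 1) (by omega)
        (by rw [hincU _ (by omega), if_pos (by omega)])
      rw [hrhoU _ (by omega)] at h1
      rw [show D.U - (k + 1) - 1 + 1 = D.U - (k + 1) by omega,
        show D.U - (k + 1) - 1 - D.u1 = D.u0 - 1 - (k + 1) by omega] at h1
      simpa [Bits.lam] using h1
    | succ t ih =>
      have h1 := ih (by omega)
      have hk1 := ihk (by omega) (t := t) (by omega)
      have hk2 := ihk (by omega) (t := t + 1) (by omega)
      have hlam1 := lam_succ_right hL hS (t := t) (by omega) hk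
      have hlam2 := lam_succ_right hL hS (t := t + 1) (by omega) hk
      obtain ⟨q, hq⟩ : ∃ q, D.U + t = q + 1 := ⟨D.U + t - 1, by omega⟩
      obtain ⟨m, hm⟩ : ∃ m, q + 1 - (k + 1) = m := ⟨_, rfl⟩
      rw [Bits.lam_succ] at hlam2 ⊢
      rw [← Nat.add_assoc] at hk2 hlam2 ⊢
      rw [hq] at h1 hk1 hk2 hlam1 hlam2 ⊢
      rw [hm] at h1 hlam2 ⊢
      simp only [Nat.add_sub_cancel] at hlam1 hlam2
      rw [show q + 1 - k = m + 1 by omega] at hk1 hlam2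
      rw [show q - k = m by omega] at hlam1
      rw [show q + 1 + 1 - k = m + 2 by omega] at hk2
      rw [show q + 1 + 1 - (k + 1) = m + 1 by omega]
      have h3 := RT_strip_pred hS (q := q) (m := m) (by omega) (by omega) (by omega) (by omega)
      have h4 := hS.RT_strip (q + 1) m (by omega) (by omega) (by omega) (by omega)
      refine (Bits.adj_RT.2 h4).symm.reachable.trans ?_
      have h5 := hL.odd q m (by omega) (by omega)
      have h6 := hL.even (q + 1) m (by omega) (by omega)
      have h7 := hL.DN_le (q + 1) m
      by_cases h8 : g.DN (q + 1) m = 1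
      · rw [h8]
        exact (Bits.adj_DN.2 h8).reachable.trans h1
      · by_cases h9 : g.LF (q + 1) m = 1
        · rw [show D.u0 - 1 - (k + 1) + (g.lam D.U t (k + 1) + (1 - g.DN (q + 1) m)) =
            D.u0 - 1 - k + g.lam D.U t k by omega]
          exact (Bits.adj_LF.2 h9).reachable.trans hk1
        · rw [show D.u0 - 1 - (k + 1) + (g.lam D.U t (k + 1) + (1 - g.DN (q + 1) m)) =
            D.u0 - 1 - k + g.lam D.U (t + 1) k by omega]
          exact (Bits.adj_UA.2 (by omega)).reachable.trans hk2

/-- In the central part, an edge upwards makes the only difference between the numbers of paths on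
consecutive antidiagonals. -/
theorem zeta_add (hL : g.Local D.n D.s D.z) (hS : Shape D g) {p : ℕ} (hp : D.U ≤ p)
    (hp' : p + 1 < D.U + D.a + D.b) {m : ℕ} (hm : m + D.u0 ≤ p + 1) :
    g.zeta (p + 1) m + g.UA p m = g.zeta p m := by
  have h0 := D.P_lt
  have hu0 := D.u0_pos
  induction m with
  | zero => simp [Bits.zeta, hL.UA_zero]
  | succ m ih =>
    have h1 := ih (by omega)
    rw [Bits.zeta_succ, Bits.zeta_succ]
    have h2 := hS.DN_center (p + 1) (m + 1) (by omega) hp' hm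
    have h3 := hS.DN_center p m hp (by omega) (by omega)
    have h4 := hL.odd p m (by omega) (by omega)
    have h5 := hL.even p m (by omega) (by omega)
    omega

/-- In the central part, the paths enter from below and leave to the right one after the other. -/
theorem center_reachable (hL : g.Local D.n D.s D.z) (hS : Shape D g) {m p : ℕ} (hp : D.U ≤ p)
    (hp' : p < D.U + D.a + D.b) (hm : m + D.u0 ≤ p) :
    g.graph.Reachable (E p m) (O (p - g.zeta p m) 0) := by
  have h0 := D.P_lt
  have hU := D.U_pos
  have hUe := D.U_eq
  have hu0 := D.u0_pos
  induction m using Nat.strong_induction_on generalizing p with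
  | _ m ih =>
    have hd := hS.DN_center p m hp hp' hm
    refine (Bits.adj_DN.2 hd).reachable.trans ?_
    rcases m with _ | l
    · simp [Bits.zeta]
    obtain ⟨q, rfl⟩ : ∃ q, p = q + 1 := ⟨p - 1, by omega⟩
    have hodd := hL.odd q l (by omega) (by omega)
    by_cases h1 : g.LF (q + 1) l = 1
    · refine (Bits.adj_LF.2 h1).symm.reachable.trans ?_
      rw [Bits.zeta_succ, h1]
      exact ih l (by omega) hp hp' (by omega)
    · have hq : D.U ≤ q := by
        by_contra hq
        have h2 := hS.RT_U' q l (by omega) (by omega)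
        have h3 := hS.UA_U q l (by omega)
        omega
      have hz := zeta_add hL hS hq hp' (m := l) (by omega)
      rw [Bits.zeta_succ]
      by_cases h2 : g.RT q l = 1
      · refine (Bits.adj_RT.2 h2).symm.reachable.trans ?_
        rw [show q + 1 - (g.zeta (q + 1) l + (1 - g.LF (q + 1) l)) = q - g.zeta q l by omega]
        exact ih l (by omega) hq (by omega) (by omega)
      · have h3 : g.UA q l = 1 := by omega
        have h4 := hL.UA_supp q l (by omega)
        obtain ⟨l, rfl⟩ : ∃ l', l = l' + 1 := ⟨l - 1, by omega⟩
        refine (Bits.adj_UA.2 h3).symm.reachable.trans ?_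
        have h5 := hL.even q l (by omega) (by omega)
        have h6 := hS.DN_center q l hq (by omega) (by omega)
        rw [g.zeta_succ q l] at hz
        rw [show q + 1 - (g.zeta (q + 1) (l + 1) + (1 - g.LF (q + 1) (l + 1))) =
          q - g.zeta q l by omega]
        exact ih l (by omega) hq (by omega) (by omega)

theorem zeta_U (hL : g.Local D.n D.s D.z) (hS : Shape D g) (h : 0 < D.a + D.b) {m : ℕ}
    (hm : m ≤ D.u1) : g.zeta D.U m = 0 := by
  have h0 := D.P_lt
  have hU := D.U_pos
  have hUe := D.U_eq
  have hu0 := D.u0_pos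
  induction m with
  | zero => rfl
  | succ m ih =>
    obtain ⟨q, hq⟩ : ∃ q, D.U = q + 1 := ⟨D.U - 1, by omega⟩
    have h1 := hL.odd q m (by omega) (by omega)
    have h2 := hS.RT_U' q m (by omega) (by omega)
    have h3 := hS.UA_U q m (by omega)
    have h4 := hL.DN_le (q + 1) (m + 1)
    rw [Bits.zeta_succ, ih (by omega), hq]
    omega

/-- On every middle antidiagonal, the paths that leave to the right and those that leave into the
left strip add up to the number of paths that have entered. -/
theorem zeta_add_lam (hL : g.Local D.n D.s D.z) (hS : Shape D g) {t : ℕ} (ht : t < D.a + D.b) :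
    g.zeta (D.U + t) (D.u1 + t + 1) + g.lam D.U (t + 1) (D.u0 - 1) = t + 1 := by
  have h0 := D.P_lt
  have hU := D.U_pos
  have hUe := D.U_eq
  have hu0 := D.u0_pos
  induction t with
  | zero =>
    rw [Bits.lam_succ, Nat.add_zero, Nat.add_zero, Bits.zeta_succ, zeta_U hL hS ht le_rfl]
    obtain ⟨q, hq⟩ : ∃ q, D.U = q + 1 := ⟨D.U - 1, by omega⟩
    have h1 := hL.odd q D.u1 (by omega) (by omega)
    have h2 := hS.RT_U q D.u1 (by omega) (by omega) le_rfl
    have h3 := hS.UA_U q D.u1 (by omega)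
    rw [show D.U - (D.u0 - 1) = D.u1 + 1 by omega, hq]
    simp only [Bits.lam, Finset.range_zero, Finset.sum_empty]
    omega
  | succ t ih =>
    have h1 := ih (by omega)
    have h2 := zeta_add hL hS (p := D.U + t) (by omega) (by omega) (m := D.u1 + t + 1) (by omega)
    have h3 := hL.odd (D.U + t) (D.u1 + t + 1) (by omega) (by omega)
    have h4 := hS.RT_strip (D.U + t) (D.u1 + t + 1) (by omega) (by omega) (by omega) (by omega)
    have h5 := hL.DN_le (D.U + t + 1) (D.u1 + t + 1 + 1)
    have h6 := hL.LF_le (D.U + t + 1) (D.u1 + t + 1)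
    rw [Bits.lam_succ, ← Nat.add_assoc, ← Nat.add_assoc,
      show D.u1 + (t + 1) = D.u1 + t + 1 by omega, Bits.zeta_succ,
      show D.U + t + 1 - (D.u0 - 1) = D.u1 + t + 1 + 1 by omega]
    omega

/-- No edge goes up from the strip to the antidiagonals of `v`. -/
theorem UA_last (hL : g.Local D.n D.s D.z) (hS : Shape D g) {q m : ℕ}
    (hq : q + 1 = D.U + D.a + D.b) (hm : m ≤ q) (hm' : q < m + D.u0) : g.UA q m = 0 := by
  have h0 := D.P_lt
  have h1 := hL.odd q m (by omega) (by omega)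
  have h2 := RT_strip_pred hS (q := q) (m := m) (by omega) (by omega) hm hm'
  by_cases h3 : D.one (q + 1)
  · have := hS.LF_outer (q + 1) m (by omega) (Or.inr (by omega)) h3 (by omega)
    omega
  · have := hS.DN_outer (q + 1) (m + 1) (by omega) (Or.inr (by omega)) h3 (by omega)
    omega

/-- At the end, each line of the strip has passed on `b` paths. -/
theorem lam_last (hL : g.Local D.n D.s D.z) (hS : Shape D g) {k : ℕ} (hk : k < D.u0) :
    g.lam D.U (D.a + D.b) k = D.b := by
  have hU := D.U_pos
  have hUe := D.U_eq
  induction k with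
  | zero =>
    have h1 := sc_middle (g := g) hL (t := D.a + D.b) le_rfl
    rw [← Nat.add_assoc, D.sc_P] at h1
    omega
  | succ k ih =>
    rw [lam_succ_right hL hS le_rfl hk, ih (by omega),
      UA_last hL hS (by omega) (by omega) (by omega), Nat.add_zero]

theorem stack_pop_middle {t : ℕ} (ht : t ≤ D.b) (r : ℕ) :
    D.stack (D.U + t) r = D.stack D.U (t + r) := by
  induction t generalizing r with
  | zero => simp
  | succ t ih =>
    rw [← Nat.add_assoc, Datum.stack_one (D.mid_one _ (by omega) (by omega)), ih (by omega)]
    congr 1; omega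

theorem stack_push_middle {t : ℕ} (ht : t ≤ D.a) (r : ℕ) :
    D.stack (D.U + D.b + t) (t + r) = D.stack D.U (D.b + r) := by
  induction t with
  | zero => rw [Nat.add_zero, Nat.zero_add, stack_pop_middle le_rfl]
  | succ t ih =>
    rw [← Nat.add_assoc, show t + 1 + r = (t + r) + 1 by omega,
      Datum.stack_not_succ (D.mid_zero _ (by omega) (by omega)), ih (by omega)]

theorem stack_push_middle_lt {t r : ℕ} (ht : t ≤ D.a) (hr : r < t) :
    D.stack (D.U + D.b + t) r = O (D.U + D.b + t - 1 - r) 0 := by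
  induction t generalizing r with
  | zero => omega
  | succ t ih =>
    rw [← Nat.add_assoc]
    rcases r with _ | r
    · rw [Datum.stack_not_zero (D.mid_zero _ (by omega) (by omega))]
      rfl
    · rw [Datum.stack_not_succ (D.mid_zero _ (by omega) (by omega)), ih (by omega) (by omega)]
      congr 1; omega

/-- The paths from the external ends with letter `1` in the middle part leave the central part into
the strip, and they pop the stack one after the other. -/
theorem reachable_X_of_middle (hL : g.Local D.n D.s D.z) (hS : Shape D g) (hE : Entering D g D.U)
    {j : ℕ} (hj : j < D.b) : g.graph.Reachable (O (D.U + j) 0) (D.stack (D.U + j) 0) := by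
  have h0 := D.P_lt
  have hU := D.U_pos
  have hUe := D.U_eq
  have hu0 := D.u0_pos
  obtain ⟨t, ht, h1, h2⟩ := exists_sum_eq
    (f := fun i => 1 - g.DN (D.U + i) (D.U + i - (D.u0 - 1))) (fun l => by omega)
    (K := D.a + D.b) (r := j) (by
      have := lam_last hL hS (k := D.u0 - 1) (by omega)
      simp only [Bits.lam] at this
      omega)
  change g.lam D.U t (D.u0 - 1) = j at h2
  have h3 := strip_reachable hL hS hE (k := D.u0 - 1) (by omega) (t := t) (by omega)
  rw [stack_pop_middle hj.le, Nat.add_zero]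
  rw [h2, show D.u0 - 1 - (D.u0 - 1) + j = j by omega] at h3
  refine SimpleGraph.Reachable.trans ?_ h3
  obtain ⟨q, hq⟩ : ∃ q, D.U + t = q + 1 := ⟨D.U + t - 1, by omega⟩
  obtain ⟨m, hm⟩ : ∃ m, q + 1 - (D.u0 - 1) = m + 1 := ⟨D.u1 + t, by omega⟩
  have hmt : m = D.u1 + t := by omega
  rw [hq, hm] at h1 ⊢
  have h4 := hL.odd q m (by omega) (by omega)
  have h5 := RT_strip_pred hS (q := q) (m := m) (by omega) (by omega) (by omega) (by omega)
  have h6 := zeta_add_lam hL hS ht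
  rw [Bits.lam_succ, h2, hq, hm, Bits.zeta_succ, ← hmt] at h6
  by_cases h7 : g.LF (q + 1) m = 1
  · refine SimpleGraph.Reachable.trans ?_ (Bits.adj_LF.2 h7).reachable
    have h8 := center_reachable hL hS (p := q + 1) (m := m) (by omega) (by omega) (by omega)
    rw [show q + 1 - g.zeta (q + 1) m = D.U + j by omega] at h8
    exact h8.symm
  · have h8 : g.UA q m = 1 := by omega
    have h9 := hL.UA_supp q m (by omega)
    have h10 : D.U ≤ q := by
      by_contra h
      have := hS.UA_U q m (by omega)
      omega
    obtain ⟨t, rfl⟩ : ∃ t', t = t' + 1 := ⟨t - 1, by omega⟩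
    obtain ⟨l, rfl⟩ : ∃ l, m = l + 1 := ⟨m - 1, by omega⟩
    refine SimpleGraph.Reachable.trans ?_ (Bits.adj_UA.2 h8).reachable
    have h11 := center_reachable hL hS (p := q) (m := l) (by omega) (by omega) (by omega)
    have h12 := zeta_add_lam hL hS (t := t) (by omega)
    have h13 := hL.even q l (by omega) (by omega)
    have h14 := hS.DN_center q l h10 (by omega) (by omega)
    rw [h2, show D.U + t = q by omega, show D.u1 + t + 1 = l + 1 by omega, Bits.zeta_succ] at h12
    rw [show q - g.zeta q l = D.U + j by omega] at h11
    exact h11.symm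

/-- The paths that leave the middle part to the right are those on the stack. -/
theorem entering_P (hL : g.Local D.n D.s D.z) (hS : Shape D g) :
    Entering D g (D.U + D.a + D.b) := by
  have h0 := D.P_lt
  have hU := D.U_pos
  have hUe := D.U_eq
  have hu0 := D.u0_pos
  have hE := entering_U hL hS (p := D.U) le_rfl
  by_cases hab : D.a + D.b = 0
  · rw [show D.U + D.a + D.b = D.U by omega]; exact hE
  obtain ⟨q, hq⟩ : ∃ q, D.U + D.a + D.b = q + 1 := ⟨D.U + D.a + D.b - 1, by omega⟩
  obtain ⟨t, ht⟩ : ∃ t, D.a + D.b = t + 1 := ⟨D.a + D.b - 1, by omega⟩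
  obtain ⟨m₀, hm₀⟩ : ∃ m₀, D.u1 + t + 1 = m₀ := ⟨_, rfl⟩
  have hlast : ∀ m, m ≤ q → m₀ ≤ m → g.UA q m = 0 ∧ g.RT q m = 1 := fun m h1 h2 =>
    ⟨UA_last hL hS (by omega) h1 (by omega), hS.RT_strip q m (by omega) (by omega) h1 (by omega)⟩
  have hzq : g.zeta q m₀ = D.a := by
    have h1 := zeta_add_lam hL hS (t := t) (by omega)
    rw [← ht, lam_last hL hS (by omega), show D.U + t = q by omega, hm₀] at h1
    omega
  have hrho : ∀ m, m ≤ m₀ → g.rho (q + 1) m + g.UA q m = g.zeta q m := by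
    intro m
    induction m with
    | zero => intro _; simp [Bits.rho_zero, hL.UA_zero, Bits.zeta]
    | succ m ih =>
      intro hm
      have h1 := ih (by omega)
      rw [Bits.rho_succ, Bits.inc_succ, Bits.zeta_succ]
      have h2 := hS.DN_center q m (by omega) (by omega) (by omega)
      have h3 := hL.even q m (by omega) (by omega)
      omega
  have hrho' : ∀ i, i ≤ D.u0 → g.rho (q + 1) (m₀ + i) = D.a + i := by
    intro i
    induction i with
    | zero =>
      intro _
      have h1 := hrho m₀ le_rfl
      have h2 := (hlast m₀ (by omega) le_rfl).1
      simp only [Nat.add_zero]; omega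
    | succ i ih =>
      intro hi
      have h1 := ih (by omega)
      have h2 := hlast (m₀ + i) (by omega) (by omega)
      rw [← Nat.add_assoc, Bits.rho_succ, Bits.inc_succ]; omega
  have hmono : ∀ m m', m ≤ m' → g.zeta q m ≤ g.zeta q m' := fun m m' h =>
    Finset.sum_le_sum_of_subset (Finset.range_mono h)
  rw [hq]
  refine ⟨fun m hm h => ?_, ?_⟩
  · rw [Bits.inc_succ] at h
    rcases Nat.lt_or_ge m m₀ with h1 | h1
    · have h2 := hrho m h1.le
      -- a path in the central part
      have key : ∀ l, l < m₀ → g.LF q l = 0 → g.rho (q + 1) m = g.zeta q l →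
          g.graph.Reachable (E q l) (D.stack (q + 1) (g.rho (q + 1) m)) := by
        intro l hl h3 h4
        have h5 := hmono (l + 1) m₀ hl
        rw [Bits.zeta_succ] at h5
        have h6 := center_reachable hL hS (p := q) (m := l) (by omega) (by omega) (by omega)
        have h7 := stack_push_middle_lt (D := D) (t := D.a) (r := g.zeta q l) le_rfl (by omega)
        rw [show D.U + D.b + D.a = q + 1 by omega, Nat.add_sub_cancel] at h7
        rw [h4, h7]
        exact h6
      by_cases h3 : g.RT q m = 1
      · refine (Bits.adj_RT.2 h3).symm.reachable.trans (key m h1 ?_ (by omega))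
        have h4 := hS.DN_center q m (by omega) (by omega) (by omega)
        have h5 := hL.even q m (by omega) (by omega)
        omega
      · have h4 : g.UA q m = 1 := by omega
        have h5 := hL.UA_supp q m (by omega)
        obtain ⟨l, rfl⟩ : ∃ l, m = l + 1 := ⟨m - 1, by omega⟩
        have h6 := hS.DN_center q l (by omega) (by omega) (by omega)
        have h7 := hL.even q l (by omega) (by omega)
        rw [Bits.zeta_succ] at h2
        exact (Bits.adj_UA.2 h4).symm.reachable.trans (key l (by omega) (by omega) (by omega))
    · obtain ⟨i, rfl⟩ : ∃ i, m = m₀ + i := ⟨m - m₀, by omega⟩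
      rw [hrho' i (by omega)]
      have h2 := strip_reachable hL hS hE (k := q - (m₀ + i)) (by omega) (t := D.a + D.b) le_rfl
      rw [lam_last hL hS (by omega), ← Nat.add_assoc, hq,
        show q + 1 - (q - (m₀ + i)) = m₀ + i + 1 by omega,
        show D.u0 - 1 - (q - (m₀ + i)) + D.b = D.b + i by omega] at h2
      have h3 := stack_push_middle (D := D) (t := D.a) le_rfl i
      rw [show D.U + D.b + D.a = q + 1 by omega] at h3
      rw [h3]
      exact h2
  · have h1 := hrho' D.u0 le_rfl
    rw [show m₀ + D.u0 = q + 1 by omega] at h1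
    rw [h1, D.pc_of_ge hq.le, ← hq, D.c_of_mid (by omega) le_rfl]
    omega

end Middle

/-! ### The paths of a configuration with the rigid part -/

section Linked

namespace Datum

variable (D : Datum)

/-- The letters of `π` at `i` and `j` are matched, in terms of the height function
`q ↦ q - 2 * D.pc q`. -/
def Match (i j : ℕ) : Prop :=
  i < j ∧ ¬ D.one i ∧ D.one j ∧ j + 2 * D.pc (i + 1) = i + 1 + 2 * D.pc j ∧
    ∀ q, i < q → q ≤ j → i + 1 + 2 * D.pc q ≤ q + 2 * D.pc (i + 1)

variable {D}

theorem Match.stack_eq {i j : ℕ} (h : D.Match i j) (hj : j < 2 * D.n) : D.stack j 0 = O i 0 := by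
  obtain ⟨h1, h2, -, h4, h5⟩ := h
  have := stack_eq_of_height (D := D) (k := i + 1) (l := j) h1 hj.le h5 0 0 (by omega)
  rw [stack_not_zero h2] at this
  exact this

theorem exists_match_left {j : ℕ} (hj : j < 2 * D.n) (h : D.one j) : ∃ i, D.Match i j := by
  have h1 := D.two_mul_pc_le (p := j + 1) hj
  rw [D.pc_one hj h] at h1
  let P : ℕ → Prop := fun q => q + 2 * D.pc j < j + 2 * D.pc q
  have h0 : P 0 := by simp only [P, D.pc_zero]; omega
  obtain ⟨i, hi⟩ : ∃ i, Nat.findGreatest P j = i := ⟨_, rfl⟩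
  have hP : P i := hi ▸ Nat.findGreatest_spec (Nat.zero_le j) h0
  have hij : i ≤ j := hi ▸ Nat.findGreatest_le j
  have hgr : ∀ q, i < q → q ≤ j → j + 2 * D.pc q ≤ q + 2 * D.pc j := fun q h2 h3 => by
    have := Nat.findGreatest_is_greatest (P := P) (hi.symm ▸ h2) h3
    simp only [P] at this; omega
  have hij' : i < j := by
    rcases hij.lt_or_eq with h2 | h2
    · exact h2
    · simp only [P, h2] at hP; omega
  simp only [P] at hP
  have h3 := hgr (i + 1) (by omega) hij'
  have hi1 : ¬ D.one i := fun h2 => by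
    rw [D.pc_one (by omega) h2] at h3; omega
  have h4 := D.pc_not (by omega) hi1
  exact ⟨i, hij', hi1, h, by omega, fun q h5 h6 => by have := hgr q h5 h6; omega⟩

theorem exists_match_right {i : ℕ} (hi : i < 2 * D.n) (h : ¬ D.one i) :
    ∃ j, j < 2 * D.n ∧ D.Match i j := by
  have h1 := D.two_mul_pc_le (p := i) hi.le
  have h2 := D.pc_not hi h
  let P : ℕ → Prop := fun q => i < q ∧ q + 2 * D.pc i < i + 1 + 2 * D.pc q
  have hP : P (2 * D.n) := by simp only [P, D.pc_end]; omega
  have hex : ∃ q, P q := ⟨_, hP⟩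
  classical
  obtain ⟨q, hq⟩ : ∃ q, Nat.find hex = q := ⟨_, rfl⟩
  have hq1 : P q := hq ▸ Nat.find_spec hex
  have hq2 : q ≤ 2 * D.n := hq ▸ Nat.find_min' hex hP
  have hmin : ∀ k, k < q → i < k → i + 1 + 2 * D.pc k ≤ k + 2 * D.pc i := fun k h3 h4 => by
    have := Nat.find_min hex (m := k) (hq.symm ▸ h3)
    simp only [P] at this; omega
  obtain ⟨j, rfl⟩ : ∃ j, q = j + 1 := ⟨q - 1, by have := hq1.1; omega⟩
  simp only [P] at hq1
  have hij : i < j := by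
    rcases Nat.lt_or_ge i j with h3 | h3
    · exact h3
    · obtain rfl : i = j := by omega
      omega
  have h3 := hmin j (by omega) hij
  have hj : D.one j := by
    by_contra h4
    rw [D.pc_not (by omega) h4] at hq1; omega
  have h4 := D.pc_one (by omega) hj
  exact ⟨j, by omega, hij, h, hj, by omega, fun k h5 h6 => by
    have := hmin k (by omega) h5; omega⟩

end Datum

variable {D : Datum} {g : Bits}

/-- The rigid part of a configuration determines how its end points are linked. -/
theorem linked_of_shape (hL : g.Local D.n D.s D.z) (hS : Shape D g) :
    g.Linked D.n D.s D.z D.Match := by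
  have h0 := D.P_lt
  have hEU : ∀ p, p ≤ D.U → Entering D g p := fun p hp => entering_U hL hS hp
  have hER : ∀ p, D.U + D.a + D.b ≤ p → p < 2 * D.n → Entering D g p := fun p hp hp' =>
    entering_right hL hS (entering_P hL hS) hp hp'
  have hX : ∀ j, j < 2 * D.n → D.one j → g.graph.Reachable (O j 0) (D.stack j 0) := by
    intro j hj h1
    rcases Nat.lt_or_ge j D.U with h2 | h2
    · exact reachable_X_of_outer hL hS hj (Or.inl h2) h1 (hEU j h2.le)
    rcases Nat.lt_or_ge j (D.U + D.b) with h3 | h3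
    · obtain ⟨i, rfl⟩ : ∃ i, j = D.U + i := ⟨j - D.U, by omega⟩
      exact reachable_X_of_middle hL hS (hEU _ le_rfl) (by omega)
    rcases Nat.lt_or_ge j (D.U + D.a + D.b) with h4 | h4
    · exact absurd h1 (D.mid_zero j h3 h4)
    · exact reachable_X_of_outer hL hS hj (Or.inr h4) h1 (hER j h4 hj)
  have hM : ∀ i j, D.Match i j → j < 2 * D.n → g.graph.Reachable (O j 0) (O i 0) :=
    fun i j h hj => h.stack_eq hj ▸ hX j hj h.2.2.1
  have hends : ∀ i j k, g.graph.Reachable (O i 0) (O j 0) → g.graph.Reachable (O i 0) (O k 0) →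
      i ≠ j → i ≠ k → j = k := by
    intro i j k h1 h2 h3 h4
    have := eq_of_reachable_ends hL.degree_le (fun _ _ => X_end) (fun _ _ => X_end)
      (fun _ _ => X_end) h1 h2 (by simpa using h3) (by simpa using h4)
    simpa using this
  refine ⟨fun i j hij hj => ⟨fun h => ?_, fun h => (hM i j h hj).symm⟩, fun i hi hs => ?_⟩
  · by_cases h1 : D.one j
    · obtain ⟨k, hk⟩ := Datum.exists_match_left hj h1
      have := hends j i k h.symm (hM k j hk hj) hij.ne' hk.1.ne'
      exact this ▸ hk
    · obtain ⟨k, hk', hk⟩ := Datum.exists_match_right hj h1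
      have := hends j i k h.symm (hM j k hk hk').symm hij.ne' hk.1.ne
      have := hk.1
      omega
  · have hN : D.one (2 * D.n - 1) := D.one_last
    obtain ⟨N, hNe⟩ : ∃ N, 2 * D.n - 1 = N := ⟨_, rfl⟩
    have hE := hER N (by omega) (by omega)
    rw [hNe] at hN
    have hpc := D.pc_one (by omega) hN
    rw [show N + 1 = 2 * D.n by omega, D.pc_end] at hpc
    have htot := hE.total
    have hsc : D.sc i < D.n := by
      have h1 := D.sc_mono (p := i + 1) (q := 2 * D.n) (by omega) le_rfl
      rw [D.sc_one i hi hs, D.sc_of_ge (by omega) le_rfl, D.pc_end] at h1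
      omega
    have hLF : ∀ m, m < N → g.LF N m = 1 := fun m hm => by
      have := hL.LF_right m (by omega)
      rwa [hNe] at this
    obtain ⟨l, h1, h2, h3⟩ := exists_sum_eq (f := fun l => if l < N then g.inc N l else 0)
      (fun l => by
        split_ifs with h
        · have := odd_inc hL (by omega) h
          have := hLF l h
          omega
        · omega) (K := N) (r := D.sc i) (by
        rw [Finset.sum_congr rfl fun l hl => if_pos (Finset.mem_range.1 hl)]
        change D.sc i < g.rho N N
        omega)
    rw [if_pos h1] at h2
    rw [Finset.sum_congr rfl fun k hk => if_pos ((Finset.mem_range.1 hk).trans h1)] at h3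
    change g.rho N l = D.sc i at h3
    have h4 := odd_inc hL (by omega) h1
    have h5 := hLF l h1
    have h6 := reachable_of_one hL hS (by omega) (Or.inr (by omega)) hN hE (m := l + 1) (by omega)
    rw [Bits.rho_succ, h3, h2, ← Datum.stack_one hN, show N + 1 = 2 * D.n by omega] at h6
    have h7 := Datum.stack_source (D := D) (p := 2 * D.n) (e := 0) (r := D.sc i) le_rfl
      (by rw [D.pc_end]; omega)
    rw [Nat.zero_add] at h7
    rw [h7, Datum.stack, D.source_sc hi hs] at h6
    refine ⟨N - (l + 1), by omega, ?_, ?_⟩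
    · rw [← hL.DN_right _ (by omega), hNe, show N - (N - (l + 1)) = l + 1 by omega]
      omega
    · rw [hNe, show N - (N - (l + 1)) = l + 1 by omega]
      exact h6.symm

/-- The condition on the paths is equivalent to a local one. -/
theorem linked_iff_shape (hL : g.Local D.n D.s D.z) :
    g.Linked D.n D.s D.z D.Match ↔ Shape D g :=
  ⟨fun h => shape_of_linked hL h fun _ _ _ _ h => ⟨h.2.1, h.2.2.1⟩, linked_of_shape hL⟩

end Linked

/-! ### Histories as arrays -/

section Arrays

/-- `Z s J` and `B s J` are the indicators of "there is a particle at `J` at time `s`" and of "the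
particle at `J` jumps at time `s`" for a history of length `T` on the positions `1, …, l`. -/
structure IsArray (T l : ℕ) (Z B : ℕ → ℕ → ℕ) : Prop where
  Z_le : ∀ s J, Z s J ≤ 1
  B_le : ∀ s J, B s J ≤ Z s J
  Z_supp : ∀ s J, Z s J ≠ 0 → 1 ≤ J ∧ J ≤ l
  B_supp : ∀ s J, B s J ≠ 0 → s < T ∧ J ≤ s ∧ J < l
  step : ∀ s J, s < T → Z (s + 1) (J + 1) + B s (J + 1) = Z s (J + 1) + B s J

theorem IsArray.B_zero {T l : ℕ} {Z B : ℕ → ℕ → ℕ} (h : IsArray T l Z B) (s : ℕ) : B s 0 = 0 := by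
  by_contra h'
  have h1 := h.B_le s 0
  have h2 := h.Z_supp s 0 (by omega)
  omega

theorem IsArray.Z_eq_Z_zero {T l : ℕ} {Z B : ℕ → ℕ → ℕ} (h : IsArray T l Z B) {s J : ℕ}
    (hs : s ≤ T) (hJ : s < J) : Z s J = Z 0 J := by
  induction s with
  | zero => rfl
  | succ s ih =>
    obtain ⟨K, rfl⟩ : ∃ K, J = K + 1 := ⟨J - 1, by omega⟩
    have h1 := h.step s K (by omega)
    have h2 : B s (K + 1) = 0 := by
      by_contra h'
      have := h.B_supp s (K + 1) h'
      omega
    have h3 : B s K = 0 := by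
      by_contra h'
      have := h.B_supp s K h'
      omega
    have := ih (by omega) (by omega)
    omega

variable {a : ℕ} (i : Fin a → ℕ)

open Classical in
/-- The indicator of the occupied positions. -/
noncomputable def occupied (H : ℕ → Finset (Fin a)) (s J : ℕ) : ℕ :=
  if ∃ d, pos i H s d = J then 1 else 0

open Classical in
/-- The indicator of the positions from which a particle jumps. -/
noncomputable def jumping (H : ℕ → Finset (Fin a)) (s J : ℕ) : ℕ :=
  if ∃ d ∈ H s, pos i H s d = J then 1 else 0

variable {i}

theorem pos_le_pos (H : ℕ → Finset (Fin a)) {s r : ℕ} (h : s ≤ r) (d : Fin a) :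
    pos i H s d ≤ pos i H r d := by
  induction r, h using Nat.le_induction with
  | base => exact le_rfl
  | succ r hr ih => exact ih.trans (by simp only [pos]; omega)

theorem isArray_of_isHistory {T l : ℕ} {H : ℕ → Finset (Fin a)} (hH : IsHistory i T H)
    (hi : ∀ d, 1 ≤ i d) (hl : ∀ d, pos i H T d ≤ l) :
    IsArray T l (fun s => if s ≤ T then occupied i H s else 0) (jumping i H) := by
  classical
  have hHT : ∀ s, ∀ d ∈ H s, s < T := fun s d hd => by
    by_contra h
    rw [hH.eq_empty s (by omega)] at hd
    simp at hd
  refine ⟨fun s J => ?_, fun s J => ?_, fun s J h => ?_, fun s J h => ?_, fun s J hs => ?_⟩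
  · split_ifs
    · simp only [occupied]; split_ifs <;> omega
    · simp
  · by_cases hJ : ∃ d ∈ H s, pos i H s d = J
    · obtain ⟨d, hd, hJ'⟩ := hJ
      have := hHT s d hd
      rw [if_pos this.le, jumping, occupied, if_pos ⟨d, hd, hJ'⟩, if_pos ⟨d, hJ'⟩]
    · rw [jumping, if_neg hJ]; omega
  · split_ifs at h with h1
    · simp only [occupied, ne_eq, ite_eq_right_iff, one_ne_zero, imp_false, not_not] at h
      obtain ⟨d, rfl⟩ := h
      exact ⟨(hi d).trans (pos_le_pos H (Nat.zero_le s) d), (pos_le_pos H h1 d).trans (hl d)⟩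
    · simp at h
  · simp only [jumping, ne_eq, ite_eq_right_iff, one_ne_zero, imp_false, not_not] at h
    obtain ⟨d, hd, rfl⟩ := h
    have h1 := hHT s d hd
    refine ⟨h1, hH.le s h1 d hd, ?_⟩
    have h2 := (pos_le_pos H (show s + 1 ≤ T from h1) d).trans (hl d)
    simp only [pos, if_pos hd] at h2
    omega
  · rw [if_pos (show s + 1 ≤ T from hs), if_pos hs.le]
    have hinj := (hH.mono s hs.le).injective
    have hinj' := (hH.mono (s + 1) hs).injective
    -- a particle is at `J + 1` at time `s + 1` if it stayed there or if it jumped from `J`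
    have h1 : (∃ d, pos i H (s + 1) d = J + 1) ↔
        (∃ d, d ∉ H s ∧ pos i H s d = J + 1) ∨ ∃ d ∈ H s, pos i H s d = J := by
      constructor
      · rintro ⟨d, hd⟩
        simp only [pos] at hd
        by_cases h : d ∈ H s
        · rw [if_pos h] at hd; exact Or.inr ⟨d, h, by omega⟩
        · rw [if_neg h] at hd; exact Or.inl ⟨d, h, by omega⟩
      · rintro (⟨d, hd, h⟩ | ⟨d, hd, h⟩)
        · exact ⟨d, by simp only [pos, if_neg hd]; omega⟩
        · exact ⟨d, by simp only [pos, if_pos hd]; omega⟩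
    simp only [occupied, jumping]
    by_cases hB : ∃ d ∈ H s, pos i H s d = J
    · rw [if_pos (h1.2 (Or.inr hB)), if_pos hB]
      have h2 : ¬ ∃ d, d ∉ H s ∧ pos i H s d = J + 1 := by
        rintro ⟨d, hd, h⟩
        obtain ⟨e, he, h'⟩ := hB
        have : d = e := hinj' (by simp only [pos, if_neg hd, if_pos he]; omega)
        exact hd (this ▸ he)
      by_cases h3 : ∃ d ∈ H s, pos i H s d = J + 1
      · have h4 : ∃ d, pos i H s d = J + 1 := h3.imp fun _ h => h.2
        rw [if_pos h3, if_pos h4]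
      · rw [if_neg h3, if_neg]
        rintro ⟨d, hd⟩
        by_cases h4 : d ∈ H s
        · exact h3 ⟨d, h4, hd⟩
        · exact h2 ⟨d, h4, hd⟩
    · rw [if_neg hB]
      by_cases h3 : ∃ d ∈ H s, pos i H s d = J + 1
      · have h4 : ∃ d, pos i H s d = J + 1 := h3.imp fun _ h => h.2
        obtain ⟨d, hd, h⟩ := h3
        have h3 : ∃ d ∈ H s, pos i H s d = J + 1 := ⟨d, hd, h⟩
        rw [if_pos h3, if_pos h4, if_neg]
        rw [h1]
        rintro (⟨e, he, h'⟩ | h')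
        · exact he (hinj (h.trans h'.symm) ▸ hd)
        · exact hB h'
      · rw [if_neg h3]
        have : (∃ d, pos i H (s + 1) d = J + 1) ↔ ∃ d, pos i H s d = J + 1 := by
          rw [h1]
          constructor
          · rintro (⟨d, -, h⟩ | h)
            · exact ⟨d, h⟩
            · exact absurd h hB
          · rintro ⟨d, h⟩
            exact Or.inl ⟨d, fun h' => h3 ⟨d, h', h⟩, h⟩
        simp only [this]

/-- The particles move as prescribed by an array `B` of jumps. -/
noncomputable def follow (i : Fin a → ℕ) (B : ℕ → ℕ → ℕ) : ℕ → Fin a → ℕ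
  | 0 => i
  | s + 1 => fun d => follow i B s d + B s (follow i B s d)

theorem exists_history {T l : ℕ} {Z B : ℕ → ℕ → ℕ} (hA : IsArray T l Z B) (hi : StrictMono i)
    (h0 : ∀ J, Z 0 J = 1 ↔ ∃ d, i d = J) :
    ∃ H, IsHistory i T H ∧ (∀ s ≤ T, ∀ J, Z s J = 1 ↔ ∃ d, pos i H s d = J) ∧
      jumping i H = B := by
  classical
  let H : ℕ → Finset (Fin a) := fun s => Finset.univ.filter fun d => B s (follow i B s d) = 1
  have hB1 : ∀ s J, B s J ≤ 1 := fun s J => (hA.B_le s J).trans (hA.Z_le s J)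
  have hpos : ∀ s, pos i H s = follow i B s := by
    intro s
    induction s with
    | zero => rfl
    | succ s ih =>
      funext d
      simp only [pos, follow, ih, H, Finset.mem_filter, Finset.mem_univ, true_and]
      have := hB1 s (follow i B s d)
      split_ifs <;> omega
  have hmem : ∀ s d, d ∈ H s ↔ B s (pos i H s d) = 1 := fun s d => by
    rw [hpos]; simp [H]
  have main : ∀ s, s ≤ T → StrictMono (pos i H s) ∧ ∀ J, Z s J = 1 ↔ ∃ d, pos i H s d = J := by
    intro s
    induction s with
    | zero => intro _; exact ⟨hi, h0⟩
    | succ s ih =>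
      intro hs
      obtain ⟨hm, hz⟩ := ih (by omega)
      have hsucc : ∀ d, pos i H (s + 1) d = pos i H s d + B s (pos i H s d) := fun d => by
        rw [hpos, hpos]; rfl
      have hZ0 : ∀ s, Z s 0 = 0 := fun s => by
        by_contra h
        have := hA.Z_supp s 0 h
        omega
      have hpos1 : ∀ d, ∃ K, pos i H s d = K + 1 := fun d => by
        refine ⟨pos i H s d - 1, ?_⟩
        have h1 := (hz (pos i H s d)).2 ⟨d, rfl⟩
        have h2 := hA.Z_supp s _ (by rw [h1]; simp)
        omega
      refine ⟨fun d e hde => ?_, fun J => ?_⟩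
      · have h1 := hm hde
        rw [hsucc, hsucc]
        have h2 := hB1 s (pos i H s d)
        by_contra h3
        have h4 : pos i H s e = pos i H s d + 1 := by omega
        have h5 := hA.step s (pos i H s d) hs
        have h6 := (hz (pos i H s e)).2 ⟨e, rfl⟩
        have h7 := hA.Z_le (s + 1) (pos i H s d + 1)
        rw [h4] at h6 h3
        omega
      · rcases J with _ | J
        · constructor
          · intro h; have := hZ0 (s + 1); omega
          · rintro ⟨d, hd⟩
            obtain ⟨K, hK⟩ := hpos1 d
            rw [hsucc] at hd; omega
        have h5 := hA.step s J hs
        have h6 := hA.Z_le (s + 1) (J + 1)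
        have h7 := hA.B_le s (J + 1)
        have h8 := hA.Z_le s (J + 1)
        have h9 := hA.B_le s J
        constructor
        · intro h
          by_cases h10 : B s J = 1
          · have := hA.Z_le s J
            obtain ⟨d, rfl⟩ := (hz J).1 (by omega)
            exact ⟨d, by rw [hsucc, h10]⟩
          · have := hB1 s J
            obtain ⟨d, hd⟩ := (hz (J + 1)).1 (by omega)
            exact ⟨d, by rw [hsucc, hd, show B s (J + 1) = 0 by omega]⟩
        · rintro ⟨d, hd⟩
          rw [hsucc] at hd
          have h10 := hB1 s (pos i H s d)
          have h11 := (hz (pos i H s d)).2 ⟨d, rfl⟩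
          by_cases h12 : B s (pos i H s d) = 1
          · have : pos i H s d = J := by omega
            rw [this] at h12
            omega
          · have : pos i H s d = J + 1 := by omega
            rw [this] at h11 h12
            have := hA.Z_le s J
            omega
  refine ⟨H, ⟨fun r hr => ?_, fun r hr d hd => ?_, fun r hr => (main r hr).1⟩,
    fun s hs => (main s hs).2, ?_⟩
  · rw [Finset.eq_empty_iff_forall_notMem]
    intro d hd
    have h1 := (hmem r d).1 hd
    have h2 := hA.B_supp r _ (by rw [h1]; simp)
    omega
  · have h1 := (hmem r d).1 hd
    exact (hA.B_supp r _ (by rw [h1]; simp)).2.1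
  · funext s J
    have h1 := hB1 s J
    simp only [jumping]
    split_ifs with h
    · obtain ⟨d, hd, rfl⟩ := h
      exact ((hmem s d).1 hd).symm
    · by_contra h2
      have h3 := hA.B_supp s J (by omega)
      have h4 := hA.B_le s J
      have h5 := hA.Z_le s J
      obtain ⟨d, rfl⟩ := ((main s (by omega)).2 J).1 (by omega)
      exact h ⟨d, (hmem s d).2 (by omega), rfl⟩

/-- A history is determined by its array of jumps. -/
theorem history_ext {T : ℕ} {H H' : ℕ → Finset (Fin a)} (hH : IsHistory i T H)
    (hH' : IsHistory i T H') (h : jumping i H = jumping i H') : H = H' := by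
  classical
  have key : ∀ H : ℕ → Finset (Fin a), IsHistory i T H → ∀ s < T, ∀ d,
      d ∈ H s ↔ jumping i H s (pos i H s d) = 1 := by
    intro H hH s hs d
    simp only [jumping, ite_eq_left_iff, zero_ne_one, imp_false, not_not]
    constructor
    · intro hd; exact ⟨d, hd, rfl⟩
    · rintro ⟨e, he, hed⟩
      exact (hH.mono s hs.le).injective hed ▸ he
  have hall : ∀ s, s ≤ T → ∀ r < s, H r = H' r := by
    intro s
    induction s with
    | zero => intro _ r hr; omega
    | succ s ih =>
      intro hs r hr
      rcases (Nat.lt_succ_iff.1 hr).lt_or_eq with h1 | rfl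
      · exact ih (by omega) r h1
      · have hp : pos i H r = pos i H' r := pos_congr i (ih (by omega))
        ext d
        rw [key H hH r hs d, key H' hH' r hs d, hp, h]
  funext s
  rcases Nat.lt_or_ge s T with h1 | h1
  · exact hall T le_rfl s h1
  · rw [hH.eq_empty s h1, hH'.eq_empty s h1]

end Arrays

/-! ### The free edges of a configuration form an array -/

section ToArray

namespace Datum

variable (D : Datum)

/-- The points of the middle antidiagonals in the strip along the left boundary. -/
def Strip (p m : ℕ) : Prop := D.U ≤ p ∧ p < D.U + D.a + D.b ∧ p < m + D.u0

/-- The antidiagonals of `u` and `v` with letter `1`. -/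
def Down (p : ℕ) : Prop := D.one p ∧ (p < D.U ∨ D.U + D.a + D.b ≤ p)

variable {D}

theorem c_succ_of_down {p : ℕ} (hp : p < 2 * D.n) (h : D.Down p) : D.c (p + 1) = D.c p + 1 :=
  D.c_one p hp h.2 h.1

theorem c_succ_of_not_down {p : ℕ} (hp : p < 2 * D.n) (h : ¬ D.Down p) : D.c (p + 1) = D.c p := by
  by_cases h1 : p < D.U ∨ D.U + D.a + D.b ≤ p
  · exact D.c_not p hp h1 fun h2 => h ⟨h2, h1⟩
  · exact D.c_mid p (by omega) (by omega)

theorem c_right_le {p : ℕ} (hp : D.U + D.a + D.b ≤ p) (hp' : p ≤ 2 * D.n) :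
    D.c p + (D.U + D.a + D.b) ≤ D.u1 + p := by
  induction p, hp using Nat.le_induction with
  | base => rw [D.c_of_mid (by omega) le_rfl]
  | succ p hp ih =>
    have := ih (by omega)
    by_cases h : D.Down p
    · rw [c_succ_of_down (by omega) h]; omega
    · rw [c_succ_of_not_down (by omega) h]; omega

theorem center_le {s K : ℕ} (h1 : K + D.u0 ≤ s) (h2 : K < D.a + D.b) (h3 : s + D.u1 < 2 * D.n) :
    D.c (s + D.u1 + 1) + K + D.u0 ≤ s + D.u1 := by
  have := D.U_eq
  rcases Nat.lt_or_ge (s + D.u1) (D.U + D.a + D.b) with h | h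
  · rw [D.c_of_mid (by omega) (by omega)]; omega
  · have := c_right_le (D := D) (p := s + D.u1 + 1) (by omega) (by omega)
    omega

end Datum

open Classical in
/-- The indicator of a particle at `E p m`. -/
noncomputable def Bits.occ (g : Bits) (D : Datum) (p m : ℕ) : ℕ :=
  if D.Strip p m then g.DN p m + g.UA p (m + 1)
  else if D.Down p then 1 - g.DN p m else 1 - g.LF p m

open Classical in
/-- The particles of a configuration. The particle at `J` at time `s` is found on the `J`-th middle
antidiagonal as long as it is in the strip along the left boundary, and on the antidiagonal
`s + u1` later on. Before, it has its initial position. -/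
noncomputable def Bits.arrZ (g : Bits) (D : Datum) (s : ℕ) : ℕ → ℕ
  | 0 => 0
  | K + 1 =>
    if K < D.a + D.b ∧ s + D.u1 < 2 * D.n then
      if s < K then (if D.s (D.U + K) then 0 else 1)
      else if s < K + D.u0 then g.occ D (D.U + K) (D.U + 2 * K - s)
      else g.occ D (s + D.u1) (D.c (s + D.u1 + 1) + K)
    else 0

open Classical in
/-- The jumps of the particles of a configuration. -/
noncomputable def Bits.arrB (g : Bits) (D : Datum) (s : ℕ) : ℕ → ℕ
  | 0 => 0
  | K + 1 =>
    if K + 1 < D.a + D.b ∧ K < s ∧ s + D.u1 + 1 < 2 * D.n then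
      if s < K + D.u0 then g.UA (D.U + K) (D.U + 2 * K + 1 - s)
      else g.UA (s + D.u1) (D.c (s + D.u1 + 1) + K + 1)
    else 0

variable {D : Datum} {g : Bits}

/-- Below the height `c (p + 1)` of an antidiagonal, the points have an edge to the left and one
below, so that no path leaves to the right there. -/
theorem chain_edges (hL : g.Local D.n D.s D.z) (hS : Shape D g) {p m : ℕ} (hp : p < 2 * D.n)
    (hm : m < D.c (p + 1)) : g.LF p m = 1 ∧ g.DN p m = 1 := by
  induction p generalizing m with
  | zero =>
    by_cases h : D.Down 0
    · have := D.c_lt hp h.2 h.1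
      omega
    · rw [Datum.c_succ_of_not_down hp h, D.c_zero] at hm; omega
  | succ p ih =>
    have hcp := D.c_le hp.le
    -- the points below the threshold have two edges and receive none
    have h1 : ∀ m, m < D.c (p + 1) → g.LF (p + 1) m = 1 ∧ g.DN (p + 1) (m + 1) = 1 := by
      intro m hm
      have hcp' := D.c_le (p := p) (by omega)
      have key : ∀ m, m < D.c (p + 1) → m < p → g.RT p m = 0 ∧ g.UA p (m + 1) = 0 := by
        intro m hm hmp
        have h2 := ih (by omega) hm
        have := hL.even p m hmp (by omega)
        omega
      have hmp : m < p := by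
        by_cases h : D.Down p
        · have := D.c_lt (by omega) h.2 h.1
          have := Datum.c_succ_of_down (by omega) h
          rcases Nat.lt_or_ge m p with h2 | h2
          · exact h2
          · have h3 := (ih (by omega) hm).1
            have := hL.LF_supp _ _ (h3.trans_ne one_ne_zero)
            omega
        · have := Datum.c_succ_of_not_down (by omega) h
          omega
      have h2 := (key m hm hmp).1
      have h3 : g.UA p m = 0 := by
        rcases m with _ | l
        · exact hL.UA_zero p
        · exact (key l (by omega) (by omega)).2
      have h4 := hL.odd p m (by omega) hp
      have := hL.DN_le (p + 1) (m + 1)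
      have := hL.LF_le (p + 1) m
      omega
    refine ⟨?_, ?_⟩
    · rcases Nat.lt_or_ge m (D.c (p + 1)) with h2 | h2
      · exact (h1 m h2).1
      · by_cases h : D.Down (p + 1)
        · have := D.c_lt hp h.2 h.1
          have := Datum.c_succ_of_down hp h
          exact hS.LF_outer _ _ hp h.2 h.1 (by omega)
        · have := Datum.c_succ_of_not_down hp h
          omega
    · rcases m with _ | l
      · exact hL.DN_zero _ hp
      · refine (h1 l ?_).2
        by_cases h : D.Down (p + 1)
        · have := Datum.c_succ_of_down hp h
          omega
        · have := Datum.c_succ_of_not_down hp h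
          omega

theorem chain_out (hL : g.Local D.n D.s D.z) (hS : Shape D g) {p m : ℕ} (hp : p + 1 < 2 * D.n)
    (hm : m < D.c (p + 1)) : g.RT p m = 0 ∧ g.UA p (m + 1) = 0 := by
  have h1 := chain_edges hL hS (by omega) hm
  have h2 := hL.LF_supp p m (h1.1.trans_ne one_ne_zero)
  have := hL.even p m h2.1 hp
  omega

theorem chain_UA (hL : g.Local D.n D.s D.z) (hS : Shape D g) {p m : ℕ} (hp : p + 1 < 2 * D.n)
    (hm : m ≤ D.c (p + 1)) : g.UA p m = 0 := by
  rcases m with _ | l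
  · exact hL.UA_zero p
  · exact (chain_out hL hS hp hm).2

/-- If each point of the upper part of an antidiagonal sends out one path and each point of the next
antidiagonal receives at most one, then all of the paths leave to the right, as the uppermost one
does. -/
theorem top_down (hL : g.Local D.n D.s D.z) {p θ : ℕ} (hp : p + 1 < 2 * D.n)
    (hE : ∀ m, θ ≤ m → m < p → g.RT p m + g.UA p (m + 1) = 1)
    (hinc : ∀ m, θ ≤ m → m ≤ p → g.RT p m + g.UA p m ≤ 1) {m : ℕ} (hm : θ ≤ m) (hm' : m ≤ p) :
    g.RT p m = 1 ∧ g.UA p m = 0 := by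
  induction hm' using Nat.decreasingInduction with
  | self =>
    have := hinc p hm le_rfl
    have := hL.RT_left p hp
    omega
  | of_succ m hm' ih =>
    have h1 := ih (by omega)
    have h2 := hE m hm hm'
    have := hinc m hm hm'.le
    omega

theorem outer_out (hL : g.Local D.n D.s D.z) (hS : Shape D g) {p θ : ℕ} (hp : p + 1 < 2 * D.n)
    (hout : p < D.U ∨ D.U + D.a + D.b ≤ p) (hθ : ∀ m, D.c p + θ ≤ m → m < p → g.inc p m = 1)
    {m : ℕ} (hm : D.c (p + 1) + θ ≤ m) (hm' : m < p) : g.RT p m + g.UA p (m + 1) = 1 := by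
  have h1 := hL.even p m hm' hp
  by_cases h : D.one p
  · have h2 := D.c_one p (by omega) hout h
    obtain ⟨l, rfl⟩ : ∃ l, m = l + 1 := ⟨m - 1, by omega⟩
    have h3 := hθ l (by omega) (by omega)
    have h4 := odd_inc hL (p := p) (m := l) (by omega) (by omega)
    have h5 := hS.LF_outer p l (by omega) hout h (by omega)
    have h6 := hS.LF_outer p (l + 1) (by omega) hout h (by omega)
    omega
  · have h2 := D.c_not p (by omega) hout h
    have h3 := hθ m (by omega) (by omega)
    have h4 := odd_inc hL (p := p) (m := m) (by omega) (by omega)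
    have h5 := hS.DN_outer p m (by omega) hout h (by omega)
    have h6 := hS.DN_outer p (m + 1) (by omega) hout h (by omega)
    omega

theorem outer_in (hL : g.Local D.n D.s D.z) (hS : Shape D g) {p m : ℕ} (hp : p + 1 < 2 * D.n)
    (hout : p + 1 < D.U ∨ D.U + D.a + D.b ≤ p + 1) (hm : m ≤ p) : g.RT p m + g.UA p m ≤ 1 := by
  have h1 := hL.odd p m hm hp
  by_cases h : D.one (p + 1)
  · have := hS.LF_outer (p + 1) m hp hout h (by omega)
    omega
  · have := hS.DN_outer (p + 1) (m + 1) hp hout h (by omega)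
    omega

/-- There are no jumps on the antidiagonals of `u`. -/
theorem corner_UA (hL : g.Local D.n D.s D.z) (hS : Shape D g) {p : ℕ} (hp : p < D.U) (m : ℕ) :
    g.UA p m = 0 := by
  have h0 := D.P_lt
  by_cases hp' : p + 1 = D.U
  · exact hS.UA_U p m hp'
  have hfull : ∀ p, p + 1 < D.U → (∀ m, D.c p ≤ m → m < p → g.inc p m = 1) →
      ∀ m, D.c (p + 1) ≤ m → m ≤ p → g.RT p m = 1 ∧ g.UA p m = 0 := by
    intro p hp h m hm hm'
    exact top_down hL (by omega) (θ := D.c (p + 1))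
      (fun m h1 h2 => outer_out hL hS (θ := 0) (by omega) (Or.inl (by omega)) h h1 h2)
      (fun m _ h2 => outer_in hL hS (by omega) (Or.inl hp) h2) hm hm'
  have hinc : ∀ p, p < D.U → ∀ m, D.c p ≤ m → m < p → g.inc p m = 1 := by
    intro p
    induction p with
    | zero => intro _ m _ h; omega
    | succ p ih =>
      intro hp m h1 h2
      have := hfull p hp (ih (by omega)) m h1 (by omega)
      rw [Bits.inc_succ]; omega
  by_contra h
  have h1 := hL.UA_supp p m h
  rcases Nat.lt_or_ge m (D.c (p + 1)) with h2 | h2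
  · exact h (chain_UA hL hS (by omega) h2.le)
  · exact h (hfull p (by omega) (hinc p hp) m h2 (by omega)).2

/-- From the height `c (p + 1) + a + b` on, all paths leave to the right. -/
theorem right_out (hL : g.Local D.n D.s D.z) (hS : Shape D g) {p m : ℕ}
    (hp : D.U + D.a + D.b ≤ p + 1) (hp' : p + 1 < 2 * D.n) (hm : D.c (p + 1) + (D.a + D.b) ≤ m)
    (hm' : m ≤ p) : g.RT p m = 1 ∧ g.UA p m = 0 := by
  have h0 := D.P_lt
  have hU := D.U_pos
  have hUe := D.U_eq
  obtain ⟨q, hq⟩ : ∃ q, D.U + D.a + D.b = q + 1 := ⟨D.U + D.a + D.b - 1, by omega⟩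
  have hqp : q ≤ p := by omega
  induction p, hqp using Nat.le_induction generalizing m with
  | base =>
    rw [← hq, D.c_of_mid (by omega) le_rfl] at hm
    have h1 := RT_strip_pred hS (q := q) (m := m) (by omega) (by omega) hm' (by omega)
    have h2 := outer_in hL hS (p := q) (m := m) (by omega) (Or.inr (by omega)) hm'
    omega
  | succ p hqp ih =>
    refine top_down hL hp' (θ := D.c (p + 1 + 1) + (D.a + D.b)) (fun m h1 h2 => ?_)
      (fun m _ h2 => outer_in hL hS hp' (Or.inr (by omega)) h2) hm hm'
    refine outer_out hL hS hp' (Or.inr (by omega)) (fun m h3 h4 => ?_) h1 h2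
    have := ih (by omega) (by omega) (m := m) h3 (by omega)
    rw [Bits.inc_succ]; omega

theorem right_UA (hL : g.Local D.n D.s D.z) (hS : Shape D g) {p m : ℕ}
    (hp : D.U + D.a + D.b ≤ p + 1) (hm : D.c (p + 1) + (D.a + D.b) ≤ m) : g.UA p m = 0 := by
  by_contra h
  have h1 := hL.UA_supp p m h
  exact h (right_out hL hS hp (by omega) hm (by omega)).2

/-- Outside the strip, a particle leaves to the right or jumps. -/
theorem occ_out (hL : g.Local D.n D.s D.z) (hS : Shape D g) {p m : ℕ} (hp : p + 1 < 2 * D.n)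
    (hm : m ≤ p) (hs : ¬ D.Strip p m) : g.RT p m + g.UA p (m + 1) = g.occ D p m := by
  have hu0 := D.u0_pos
  rw [Bits.occ, if_neg hs]
  have hLF := hL.LF_le p m
  have hDN := hL.DN_le p m
  have hU : m = p → g.UA p (m + 1) = 0 := fun h => by
    by_contra h'
    have := hL.UA_supp p (m + 1) h'
    omega
  by_cases h : D.Down p
  · rw [if_pos h]
    rcases hm.lt_or_eq with h1 | h1
    · have := hL.even p m h1 hp
      have := hS.LF_outer p m (by omega) h.2 h.1 h1
      omega
    · have := hU h1
      subst h1
      have := hL.RT_left m hp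
      have := (hL.DN_left m (by omega)).2 ((D.s_iff m (by omega) h.2).2 h.1)
      omega
  · rw [if_neg h]
    rcases hm.lt_or_eq with h1 | h1
    · have h2 := hL.even p m h1 hp
      have h3 : g.DN p m = 1 := by
        by_cases h4 : p < D.U ∨ D.U + D.a + D.b ≤ p
        · exact hS.DN_outer p m (by omega) h4 (fun h5 => h ⟨h5, h4⟩) hm
        · refine hS.DN_center p m (by omega) (by omega) ?_
          simp only [Datum.Strip] at hs
          omega
      omega
    · have := hU h1
      subst h1
      have := hL.RT_left m hp
      have : g.LF m m = 0 := by
        by_contra h'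
        have := hL.LF_supp m m h'
        omega
      omega

/-- Outside the strip, the particles on an antidiagonal have come from the previous one. -/
theorem occ_in (hL : g.Local D.n D.s D.z) (hS : Shape D g) {p K : ℕ} (hp : p + 1 < 2 * D.n)
    (hm : D.c (p + 1) + K ≤ p) (hs : ¬ D.Strip (p + 1) (D.c (p + 1) + K + 1)) :
    g.occ D (p + 1) (D.c (p + 2) + K) = g.RT p (D.c (p + 1) + K) + g.UA p (D.c (p + 1) + K) := by
  have h1 := hL.odd p _ hm hp
  have h2 := hL.LF_le (p + 1) (D.c (p + 1) + K)
  have h3 := hL.DN_le (p + 1) (D.c (p + 1) + K + 1)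
  by_cases h : D.Down (p + 1)
  · rw [Datum.c_succ_of_down hp h, show D.c (p + 1) + 1 + K = D.c (p + 1) + K + 1 by omega, Bits.occ,
      if_neg hs, if_pos h]
    have := hS.LF_outer (p + 1) (D.c (p + 1) + K) hp h.2 h.1 (by omega)
    omega
  · have hs' : ¬ D.Strip (p + 1) (D.c (p + 1) + K) := by
      simp only [Datum.Strip] at hs ⊢
      omega
    rw [Datum.c_succ_of_not_down hp h, Bits.occ, if_neg hs', if_neg h]
    have h3 : g.DN (p + 1) (D.c (p + 1) + K + 1) = 1 := by
      by_cases h4 : p + 1 < D.U ∨ D.U + D.a + D.b ≤ p + 1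
      · exact hS.DN_outer _ _ (by omega) h4 (fun h5 => h ⟨h5, h4⟩) (by omega)
      · refine hS.DN_center _ _ (by omega) (by omega) ?_
        simp only [Datum.Strip] at hs
        omega
    omega

/-- In the strip, the particles move along the antidiagonals. -/
theorem occ_strip (hL : g.Local D.n D.s D.z) (hS : Shape D g) {p m : ℕ} (hm : m ≤ p)
    (hs : D.Strip (p + 1) (m + 1)) :
    g.occ D (p + 1) m + g.UA (p + 1) (m + 2) = g.occ D (p + 1) (m + 1) + g.UA p m := by
  have h0 := D.P_lt
  obtain ⟨h1, h2, h3⟩ := hs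
  have h4 := hL.odd p m hm (by omega)
  have h5 := RT_strip_pred hS (q := p) (m := m) h1 (by omega) hm (by omega)
  have h6 : g.occ D (p + 1) m = 1 - g.LF (p + 1) m := by
    have h7 : ¬ D.Down (p + 1) := fun h => by have := h.2; omega
    rw [Bits.occ, if_neg h7]
    split_ifs with h8
    · have h9 := hL.even (p + 1) m (by omega) (by omega)
      have := hS.RT_strip (p + 1) m h1 h2 (by omega) h8.2.2
      omega
    · rfl
  rw [h6, Bits.occ, if_pos ⟨h1, h2, h3⟩, show m + 1 + 1 = m + 2 from rfl]
  have := hL.LF_le (p + 1) m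
  omega

theorem occ_le (hL : g.Local D.n D.s D.z) (hS : Shape D g) (p m : ℕ) : g.occ D p m ≤ 1 := by
  have h0 := D.P_lt
  rw [Bits.occ]
  split_ifs with h
  · rcases Nat.lt_or_ge m p with h1 | h1
    · have := hL.even p m h1 (by have := h.2; omega)
      have := hS.RT_strip p m h.1 h.2.1 h1.le h.2.2
      omega
    · have : g.UA p (m + 1) = 0 := by
        by_contra h'
        have := hL.UA_supp p (m + 1) h'
        omega
      have := hL.DN_le p m
      omega
  · omega
  · omega

theorem occ_diag (hL : g.Local D.n D.s D.z) {p : ℕ} (h1 : D.U ≤ p) (h2 : p < D.U + D.a + D.b) :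
    (g.occ D p p = 0 ↔ D.s p) := by
  have h0 := D.P_lt
  have hu0 := D.u0_pos
  rw [Bits.occ, if_pos ⟨h1, h2, by omega⟩, ← hL.DN_left p (by omega)]
  have : g.UA p (p + 1) = 0 := by
    by_contra h'
    have := hL.UA_supp p (p + 1) h'
    omega
  omega

open Classical in
/-- The free edges of a configuration form an array. -/
theorem isArray_of_shape (hL : g.Local D.n D.s D.z) (hS : Shape D g) :
    IsArray (2 * D.n - 1 - D.u1) (D.a + D.b) (g.arrZ D) (g.arrB D) := by
  have h0 := D.P_lt
  have hU := D.U_pos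
  have hUe := D.U_eq
  have hu0 := D.u0_pos
  refine ⟨fun s J => ?_, fun s J => ?_, fun s J h => ?_, fun s J h => ?_, fun s K hs => ?_⟩
  · rcases J with _ | K
    · simp [Bits.arrZ]
    · simp only [Bits.arrZ]
      split_ifs
      · omega
      · omega
      · exact occ_le hL hS _ _
      · exact occ_le hL hS _ _
      · omega
  · rcases J with _ | K
    · simp [Bits.arrB]
    · simp only [Bits.arrB, Bits.arrZ]
      by_cases h1 : K + 1 < D.a + D.b ∧ K < s ∧ s + D.u1 + 1 < 2 * D.n
      · rw [if_pos h1, if_pos (show K < D.a + D.b ∧ s + D.u1 < 2 * D.n by omega),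
          if_neg (show ¬ s < K by omega)]
        split_ifs with h2
        · rw [Bits.occ, if_pos ⟨by omega, by omega, by omega⟩,
            show D.U + 2 * K - s + 1 = D.U + 2 * K + 1 - s by omega]
          omega
        · have h3 := Datum.center_le (D := D) (s := s) (K := K) (by omega) (by omega) (by omega)
          have := occ_out hL hS (p := s + D.u1) (m := D.c (s + D.u1 + 1) + K) (by omega) (by omega)
            (by simp only [Datum.Strip]; omega)
          omega
      · rw [if_neg h1]; omega
  · rcases J with _ | K
    · simp [Bits.arrZ] at h
    · simp only [Bits.arrZ] at h
      split_ifs at h with h1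
      all_goals omega
  · rcases J with _ | K
    · simp [Bits.arrB] at h
    · simp only [Bits.arrB] at h
      split_ifs at h with h1
      all_goals omega
  · by_cases hK : K < D.a + D.b
    swap
    · have h1 : g.arrB D s K = 0 := by
        rcases K with _ | K
        · rfl
        · simp only [Bits.arrB]; rw [if_neg (by omega)]
      rw [h1]
      simp only [Bits.arrB, Bits.arrZ]
      rw [if_neg (by omega), if_neg (by omega), if_neg (by omega)]
    have hZ : g.arrZ D s (K + 1) = if s < K then (if D.s (D.U + K) then 0 else 1)
      else if s < K + D.u0 then g.occ D (D.U + K) (D.U + 2 * K - s)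
      else g.occ D (s + D.u1) (D.c (s + D.u1 + 1) + K) := by
      simp only [Bits.arrZ]; rw [if_pos (by omega)]
    have hZ' : g.arrZ D (s + 1) (K + 1) = if s + 1 < K then (if D.s (D.U + K) then 0 else 1)
      else if s + 1 < K + D.u0 then g.occ D (D.U + K) (D.U + 2 * K - (s + 1))
      else g.occ D (s + 1 + D.u1) (D.c (s + 1 + D.u1 + 1) + K) := by
      simp only [Bits.arrZ]; rw [if_pos (by omega)]
    have hB0 : ∀ J, s < J → g.arrB D s J = 0 := by
      intro J hJ
      rcases J with _ | K
      · rfl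
      · simp only [Bits.arrB]; rw [if_neg (by omega)]
    rw [hZ, hZ']
    rcases Nat.lt_or_ge s K with h1 | h1
    · rw [hB0 _ (by omega), hB0 _ h1, if_pos h1]
      rcases Nat.lt_or_ge (s + 1) K with h2 | h2
      · rw [if_pos h2]
      · obtain rfl : K = s + 1 := by omega
        rw [if_neg (lt_irrefl _), if_pos (by omega),
          show D.U + 2 * (s + 1) - (s + 1) = D.U + (s + 1) by omega]
        have h3 := occ_diag hL (p := D.U + (s + 1)) (by omega) (by omega)
        have h4 := occ_le hL hS (D.U + (s + 1)) (D.U + (s + 1))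
        split_ifs with h5
        · have := h3.2 h5; omega
        · have := h3.not.2 h5; omega
    rw [if_neg (show ¬ s < K by omega), if_neg (show ¬ s + 1 < K by omega)]
    rcases Nat.lt_or_ge s (K + D.u0) with h2 | h2
    · -- the particle is in the strip at time `s`
      obtain ⟨p, hp⟩ : ∃ p, D.U + K = p + 1 := ⟨D.U + K - 1, by omega⟩
      obtain ⟨m, hm⟩ : ∃ m, D.U + 2 * K - s = m + 1 := ⟨D.U + 2 * K - s - 1, by omega⟩
      have h3 := occ_strip hL hS (p := p) (m := m) (by omega) ⟨by omega, by omega, by omega⟩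
      have h4 : (if s + 1 < K + D.u0 then g.occ D (D.U + K) (D.U + 2 * K - (s + 1))
          else g.occ D (s + 1 + D.u1) (D.c (s + 1 + D.u1 + 1) + K)) = g.occ D (p + 1) m := by
        split_ifs with h5
        · congr 1; omega
        · rw [show s + 1 + D.u1 = p + 1 by omega, D.c_of_mid (by omega) (by omega)]
          congr 1; omega
      have h5 : g.arrB D s (K + 1) = g.UA (p + 1) (m + 2) := by
        simp only [Bits.arrB]
        split_ifs with h6
        · rw [hp]; congr 1; omega
        · by_contra h7
          have h8 := hL.UA_supp (p + 1) (m + 2) (by omega)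
          have h9 := UA_last hL hS (q := p + 1) (m := m + 2) (by omega) (by omega) (by omega)
          omega
      have h6 : g.arrB D s K = g.UA p m := by
        rcases K with _ | K
        · rw [hS.UA_U p m (by omega)]; rfl
        · simp only [Bits.arrB]
          rw [if_pos (by omega)]
          split_ifs with h7
          · rw [show D.U + K = p by omega]
            congr 1; omega
          · rw [show s + D.u1 = p by omega, D.c_of_mid (by omega) (by omega)]
            congr 1; omega
      rw [h4, h5, h6, if_pos h2, hp, hm]
      exact h3
    · obtain ⟨p, hp⟩ : ∃ p, s + D.u1 = p := ⟨_, rfl⟩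
      have h3 := Datum.center_le (D := D) (s := s) (K := K) h2 hK (by omega)
      rw [hp] at h3
      have h4 := occ_out hL hS (p := p) (m := D.c (p + 1) + K) (by omega) (by omega)
        (by simp only [Datum.Strip]; omega)
      have h5 := occ_in hL hS (p := p) (K := K) (by omega) (by omega)
        (by simp only [Datum.Strip]; omega)
      have h6 : g.arrB D s (K + 1) = g.UA p (D.c (p + 1) + K + 1) := by
        simp only [Bits.arrB]
        by_cases h7 : K + 1 < D.a + D.b
        · rw [if_pos (by omega), if_neg (by omega), hp]
        · rw [if_neg (by omega), right_UA hL hS (by omega) (by omega)]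
      have h7 : g.arrB D s K = g.UA p (D.c (p + 1) + K) := by
        rcases K with _ | K
        · rw [chain_UA hL hS (by omega) (by omega)]; rfl
        · simp only [Bits.arrB]
          rw [if_pos (by omega), if_neg (by omega), hp]
          rfl
      rw [if_neg (show ¬ s < K + D.u0 by omega), if_neg (show ¬ s + 1 < K + D.u0 by omega), h6, h7, hp,
        show s + 1 + D.u1 = p + 1 by omega, h5, ← h4]
      omega

/-- The particles start at the letters `0` of the middle part of `σ`. -/
theorem arrZ_zero (hL : g.Local D.n D.s D.z) (hS : Shape D g) {K : ℕ} (hK : K < D.a + D.b) :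
    g.arrZ D 0 (K + 1) = 1 ↔ ¬ D.s (D.U + K) := by
  have h0 := D.P_lt
  have hUe := D.U_eq
  have hu0 := D.u0_pos
  simp only [Bits.arrZ]
  rw [if_pos (by omega)]
  rcases Nat.eq_zero_or_pos K with rfl | h
  · rw [if_neg (by omega), if_pos (by omega), ← occ_diag hL (p := D.U + 0) (by omega) (by omega)]
    have := occ_le hL hS (D.U + 0) (D.U + 0)
    simp only [Nat.mul_zero, Nat.sub_zero, Nat.add_zero] at *
    omega
  · rw [if_pos h]
    split_ifs <;> simp_all

/-- The particles end at the letters `0` of the middle part of `τ`, in reverse order. -/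
theorem arrZ_last (hL : g.Local D.n D.s D.z) {K : ℕ} (hK : K < D.a + D.b) :
    g.arrZ D (2 * D.n - 1 - D.u1) (K + 1) = 1 ↔ D.z (D.n + D.b - (K + 1)) := by
  have h0 := D.P_lt
  have hUe := D.U_eq
  have hu0 := D.u0_pos
  have hc := D.c_end
  simp only [Bits.arrZ]
  have h1 := Datum.center_le (D := D) (s := 2 * D.n - 1 - D.u1) (K := K) (by omega) hK (by omega)
  rw [if_pos (by omega), if_neg (by omega), if_neg (by omega)]
  rw [show 2 * D.n - 1 - D.u1 + D.u1 = 2 * D.n - 1 by omega,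
    show 2 * D.n - 1 + 1 = 2 * D.n by omega] at *
  have h2 : D.Down (2 * D.n - 1) := ⟨D.one_last, Or.inr (by omega)⟩
  rw [Bits.occ, if_neg (by simp only [Datum.Strip]; omega), if_pos h2,
    ← hL.DN_right _ (by omega),
    show 2 * D.n - 1 - (D.n + D.b - (K + 1)) = D.c (2 * D.n) + K by omega]
  omega

end ToArray

/-! ### The configuration of an array -/

section OfArray

namespace Datum

variable (D : Datum)

open Classical in
/-- The indicator of a particle at `E p m`, in terms of the particles `Z` of an array. Below the
middle part there are no particles, and above it and on the first antidiagonals all points are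
occupied. -/
noncomputable def occOf (Z : ℕ → ℕ → ℕ) (p m : ℕ) : ℕ :=
  if m < D.c (p + 1) then 0 else if p < D.U then 1
  else if D.Strip p m then Z (2 * p - m - D.U) (p + 1 - D.U)
  else if m < D.c (p + 1) + (D.a + D.b) then Z (p - D.u1) (m - D.c (p + 1) + 1) else 1

open Classical in
/-- The indicator of a jump upwards from `E p m`, in terms of the jumps `B` of an array. -/
noncomputable def jumpOf (B : ℕ → ℕ → ℕ) (p m : ℕ) : ℕ :=
  if m < D.c (p + 1) ∨ p < D.U then 0
  else if D.Strip p m then B (2 * p - m - D.U) (p + 1 - D.U)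
  else B (p - D.u1) (m - D.c (p + 1) + 1)

open Classical in
/-- The configuration with the particles `Z` and the jumps `B`. -/
noncomputable def build (Z B : ℕ → ℕ → ℕ) : Bits where
  LF p m := if m < p ∧ p < 2 * D.n then (if D.Down p then 1 else 1 - D.occOf Z p m) else 0
  DN p m := if m ≤ p ∧ p < 2 * D.n then (if D.Down p then 1 - D.occOf Z p m else
    if D.Strip p m then D.occOf Z p m - D.jumpOf B p m else 1) else 0
  RT p m := if m ≤ p ∧ p + 1 < 2 * D.n then
    (if D.Strip p m then 1 else D.occOf Z p m - D.jumpOf B p m) else 0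
  UA p m := if 1 ≤ m ∧ m ≤ p ∧ p + 1 < 2 * D.n then D.jumpOf B p (m - 1) else 0

variable {D} {Z B : ℕ → ℕ → ℕ} {p m K : ℕ}

theorem Strip.not_down (h : D.Strip p m) : ¬ D.Down p := fun h' => by
  have := h.1
  have := h.2.1
  have := h'.2
  omega

theorem Strip.c_eq (h : D.Strip p m) : D.c (p + 1) = D.u1 :=
  D.c_of_mid (by have := h.1; omega) (by have := h.2.1; omega)

theorem Strip.le (h : D.Strip p m) : D.u1 < m + 1 := by
  have := h.1
  have := h.2.2
  have := D.U_eq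
  omega

theorem occOf_below (h : m < D.c (p + 1)) : D.occOf Z p m = 0 := if_pos h

theorem jumpOf_below (h : m < D.c (p + 1)) : D.jumpOf B p m = 0 := if_pos (Or.inl h)

theorem occOf_corner (h : D.c (p + 1) ≤ m) (hp : p < D.U) : D.occOf Z p m = 1 := by
  rw [occOf, if_neg (by omega), if_pos hp]

theorem jumpOf_corner (hp : p < D.U) : D.jumpOf B p m = 0 := if_pos (Or.inr hp)

theorem occOf_strip (h : D.Strip p m) :
    D.occOf Z p m = Z (2 * p - m - D.U) (p + 1 - D.U) := by
  have h1 := h.c_eq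
  have h2 := h.le
  have h3 := h.1
  rw [occOf, if_neg (by omega), if_neg (by omega), if_pos h]

theorem jumpOf_strip (h : D.Strip p m) :
    D.jumpOf B p m = B (2 * p - m - D.U) (p + 1 - D.U) := by
  have h1 := h.c_eq
  have h2 := h.le
  have h3 := h.1
  rw [jumpOf, if_neg (by omega), if_pos h]

theorem occOf_mid (hp : D.U ≤ p) (h : ¬ D.Strip p (D.c (p + 1) + K)) (hK : K < D.a + D.b) :
    D.occOf Z p (D.c (p + 1) + K) = Z (p - D.u1) (K + 1) := by
  rw [occOf, if_neg (by omega), if_neg (by omega), if_neg h, if_pos (by omega),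
    Nat.add_sub_cancel_left]

theorem jumpOf_mid (hp : D.U ≤ p) (h : ¬ D.Strip p (D.c (p + 1) + K)) :
    D.jumpOf B p (D.c (p + 1) + K) = B (p - D.u1) (K + 1) := by
  rw [jumpOf, if_neg (by omega), if_neg h, Nat.add_sub_cancel_left]

theorem occOf_above (h : ¬ D.Strip p m) (hm : D.c (p + 1) + (D.a + D.b) ≤ m) :
    D.occOf Z p m = 1 := by
  rw [occOf, if_neg (by omega)]
  split_ifs
  · rfl
  · omega
  · rfl

end Datum

open Datum

variable {D : Datum} {Z B : ℕ → ℕ → ℕ}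

theorem occOf_le {l T : ℕ} (hA : IsArray T l Z B) (p m : ℕ) : D.occOf Z p m ≤ 1 := by
  unfold occOf
  split_ifs
  · omega
  · omega
  · exact hA.Z_le _ _
  · exact hA.Z_le _ _
  · omega

theorem IsArray.B_eq_zero {l T : ℕ} (hA : IsArray T l Z B) {s J : ℕ} (h : s < J ∨ l ≤ J) :
    B s J = 0 := by
  by_contra h'
  have := hA.B_supp s J h'
  omega

theorem jumpOf_le {T : ℕ} (hA : IsArray T (D.a + D.b) Z B) (p m : ℕ) :
    D.jumpOf B p m ≤ D.occOf Z p m := by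
  rcases Nat.lt_or_ge m (D.c (p + 1)) with h1 | h1
  · rw [jumpOf_below h1]; omega
  rcases Nat.lt_or_ge p D.U with h2 | h2
  · rw [jumpOf_corner h2]; omega
  by_cases h3 : D.Strip p m
  · rw [jumpOf_strip h3, occOf_strip h3]
    exact hA.B_le _ _
  · obtain ⟨K, rfl⟩ : ∃ K, m = D.c (p + 1) + K := ⟨m - D.c (p + 1), by omega⟩
    rw [jumpOf_mid h2 h3]
    rcases Nat.lt_or_ge K (D.a + D.b) with h4 | h4
    · rw [occOf_mid h2 h3 h4]
      exact hA.B_le _ _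
    · rw [hA.B_eq_zero (Or.inr (by omega))]; omega

theorem Datum.c_succ_right_le {p : ℕ} (hp : D.U + D.a + D.b ≤ p) (hp' : p < 2 * D.n) :
    D.c (p + 1) + (D.a + D.b) ≤ p := by
  have h0 := D.u0_pos
  have h4 := c_right_le hp hp'.le
  have h5 := D.U_eq
  by_cases h6 : D.Down p
  · rw [c_succ_of_down hp' h6]; omega
  · rw [c_succ_of_not_down hp' h6]; omega

theorem occOf_diag {p : ℕ} (hp : p < 2 * D.n) (h : ¬ D.Strip p p) : D.occOf Z p p = 1 := by
  have h0 := D.u0_pos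
  rcases Nat.lt_or_ge p D.U with h2 | h2
  · have := D.dyck_left (p + 1) (by omega)
    exact occOf_corner (by omega) h2
  · exact occOf_above h (c_succ_right_le (by simp only [Strip] at h; omega) hp)

theorem jumpOf_above {T p m : ℕ} (hA : IsArray T (D.a + D.b) Z B) (h : ¬ D.Strip p m)
    (hm : D.c (p + 1) + (D.a + D.b) ≤ m + 1) : D.jumpOf B p m = 0 := by
  unfold jumpOf
  rw [if_neg h]
  split_ifs
  · rfl
  · exact hA.B_eq_zero (Or.inr (by omega))

theorem jumpOf_diag {T p : ℕ} (hA : IsArray T (D.a + D.b) Z B) (hp : p < 2 * D.n)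
    (h : ¬ D.Strip p p) : D.jumpOf B p p = 0 := by
  have h0 := D.u0_pos
  rcases Nat.lt_or_ge p D.U with h2 | h2
  · exact jumpOf_corner h2
  · have := c_succ_right_le (D := D) (p := p) (by simp only [Strip] at h; omega) hp
    exact jumpOf_above hA h (by omega)

variable {T : ℕ}

/-- The jumps from the point below. -/
theorem jumpOf_pred (hA : IsArray T (D.a + D.b) Z B) {p K : ℕ} (hp : D.U ≤ p)
    (hs : ¬ D.Strip p (D.c (p + 1) + K)) :
    (D.build Z B).UA p (D.c (p + 1) + K) =
      if D.c (p + 1) + K ≤ p ∧ p + 1 < 2 * D.n then B (p - D.u1) K else 0 := by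
  simp only [build]
  rcases K with _ | K
  · rw [hA.B_zero]
    split_ifs <;> first | rfl | exact jumpOf_below (by omega)
  · have h1 : ¬ D.Strip p (D.c (p + 1) + K) := by
      simp only [Strip] at hs ⊢
      omega
    rw [← Nat.add_assoc, Nat.add_sub_cancel, jumpOf_mid hp h1]
    simp only [show 1 ≤ D.c (p + 1) + K + 1 by omega, true_and]

/-- Below the height `c (p + 1)`, nothing crosses to the next antidiagonal. -/
theorem build_out_below {p m : ℕ} (h : m < D.c (p + 1)) :
    (D.build Z B).RT p m = 0 ∧ (D.build Z B).UA p m = 0 := by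
  have hs : ¬ D.Strip p m := fun hs => by
    have := hs.le
    rw [hs.c_eq] at h
    omega
  constructor
  · simp only [build]
    rw [if_neg hs, occOf_below h]
    split_ifs <;> omega
  · simp only [build]
    rw [jumpOf_below (by omega)]
    split_ifs <;> rfl

/-- On the antidiagonals of `u`, all paths above this height leave to the right. -/
theorem build_out_corner {p m : ℕ} (h : D.c (p + 1) ≤ m) (hm : m ≤ p) (hp : p < D.U) :
    (D.build Z B).RT p m = 1 ∧ (D.build Z B).UA p m = 0 := by
  have h0 := D.P_lt
  have hs : ¬ D.Strip p m := fun hs => by have := hs.1; omega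
  constructor
  · simp only [build]
    rw [if_pos (by omega), if_neg hs, occOf_corner h hp, jumpOf_corner hp]
  · simp only [build]
    rw [jumpOf_corner hp]
    split_ifs <;> rfl

/-- Above the `a + b` positions of the array, all paths leave to the right. -/
theorem build_out_above (hA : IsArray T (D.a + D.b) Z B) {p m : ℕ} (hp : D.U + D.a + D.b ≤ p + 1)
    (hp' : p + 1 < 2 * D.n) (hm : D.c (p + 1) + (D.a + D.b) ≤ m) (hm' : m ≤ p) :
    (D.build Z B).RT p m = 1 ∧ (D.build Z B).UA p m = 0 := by
  rcases Nat.lt_or_ge p D.U with h1 | h1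
  · exact build_out_corner (by omega) hm' h1
  constructor
  · simp only [build]
    rw [if_pos (by omega)]
    split_ifs with h2
    · rfl
    · rw [occOf_above h2 hm, jumpOf_above hA h2 (by omega)]
  · simp only [build]
    split_ifs with h2
    · by_cases h3 : D.Strip p (m - 1)
      · rw [jumpOf_strip h3]
        exact hA.B_eq_zero (Or.inr (by omega))
      · exact jumpOf_above hA h3 (by omega)
    · rfl

/-- Outside the strip, the particles of an array move from one antidiagonal to the next one. -/
theorem occOf_succ (hT : T + D.u1 + 1 = 2 * D.n) (hA : IsArray T (D.a + D.b) Z B) {p K : ℕ}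
    (hp : p + 1 < 2 * D.n) (hm : D.c (p + 1) + K ≤ p) (hs : ¬ D.Strip (p + 1) (D.c (p + 1) + K + 1)) :
    D.occOf Z (p + 1) (D.c (p + 2) + K) =
      (D.build Z B).RT p (D.c (p + 1) + K) + (D.build Z B).UA p (D.c (p + 1) + K) := by
  have hUe := D.U_eq
  have hs' : ¬ D.Strip (p + 1) (D.c (p + 2) + K) := by
    by_cases h : D.Down (p + 1)
    · exact fun h' => h'.not_down h
    · rw [c_succ_of_not_down hp h]
      simp only [Strip] at hs ⊢
      omega
  rcases Nat.lt_or_ge (p + 1) D.U with h1 | h1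
  · rw [occOf_corner (Nat.le_add_right _ _) h1]
    have := build_out_corner (D := D) (Z := Z) (B := B) (p := p) (m := D.c (p + 1) + K) (by omega) hm
      (by omega)
    omega
  -- above the array, all points are occupied
  by_cases h2 : D.U + D.a + D.b ≤ p + 1 ∧ D.a + D.b ≤ K
  · rw [occOf_above hs' (by rw [show p + 1 + 1 = p + 2 from rfl]; omega)]
    have := build_out_above hA h2.1 hp (m := D.c (p + 1) + K) (by omega) hm
    omega
  -- otherwise, both points carry entries of the array at consecutive times
  have h3 : D.U ≤ p ∧ K < D.a + D.b ∧ ¬ D.Strip p (D.c (p + 1) + K) := by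
    rcases Nat.lt_or_ge (p + 1) (D.U + D.a + D.b) with h4 | h4
    · have h5 : D.c (p + 1) = D.u1 := D.c_of_mid (by omega) (by omega)
      simp only [Strip] at hs ⊢
      omega
    · have h5 : D.c (p + 1) + (D.a + D.b) + D.u0 ≤ p + 1 := by
        have := c_right_le h4 hp.le
        omega
      simp only [Strip]
      omega
  rw [occOf_mid h1 hs' h3.2.1, jumpOf_pred hA h3.1 h3.2.2, if_pos ⟨hm, hp⟩]
  simp only [build]
  rw [if_pos ⟨hm, hp⟩, if_neg h3.2.2, occOf_mid h3.1 h3.2.2 h3.2.1, jumpOf_mid h3.1 h3.2.2]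
  have h6 := hA.step (p - D.u1) K (by omega)
  have h7 := hA.B_le (p - D.u1) (K + 1)
  rw [show p + 1 - D.u1 = p - D.u1 + 1 by omega]
  omega

/-- In the strip, the particles of an array move along the antidiagonals. -/
theorem occOf_step (hT : T + D.u1 + 1 = 2 * D.n) (hA : IsArray T (D.a + D.b) Z B) {p m : ℕ}
    (hm : m ≤ p) (hs : D.Strip (p + 1) (m + 1)) :
    D.occOf Z (p + 1) m + D.jumpOf B (p + 1) (m + 1) =
      D.occOf Z (p + 1) (m + 1) + (D.build Z B).UA p m := by
  have hUe := D.U_eq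
  have h0 := D.P_lt
  obtain ⟨h1, h2, h3⟩ := id hs
  obtain ⟨K, hK⟩ : ∃ K, p + 1 = D.U + K := ⟨p + 1 - D.U, by omega⟩
  obtain ⟨s, hs'⟩ : ∃ s, 2 * (p + 1) - (m + 1) - D.U = s := ⟨_, rfl⟩
  have hJ : p + 1 + 1 - D.U = K + 1 := by omega
  rw [jumpOf_strip hs, occOf_strip hs, hs', hJ]
  have h4 : D.occOf Z (p + 1) m = Z (s + 1) (K + 1) := by
    by_cases h5 : D.Strip (p + 1) m
    · rw [occOf_strip h5, hJ]
      congr 1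
      omega
    · obtain rfl : m = D.c (p + 1 + 1) + K := by
        rw [hs.c_eq]
        simp only [Strip] at h5
        omega
      rw [occOf_mid h1 h5 (by omega)]
      congr 1
      rw [hs.c_eq] at hs'
      omega
  have h5 : (D.build Z B).UA p m = B s K := by
    rcases K with _ | K
    · rw [hA.B_zero]
      simp only [build]
      rw [jumpOf_corner (by omega)]
      split_ifs <;> rfl
    · simp only [build]
      rw [if_pos (by omega)]
      by_cases h6 : D.Strip p (m - 1)
      · rw [jumpOf_strip h6]
        congr 1 <;> omega
      · have h7 : D.c (p + 1) = D.u1 := D.c_of_mid (by omega) (by omega)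
        have h8 : m - 1 = D.c (p + 1) + K := by
          rw [h7]
          simp only [Strip] at h6
          omega
        rw [h8] at h6 ⊢
        rw [jumpOf_mid (by omega) h6]
        congr 1
        omega
  rw [h4, h5]
  exact hA.step s K (by omega)

theorem build_supp (hA : IsArray T (D.a + D.b) Z B) : (D.build Z B).Supp D.n := by
  have h1 := occOf_le (D := D) hA
  have h2 := jumpOf_le (D := D) hA
  refine ⟨fun p m => ?_, fun p m => ?_, fun p m => ?_, fun p m => ?_, fun p m h => ?_,
    fun p m h => ?_, fun p m h => ?_, fun p m h => ?_⟩
  · simp only [build]; split_ifs <;> omega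
  · have := h1 p m
    simp only [build]; split_ifs <;> omega
  · have := h1 p m
    simp only [build]; split_ifs <;> omega
  · have := h1 p (m - 1)
    have := h2 p (m - 1)
    simp only [build]; split_ifs <;> omega
  all_goals
    simp only [build] at h
    split_ifs at h with h3 <;> omega

theorem build_shape : Shape D (D.build Z B) := by
  have h0 := D.P_lt
  have hUe := D.U_eq
  refine ⟨fun p m hp ho h hm => ?_, fun p m hp ho h hm => ?_, fun p m h1 h2 hm => ?_,
    fun p m h1 h2 h3 h4 => ?_, fun p m hp hm h => ?_, fun p m hp hm => ?_, fun p m hp => ?_⟩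
  · simp only [build]
    rw [if_pos (by omega), if_neg fun h' => h h'.1, if_neg fun h' => ?_]
    have := h'.1
    have := h'.2
    omega
  · simp only [build]
    rw [if_pos (by omega), if_pos ⟨h, ho⟩]
  · simp only [build]
    rw [if_pos (by omega), if_neg fun h' => ?_, if_neg fun h' => ?_]
    · have := h'.2.2
      omega
    · have := h'.2
      omega
  · simp only [build]
    rw [if_pos (by omega), if_pos ⟨h1, h2, h4⟩]
  · have := D.c_U
    exact (build_out_corner (by rw [hp]; omega) hm (by omega)).1
  · have := D.c_U
    exact (build_out_below (by rw [hp]; omega)).1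
  · simp only [build]
    rw [jumpOf_corner (by omega)]
    split_ifs <;> rfl

theorem build_even (hA : IsArray T (D.a + D.b) Z B) {p m : ℕ} (hm : m < p) (hp : p + 1 < 2 * D.n) :
    (D.build Z B).LF p m + (D.build Z B).DN p m + (D.build Z B).RT p m +
      (D.build Z B).UA p (m + 1) = 2 := by
  have h1 := occOf_le (D := D) hA p m
  have h2 := jumpOf_le (D := D) hA p m
  simp only [build]
  rw [if_pos (show m < p ∧ p < 2 * D.n by omega), if_pos (show m ≤ p ∧ p < 2 * D.n by omega),
    if_pos (show m ≤ p ∧ p + 1 < 2 * D.n by omega),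
    if_pos (show 1 ≤ m + 1 ∧ m + 1 ≤ p ∧ p + 1 < 2 * D.n by omega), Nat.add_sub_cancel]
  by_cases h3 : D.Down p
  · rw [if_pos h3, if_pos h3, if_neg fun h => h.not_down h3]
    omega
  · rw [if_neg h3, if_neg h3]
    split_ifs <;> omega

open Classical in
theorem build_odd (hT : T + D.u1 + 1 = 2 * D.n) (hA : IsArray T (D.a + D.b) Z B) {p m : ℕ}
    (hm : m ≤ p) (hp : p + 1 < 2 * D.n) :
    (D.build Z B).DN (p + 1) (m + 1) + (D.build Z B).LF (p + 1) m + (D.build Z B).RT p m +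
      (D.build Z B).UA p m = 2 := by
  have hUe := D.U_eq
  have h1 := occOf_le (D := D) hA
  have h2 := jumpOf_le (D := D) hA
  have hDN : (D.build Z B).DN (p + 1) (m + 1) = if D.Down (p + 1) then 1 - D.occOf Z (p + 1) (m + 1)
      else if D.Strip (p + 1) (m + 1) then
        D.occOf Z (p + 1) (m + 1) - D.jumpOf B (p + 1) (m + 1) else 1 := by
    simp only [build]; rw [if_pos (by omega)]
  have hLF : (D.build Z B).LF (p + 1) m =
      if D.Down (p + 1) then 1 else 1 - D.occOf Z (p + 1) m := by
    simp only [build]; rw [if_pos (by omega)]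
  rw [hDN, hLF]
  by_cases hs : D.Strip (p + 1) (m + 1)
  · rw [if_neg hs.not_down, if_neg hs.not_down, if_pos hs]
    have h3 := occOf_step hT hA hm hs
    have h4 := h2 (p + 1) (m + 1)
    have h5 := h1 (p + 1) m
    obtain ⟨h6, h7, h8⟩ := id hs
    have h9 : (D.build Z B).RT p m = 1 := by
      rcases Nat.lt_or_ge p D.U with h9 | h9
      · exact (build_out_corner (by
          have := D.c_U
          rw [show p + 1 = D.U by omega]; omega) hm h9).1
      · simp only [build]
        rw [if_pos (by omega), if_pos ⟨h9, by omega, by omega⟩]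
    omega
  rw [if_neg hs]
  have h3 := h1 (p + 1) m
  have h4 := h1 (p + 1) (m + 1)
  rcases Nat.lt_or_ge m (D.c (p + 1)) with h5 | h5
  · have h6 := build_out_below (D := D) (Z := Z) (B := B) h5
    rw [h6.1, h6.2]
    by_cases h : D.Down (p + 1)
    · rw [if_pos h, if_pos h, occOf_below (by rw [c_succ_of_down hp h]; omega)]
    · rw [if_neg h, if_neg h, occOf_below (by rw [c_succ_of_not_down hp h]; omega)]
  · obtain ⟨K, rfl⟩ : ∃ K, m = D.c (p + 1) + K := ⟨m - D.c (p + 1), by omega⟩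
    have h6 := occOf_succ hT hA hp hm hs
    rw [Nat.add_assoc _ (Bits.RT _ _ _), ← h6]
    by_cases h : D.Down (p + 1)
    · have h7 : D.c (p + 2) = D.c (p + 1) + 1 := c_succ_of_down hp h
      rw [if_pos h, if_pos h, h7, show D.c (p + 1) + 1 + K = D.c (p + 1) + K + 1 by omega]
      omega
    · have h7 : D.c (p + 2) = D.c (p + 1) := c_succ_of_not_down hp h
      rw [if_neg h, if_neg h, h7]
      omega

/-- The configuration of an array with the prescribed first and last lines satisfies the local
conditions. -/
theorem build_local (hT : T + D.u1 + 1 = 2 * D.n) (hA : IsArray T (D.a + D.b) Z B)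
    (h0 : ∀ K < D.a + D.b, Z 0 (K + 1) = 1 ↔ ¬ D.s (D.U + K))
    (hlast : ∀ K < D.a + D.b, Z T (K + 1) = 1 ↔ D.z (D.n + D.b - (K + 1))) :
    (D.build Z B).Local D.n D.s D.z := by
  have hP := D.P_lt
  have hUe := D.U_eq
  have hu0 := D.u0_pos
  refine ⟨build_supp hA, fun p m => build_even hA, fun p m => build_odd hT hA, fun p hp => ?_,
    fun p hp => ?_, fun m hm => ?_, fun p hp => ?_, fun k hk => ?_⟩
  · simp only [build]
    rw [if_pos (by omega)]
    have h1 : ¬ D.Strip p 0 := by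
      have := D.dyck_left D.U le_rfl
      have := D.c_U
      simp only [Strip]
      omega
    rw [if_neg h1]
    split_ifs with h2
    · rw [occOf_below (by rw [c_succ_of_down hp h2]; omega)]
    · rfl
  · simp only [build]
    rw [if_pos (by omega)]
    split_ifs with h1
    · rfl
    · rw [occOf_diag (by omega) h1, jumpOf_diag hA (by omega) h1]
  · simp only [build]
    rw [if_pos (by omega), if_pos ⟨D.one_last, Or.inr (by omega)⟩]
  · simp only [build]
    rw [if_pos (by omega)]
    by_cases h1 : D.Strip p p
    · obtain ⟨K, hK⟩ : ∃ K, p = D.U + K := ⟨p - D.U, by have := h1.1; omega⟩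
      have h2 := h1.2.1
      rw [if_neg h1.not_down, if_pos h1, jumpOf_strip h1, occOf_strip h1,
        show p + 1 - D.U = K + 1 by omega, hA.B_eq_zero (Or.inl (by omega)),
        hA.Z_eq_Z_zero (by omega) (by omega), hK]
      have := h0 K (by omega)
      have := hA.Z_le 0 (K + 1)
      by_cases h3 : D.s (D.U + K) <;> simp only [h3, not_true, not_false_iff, iff_true, iff_false] at * <;> omega
    · have h2 : p < D.U ∨ D.U + D.a + D.b ≤ p := by simp only [Strip] at h1; omega
      rw [if_neg h1, D.s_iff p hp h2, occOf_diag hp h1]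
      by_cases h3 : D.one p
      · rw [if_pos ⟨h3, h2⟩]; simp [h3]
      · rw [if_neg fun h => h3 h.1]; simp [h3]
  · have hc := D.c_end
    simp only [build]
    have h2 : ¬ D.Strip (2 * D.n - 1) (2 * D.n - 1 - k) := by simp only [Strip]; omega
    have h3 : D.c (2 * D.n - 1 + 1) = D.n - D.b := by
      rw [show 2 * D.n - 1 + 1 = 2 * D.n by omega]; omega
    rw [if_pos (by omega), if_pos ⟨D.one_last, Or.inr (by omega)⟩]
    by_cases h4 : D.n + D.b ≤ k
    · rw [occOf_below (by omega)]
      have := D.z_right k h4 hk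
      simp [this]
    by_cases h5 : k + D.a < D.n
    · rw [occOf_above h2 (by omega)]
      have := D.z_left k h5
      simp [this]
    obtain ⟨K, hK⟩ : ∃ K, 2 * D.n - 1 - k = D.c (2 * D.n - 1 + 1) + K :=
      ⟨2 * D.n - 1 - k - D.c (2 * D.n - 1 + 1), by omega⟩
    rw [hK] at h2 ⊢
    rw [occOf_mid (by omega) h2 (by omega), show 2 * D.n - 1 - D.u1 = T by omega,
      show k = D.n + D.b - (K + 1) by omega, ← hlast K (by omega)]
    have := hA.Z_le T (K + 1)
    omega

end OfArray

/-! ### Counting the configurations by a determinant -/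

section Count

open Datum

variable {D : Datum} {g g' : Bits}

/-- A configuration is determined by its edges above the points with even coordinate sum. -/
theorem eq_of_UA (hL : g.Local D.n D.s D.z) (hS : Shape D g) (hL' : g'.Local D.n D.s D.z)
    (hS' : Shape D g') (hUA : ∀ p m, g.UA p m = g'.UA p m) : g = g' := by
  have hP := D.P_lt
  have hUe := D.U_eq
  have hu0 := D.u0_pos
  -- by induction on the antidiagonals; inside the strip, from the left boundary downwards
  have key : ∀ p, p < 2 * D.n → (∀ m, m < p → g.LF p m = g'.LF p m) ∧
      ∀ m, m ≤ p → g.DN p m = g'.DN p m := by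
    intro p
    induction p with
    | zero =>
      refine fun hp => ⟨fun m hm => by omega, fun m hm => ?_⟩
      obtain rfl : m = 0 := by omega
      rw [hL.DN_zero 0 hp, hL'.DN_zero 0 hp]
    | succ p ih =>
      intro hp
      obtain ⟨h1, h2⟩ := ih (by omega)
      have hRT : ∀ m, m ≤ p → g.RT p m = g'.RT p m := by
        intro m hm
        rcases hm.lt_or_eq with h3 | rfl
        · have := hL.even p m h3 hp
          have := hL'.even p m h3 hp
          have := h1 m h3
          have := h2 m hm
          have := hUA p (m + 1)
          omega
        · rw [hL.RT_left m hp, hL'.RT_left m hp]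
      have hodd : ∀ m, m ≤ p → g.DN (p + 1) (m + 1) + g.LF (p + 1) m =
          g'.DN (p + 1) (m + 1) + g'.LF (p + 1) m := by
        intro m hm
        have := hL.odd p m hm hp
        have := hL'.odd p m hm hp
        have := hRT m hm
        have := hUA p m
        omega
      have hDN : ∀ m, m ≤ p → g.DN (p + 1) (m + 1) = g'.DN (p + 1) (m + 1) := by
        intro m hm
        by_cases h3 : p + 1 < D.U ∨ D.U + D.a + D.b ≤ p + 1
        · by_cases h4 : D.one (p + 1)
          · have := hodd m hm
            have := hS.LF_outer (p + 1) m hp h3 h4 (by omega)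
            have := hS'.LF_outer (p + 1) m hp h3 h4 (by omega)
            omega
          · rw [hS.DN_outer (p + 1) (m + 1) hp h3 h4 (by omega),
              hS'.DN_outer (p + 1) (m + 1) hp h3 h4 (by omega)]
        · induction hm using Nat.decreasingInduction with
          | self =>
            have h4 := hL.DN_left (p + 1) hp
            have h5 := hL'.DN_left (p + 1) hp
            have := hL.DN_le (p + 1) (p + 1)
            have := hL'.DN_le (p + 1) (p + 1)
            by_cases h6 : D.s (p + 1)
            · rw [h4.2 h6, h5.2 h6]
            · have := h4.not.2 h6
              have := h5.not.2 h6
              omega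
          | of_succ m hm ih =>
            rcases Nat.lt_or_ge (p + 1) (m + 1 + D.u0) with h4 | h4
            · have := hodd (m + 1) hm
              have := hL.even (p + 1) (m + 1) (by omega) (by omega)
              have := hL'.even (p + 1) (m + 1) (by omega) (by omega)
              have := hS.RT_strip (p + 1) (m + 1) (by omega) (by omega) (by omega) h4
              have := hS'.RT_strip (p + 1) (m + 1) (by omega) (by omega) (by omega) h4
              have := hUA (p + 1) (m + 1 + 1)
              omega
            · rw [hS.DN_center (p + 1) (m + 1) (by omega) (by omega) h4,
                hS'.DN_center (p + 1) (m + 1) (by omega) (by omega) h4]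
      refine ⟨fun m hm => ?_, fun m hm => ?_⟩
      · have := hodd m (by omega)
        have := hDN m (by omega)
        omega
      · rcases m with _ | m
        · rw [hL.DN_zero _ hp, hL'.DN_zero _ hp]
        · exact hDN m (by omega)
  ext p m
  · by_cases h : m < p ∧ p < 2 * D.n
    · exact (key p h.2).1 m h.1
    · have h1 := (hL.LF_supp p m).mt h
      have h2 := (hL'.LF_supp p m).mt h
      omega
  · by_cases h : m ≤ p ∧ p < 2 * D.n
    · exact (key p h.2).2 m h.1
    · have h1 := (hL.DN_supp p m).mt h
      have h2 := (hL'.DN_supp p m).mt h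
      omega
  · by_cases h : m ≤ p ∧ p + 1 < 2 * D.n
    · rcases h.1.lt_or_eq with h1 | h1
      · have := hL.even p m h1 h.2
        have := hL'.even p m h1 h.2
        have := (key p (by omega)).1 m h1
        have := (key p (by omega)).2 m h.1
        have := hUA p (m + 1)
        omega
      · subst h1
        rw [hL.RT_left m h.2, hL'.RT_left m h.2]
    · have h1 := (hL.RT_supp p m).mt h
      have h2 := (hL'.RT_supp p m).mt h
      omega
  · exact hUA p m

/-- A configuration is determined by its jumps. -/
theorem eq_of_arrB (hL : g.Local D.n D.s D.z) (hS : Shape D g) (hL' : g'.Local D.n D.s D.z)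
    (hS' : Shape D g') (hB : g.arrB D = g'.arrB D) : g = g' := by
  have hP := D.P_lt
  have hUe := D.U_eq
  have hu0 := D.u0_pos
  refine eq_of_UA hL hS hL' hS' fun p m => ?_
  rcases m with _ | m
  · rw [hL.UA_zero, hL'.UA_zero]
  by_cases hr : m + 1 ≤ p ∧ p + 1 < 2 * D.n
  swap
  · have h1 := (hL.UA_supp p (m + 1)).mt (by omega)
    have h2 := (hL'.UA_supp p (m + 1)).mt (by omega)
    omega
  obtain ⟨hm, hp⟩ := hr
  rcases Nat.lt_or_ge m (D.c (p + 1)) with h1 | h1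
  · rw [(chain_out hL hS hp h1).2, (chain_out hL' hS' hp h1).2]
  rcases Nat.lt_or_ge p D.U with h2 | h2
  · rw [corner_UA hL hS h2, corner_UA hL' hS' h2]
  -- in the strip, the time is `2 * p - m - U`, and outside of it, the time is `p - u1`
  by_cases h3 : D.Strip p m
  · obtain ⟨-, h4, h5⟩ := id h3
    by_cases h6 : p + 1 = D.U + D.a + D.b
    · rw [UA_last hL hS h6 hm (by omega), UA_last hL' hS' h6 hm (by omega)]
    · have := congrFun (congrFun hB (2 * p - m - D.U)) (p - D.U + 1)
      simp only [Bits.arrB] at this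
      rw [if_pos (show _ ∧ _ ∧ _ by omega), if_pos (show _ ∧ _ ∧ _ by omega), if_pos (by omega),
        if_pos (by omega)] at this
      rwa [show D.U + (p - D.U) = p by omega,
        show D.U + 2 * (p - D.U) + 1 - (2 * p - m - D.U) = m + 1 by omega] at this
  · obtain ⟨K, rfl⟩ : ∃ K, m = D.c (p + 1) + K := ⟨m - D.c (p + 1), by omega⟩
    have h4 : (p < D.U + D.a + D.b ∧ D.c (p + 1) = D.u1) ∨
        (D.U + D.a + D.b ≤ p ∧ D.u1 ≤ D.c (p + 1)) := by
      rcases Nat.lt_or_ge p (D.U + D.a + D.b) with h4 | h4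
      · exact Or.inl ⟨h4, D.c_of_mid (by omega) (by omega)⟩
      · refine Or.inr ⟨h4, ?_⟩
        have h5 := D.dyck_right
        rw [← D.c_of_mid (p := D.U + D.a + D.b) (by omega) le_rfl]
        clear h1 h2 h3 hm
        induction p, h4 using Nat.le_induction with
        | base =>
          by_cases h : D.Down (D.U + D.a + D.b)
          · rw [c_succ_of_down (by omega) h]; omega
          · rw [c_succ_of_not_down (by omega) h]
        | succ p h4 ih =>
          refine (ih (by omega)).trans ?_
          by_cases h : D.Down (p + 1)
          · rw [c_succ_of_down (by omega) h]; omega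
          · rw [c_succ_of_not_down (by omega) h]
    simp only [Strip] at h3
    by_cases h6 : K + 1 < D.a + D.b
    · have := congrFun (congrFun hB (p - D.u1)) (K + 1)
      simp only [Bits.arrB] at this
      rw [if_pos (show _ ∧ _ ∧ _ by omega), if_pos (show _ ∧ _ ∧ _ by omega), if_neg (by omega),
        if_neg (by omega)] at this
      rwa [show p - D.u1 + D.u1 = p by omega] at this
    · rw [right_UA hL hS (by omega) (by omega), right_UA hL' hS' (by omega) (by omega)]

/-- The jumps of the configuration of an array are the given ones. -/
theorem arrB_build {Z B : ℕ → ℕ → ℕ} {T : ℕ} (hT : T + D.u1 + 1 = 2 * D.n)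
    (hA : IsArray T (D.a + D.b) Z B) : (D.build Z B).arrB D = B := by
  have hP := D.P_lt
  have hUe := D.U_eq
  have hu0 := D.u0_pos
  funext s J
  rcases J with _ | K
  · rw [hA.B_zero]; rfl
  simp only [Bits.arrB]
  by_cases h1 : K + 1 < D.a + D.b ∧ K < s ∧ s + D.u1 + 1 < 2 * D.n
  swap
  · rw [if_neg h1]
    by_contra h
    have := hA.B_supp s (K + 1) (Ne.symm h)
    omega
  rw [if_pos h1]
  simp only [build]
  split_ifs with h2 h3 h3
  · have h4 : D.Strip (D.U + K) (D.U + 2 * K + 1 - s - 1) := ⟨by omega, by omega, by omega⟩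
    rw [jumpOf_strip h4]
    congr 1 <;> omega
  · omega
  · have h4 : ¬ D.Strip (s + D.u1) (D.c (s + D.u1 + 1) + K) := by
      rcases Nat.lt_or_ge (s + D.u1) (D.U + D.a + D.b) with h | h
      · rw [D.c_of_mid (by omega) (by omega)]
        simp only [Strip]; omega
      · simp only [Strip]; omega
    rw [Nat.add_sub_cancel, jumpOf_mid (by omega) h4, Nat.add_sub_cancel]
  · have := Datum.center_le (D := D) (s := s) (K := K) (by omega) (by omega) (by omega)
    omega

/-- The configurations are counted by a determinant. The particles start at the letters `0` of
the middle part of `σ`, and they end at the letters `0` of the middle part of `τ`, in reverse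
order. -/
theorem ncard_linked (D : Datum) {k : ℕ} {i z : Fin k → ℕ} (hi : StrictMono i) (hz : StrictMono z)
    (hir : ∀ J, (∃ d, i d = J) ↔ 1 ≤ J ∧ J ≤ D.a + D.b ∧ ¬ D.s (D.U + (J - 1)))
    (hzr : ∀ J, (∃ d, z d = J) ↔ 1 ≤ J ∧ J ≤ D.a + D.b ∧ D.z (D.n + D.b - J)) :
    ({g : Bits | g.Local D.n D.s D.z ∧ g.Linked D.n D.s D.z D.Match}.ncard : ℤ) =
      (Matrix.of fun d e => weight (2 * D.n - 1 - D.u1) (i d) (z e)).det := by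
  have hP := D.P_lt
  have hUe := D.U_eq
  have hu0 := D.u0_pos
  obtain ⟨T, hT'⟩ : ∃ T, 2 * D.n - 1 - D.u1 = T := ⟨_, rfl⟩
  have hT : T + D.u1 + 1 = 2 * D.n := by omega
  rw [hT', ← card_histories i hi T z hz, ← Set.ncard_coe_finset]
  have hset : {g : Bits | g.Local D.n D.s D.z ∧ g.Linked D.n D.s D.z D.Match} =
      {g : Bits | g.Local D.n D.s D.z ∧ Shape D g} := by
    ext g
    exact and_congr_right fun h => linked_iff_shape h
  rw [hset]
  -- the array of a history
  let Z : (ℕ → Finset (Fin k)) → ℕ → ℕ → ℕ := fun H s => if s ≤ T then occupied i H s else 0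
  have hA : ∀ H ∈ histories i T z, IsArray T (D.a + D.b) (Z H) (jumping i H) := by
    intro H hH
    obtain ⟨h1, h2⟩ := (mem_histories i hi T z H).1 hH
    refine isArray_of_isHistory h1 (fun d => ((hir _).1 ⟨d, rfl⟩).1) fun d => ?_
    rw [h2]
    exact ((hzr _).1 ⟨d, rfl⟩).2.1
  have hocc : ∀ (H : ℕ → Finset (Fin k)) s J, s ≤ T → (Z H s J = 1 ↔ ∃ d, pos i H s d = J) := by
    intro H s J hs
    simp only [Z, if_pos hs, occupied, ite_eq_left_iff, zero_ne_one, imp_false, not_not]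
  have hloc : ∀ H ∈ histories i T z, (D.build (Z H) (jumping i H)).Local D.n D.s D.z := by
    intro H hH
    obtain ⟨h1, h2⟩ := (mem_histories i hi T z H).1 hH
    refine build_local hT (hA H hH) (fun K hK => ?_) fun K hK => ?_
    · rw [hocc H 0 _ (Nat.zero_le _), pos, hir, Nat.add_sub_cancel]
      exact ⟨fun h => h.2.2, fun h => ⟨by omega, by omega, h⟩⟩
    · rw [hocc H T _ le_rfl, h2, hzr]
      exact ⟨fun h => h.2.2, fun h => ⟨by omega, by omega, h⟩⟩
  symm
  refine congrArg _ (Set.ncard_congr (fun H _ => D.build (Z H) (jumping i H)) (fun H hH => ?_)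
    (fun H H' hH hH' h => ?_) fun g hg => ?_)
  · exact ⟨hloc H hH, build_shape⟩
  · refine history_ext ((mem_histories i hi T z H).1 hH).1 ((mem_histories i hi T z H').1 hH').1 ?_
    rw [← arrB_build hT (hA H hH), ← arrB_build hT (hA H' hH'), h]
  · obtain ⟨hL, hS⟩ := hg
    have hgA : IsArray T (D.a + D.b) (g.arrZ D) (g.arrB D) := hT' ▸ isArray_of_shape hL hS
    have hsupp : ∀ {s J}, g.arrZ D s J = 1 → 1 ≤ J ∧ J ≤ D.a + D.b := fun {s J} h =>
      hgA.Z_supp s J (by omega)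
    obtain ⟨H, h1, h2, h3⟩ := exists_history hgA hi fun J => by
      rw [hir]
      constructor
      · intro h
        have hJ := hsupp h
        refine ⟨hJ.1, hJ.2, (arrZ_zero hL hS (K := J - 1) (by omega)).1 ?_⟩
        rwa [Nat.sub_add_cancel hJ.1]
      · rintro ⟨hJ, hJ', h⟩
        rw [← arrZ_zero hL hS (by omega), Nat.sub_add_cancel hJ] at h
        exact h
    have hH : H ∈ histories i T z := by
      refine (mem_histories i hi T z H).2 ⟨h1, ?_⟩
      refine ((h1.mono T le_rfl).range_inj hz).1 ?_
      ext J
      simp only [Set.mem_range]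
      rw [← h2 T le_rfl, hzr]
      constructor
      · intro h
        have hJ := hsupp h
        refine ⟨hJ.1, hJ.2, ?_⟩
        obtain ⟨K, rfl⟩ : ∃ K, J = K + 1 := ⟨J - 1, by omega⟩
        rw [← hT'] at h
        exact (arrZ_last hL (by omega)).1 h
      · rintro ⟨hJ, hJ', h⟩
        obtain ⟨K, rfl⟩ : ∃ K, J = K + 1 := ⟨J - 1, by omega⟩
        rw [← hT']
        exact (arrZ_last hL (by omega)).2 h
    refine ⟨H, hH, eq_of_arrB (hloc H hH) build_shape hL hS ?_⟩
    rw [arrB_build hT (hA H hH), h3]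

end Count

/-! ### Complementary minors -/

section Minors

theorem weight_mul_weight {T i j k : ℕ} (h1 : i ≤ j) (h2 : j ≤ k) (h3 : k ≤ T) :
    weight T i j * weight T j k = weight T i k * ((k - i).choose (j - i) : ℤ) := by
  simp only [weight, if_pos h1, if_pos h2, if_pos (h1.trans h2)]
  have := Nat.choose_mul (n := T - i) (k := k - i) (s := j - i) (by omega)
  rw [show T - i - (j - i) = T - j by omega, show k - i - (j - i) = k - j by omega] at this
  exact_mod_cast this.symm

/-- The inverse of the matrix of weights has the same entries with alternating signs. -/
theorem sum_weight_mul_weight {T m i k : ℕ} (hi : 1 ≤ i) (hk : k ≤ m) (hm : m ≤ T) :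
    ∑ j ∈ Finset.Icc 1 m, weight T i j * ((-1) ^ (j + k) * weight T j k) =
      if i = k then 1 else 0 := by
  have hsupp : ∀ j ∈ Finset.Icc 1 m, j ∉ Finset.Icc i k →
      weight T i j * ((-1) ^ (j + k) * weight T j k) = 0 := by
    intro j hj hj'
    rw [Finset.mem_Icc] at hj hj'
    rcases Nat.lt_or_ge j i with h | h
    · rw [weight, if_neg (by omega), zero_mul]
    · rw [weight, weight, if_neg (show ¬ j ≤ k by omega), mul_zero, mul_zero]
  rw [← Finset.sum_subset (Finset.Icc_subset_Icc hi hk) hsupp]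
  rcases Nat.lt_or_ge k i with h | h
  · rw [Finset.Icc_eq_empty (by omega), Finset.sum_empty, if_neg (by omega)]
  obtain ⟨l, rfl⟩ : ∃ l, k = i + l := ⟨k - i, by omega⟩
  have h1 : ∀ j ∈ Finset.range (l + 1),
      weight T i (i + j) * ((-1) ^ (i + j + (i + l)) * weight T (i + j) (i + l)) =
        weight T i (i + l) * (-1) ^ l * ((-1) ^ j * (l.choose j : ℤ)) := by
    intro j hj
    rw [Finset.mem_range] at hj
    have h2 := weight_mul_weight (T := T) (i := i) (j := i + j) (k := i + l) (by omega) (by omega)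
      (by omega)
    rw [Nat.add_sub_cancel_left, Nat.add_sub_cancel_left] at h2
    have h3 : ((-1 : ℤ)) ^ (i + j + (i + l)) = (-1) ^ l * (-1) ^ j := by
      rw [show i + j + (i + l) = 2 * i + (l + j) by omega, pow_add, pow_mul, pow_add]; simp
    rw [h3]
    linear_combination (-1 : ℤ) ^ l * (-1) ^ j * h2
  have h4 : Finset.Icc i (i + l) = (Finset.range (l + 1)).image (i + ·) := by
    ext x
    simp only [Finset.mem_Icc, Finset.mem_image, Finset.mem_range]
    constructor
    · intro hx; exact ⟨x - i, by omega, by omega⟩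
    · rintro ⟨y, hy, rfl⟩; omega
  rw [h4, Finset.sum_image (fun x _ y _ h => Nat.add_left_cancel h), Finset.sum_congr rfl h1,
    ← Finset.mul_sum, Int.alternating_sum_range_choose]
  rcases Nat.eq_zero_or_pos l with rfl | hl
  · simp [weight]
  · rw [if_neg (by omega), if_neg (by omega), mul_zero]

/-- Jacobi's identity: a minor of a matrix agrees, up to a unit, with the complementary minor of the
inverse matrix. -/
theorem det_eq_det_mul_det_of_mul_eq_one {R m n : Type*} [CommRing R] [Fintype m] [Fintype n]
    [DecidableEq m] [DecidableEq n] {P Q : Matrix (m ⊕ n) (m ⊕ n) R} (h : P * Q = 1) :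
    P.toBlocks₁₁.det = P.det * Q.toBlocks₂₂.det := by
  have h1 : P * Matrix.fromBlocks 1 Q.toBlocks₁₂ 0 Q.toBlocks₂₂ =
      Matrix.fromBlocks P.toBlocks₁₁ 0 P.toBlocks₂₁ 1 := by
    have h2 := h
    rw [← Matrix.fromBlocks_toBlocks P, ← Matrix.fromBlocks_toBlocks Q, Matrix.fromBlocks_multiply,
      ← Matrix.fromBlocks_one, Matrix.fromBlocks_inj] at h2
    conv_lhs => rw [← Matrix.fromBlocks_toBlocks P]
    rw [Matrix.fromBlocks_multiply, h2.2.1, h2.2.2.2]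
    simp
  have h3 := congrArg Matrix.det h1
  rw [Matrix.det_mul, Matrix.det_fromBlocks_zero₂₁, Matrix.det_fromBlocks_zero₁₂, Matrix.det_one,
    Matrix.det_one, one_mul, mul_one] at h3
  exact h3.symm

/-- The two determinants are complementary minors of inverse matrices, and so they agree up to a
sign. Both of them count histories, so they are nonnegative. -/
theorem det_weight_compl {a b T : ℕ} (hT : a + b ≤ T) {i₀ J₀ : Fin a → ℕ} {i₁ J₁ : Fin b → ℕ}
    (hi₀ : StrictMono i₀) (hJ₀ : StrictMono J₀) (hi₁ : StrictMono i₁) (hJ₁ : StrictMono J₁)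
    (hi : Function.Injective (Sum.elim i₀ i₁)) (hJ : Function.Injective (Sum.elim J₀ J₁))
    (hir : ∀ x, 1 ≤ Sum.elim i₀ i₁ x ∧ Sum.elim i₀ i₁ x ≤ a + b)
    (hJr : ∀ x, 1 ≤ Sum.elim J₀ J₁ x ∧ Sum.elim J₀ J₁ x ≤ a + b) :
    (Matrix.of fun d e => weight T (i₀ d) (J₀ e)).det =
      (Matrix.of fun d e => weight T (J₁ e) (i₁ d)).det := by
  classical
  let P : Matrix (Fin a ⊕ Fin b) (Fin a ⊕ Fin b) ℤ :=
    Matrix.of fun x y => weight T (Sum.elim i₀ i₁ x) (Sum.elim J₀ J₁ y)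
  let Q : Matrix (Fin a ⊕ Fin b) (Fin a ⊕ Fin b) ℤ := Matrix.of fun y x =>
    (-1) ^ (Sum.elim J₀ J₁ y + Sum.elim i₀ i₁ x) * weight T (Sum.elim J₀ J₁ y) (Sum.elim i₀ i₁ x)
  have himg : Finset.univ.image (Sum.elim J₀ J₁) = Finset.Icc 1 (a + b) := by
    apply Finset.eq_of_subset_of_card_le
    · intro k hk
      obtain ⟨x, -, rfl⟩ := Finset.mem_image.1 hk
      exact Finset.mem_Icc.2 (hJr x)
    · rw [Finset.card_image_of_injective _ hJ]
      simp
  have hPQ : P * Q = 1 := by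
    ext x x'
    rw [Matrix.mul_apply]
    simp only [P, Q, Matrix.of_apply]
    have h1 := sum_weight_mul_weight (T := T) (hir x).1 (hir x').2 hT
    rw [← himg, Finset.sum_image hJ.injOn] at h1
    rw [h1, Matrix.one_apply]
    simp only [hi.eq_iff]
  have h2 := det_eq_det_mul_det_of_mul_eq_one hPQ
  have h3 : Q.toBlocks₂₂ = Matrix.of fun y x =>
      (-1) ^ J₁ y * ((Matrix.of fun y x => (-1) ^ i₁ x *
        ((Matrix.of fun d e => weight T (J₁ d) (i₁ e)) y x)) y x) := by
    ext y x
    simp [Q, Matrix.toBlocks₂₂, pow_add, mul_assoc]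
  have h4 : P.toBlocks₁₁ = Matrix.of fun d e => weight T (i₀ d) (J₀ e) := by
    ext d e
    simp [P, Matrix.toBlocks₁₁]
  have h5 : (Matrix.of fun d e => weight T (J₁ e) (i₁ d)).det =
      (Matrix.of fun d e => weight T (J₁ d) (i₁ e)).det := by
    rw [← Matrix.det_transpose]
    rfl
  have habs : ∀ (k : ℕ) (f : Fin k → ℕ), |∏ x, (-1 : ℤ) ^ f x| = 1 := by
    intro k f
    rw [Finset.abs_prod]
    simp
  have hP : |P.det| = 1 := by
    have h6 := congrArg Matrix.det hPQ
    rw [Matrix.det_mul, Matrix.det_one] at h6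
    exact Int.isUnit_iff_abs_eq.1 (IsUnit.of_mul_eq_one _ h6)
  rw [h4, h3, Matrix.det_mul_column, Matrix.det_mul_row] at h2
  have h7 := congrArg abs h2
  rw [abs_mul, abs_mul, abs_mul, hP, habs, habs, one_mul, one_mul, one_mul,
    ← card_histories i₀ hi₀ T J₀ hJ₀, ← card_histories J₁ hJ₁ T i₁ hi₁, Nat.abs_cast,
    Nat.abs_cast] at h7
  rw [h5, ← card_histories i₀ hi₀ T J₀ hJ₀, ← card_histories J₁ hJ₁ T i₁ hi₁, h7]

theorem binom_eq_weight {T i j : ℕ} (h : i ≤ T) (x k : ℤ) (hx : x = (T : ℤ) - i)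
    (hk : k = (j : ℤ) - i) : binom x k = weight T i j := by
  unfold binom weight
  by_cases h1 : i ≤ j
  · rw [if_pos (by omega), if_pos h1, show x = ((T - i : ℕ) : ℤ) by omega,
      show k.toNat = j - i by omega, Ring.choose_natCast]
  · rw [if_neg (by omega), if_neg h1]

end Minors

/-! ### Words -/

section Words

theorem Word.length_eq (w : Word) : w.length = w.count 0 + w.count 1 := by
  induction w with
  | nil => rfl
  | cons x w ih =>
    rw [List.length_cons, ih]
    fin_cases x <;> simp <;> omega

theorem Word.count_take_succ {w : Word} {p : ℕ} {x : Fin 2} (h : w[p]? = some x) (y : Fin 2) :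
    (w.take (p + 1)).count y = (w.take p).count y + if x = y then 1 else 0 := by
  rw [List.take_add_one, h, List.count_append]
  simp [List.count_singleton]

theorem Word.count_take_add (w : Word) {p : ℕ} (hp : p ≤ w.length) :
    (w.take p).count 0 + (w.take p).count 1 = p := by
  rw [← Word.length_eq, List.length_take]
  omega

theorem Word.ne_one_iff {w : Word} {p : ℕ} (hp : p < w.length) :
    w[p]? = some 0 ↔ ¬ w[p]? = some 1 := by
  rcases letter_cases hp with h | h <;> simp [h]

theorem Word.ncard_positions (w : Word) (x : Fin 2) (p : ℕ) :
    {i | i < p ∧ w[i]? = some x}.ncard = (w.take p).count x := by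
  have h : {i | i < p ∧ w[i]? = some x} = ↑((Finset.range p).filter fun i => w[i]? = some x) := by
    ext i; simp
  rw [h, Set.ncard_coe_finset]
  clear h
  induction p with
  | zero => simp
  | succ p ih =>
    rw [Finset.range_add_one, Finset.filter_insert]
    split_ifs with h
    · rw [Finset.card_insert_of_notMem (by simp), ih, Word.count_take_succ h, if_pos rfl]
    · rw [ih]
      rcases Nat.lt_or_ge p w.length with h1 | h1
      · rw [Word.count_take_succ (List.getElem?_eq_getElem h1), if_neg fun h2 => h ?_, Nat.add_zero]
        rw [← h2, List.getElem?_eq_getElem h1]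
      · rw [List.take_of_length_le h1, List.take_of_length_le (by omega)]

theorem mem_indexSet_le {x : Fin 2} {w : Word} {i : ℕ} (h : i ∈ indexSet x w) :
    1 ≤ i ∧ i ≤ w.length := by
  obtain ⟨h1, h2⟩ := h
  have := (List.getElem?_eq_some_iff.1 h2).1
  omega

theorem count_of_mem_dyckWords {n : ℕ} {w : Word} (h : w ∈ dyckWords n) :
    w.count 0 = n ∧ w.count 1 = n := by
  obtain ⟨h1, h2, -⟩ := h
  have := Word.length_eq w
  omega

theorem last_of_mem_dyckWords {n : ℕ} {w : Word} (h : w ∈ dyckWords n) (hn : 0 < n) :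
    w[2 * n - 1]? = some 1 := by
  have h0 := count_of_mem_dyckWords h
  obtain ⟨h1, h2, h3⟩ := h
  by_contra h4
  have h5 := (Word.ne_one_iff (w := w) (p := 2 * n - 1) (by omega)).2 h4
  have h6 := Word.count_take_succ h5 0
  have h7 := Word.count_take_succ h5 1
  have h8 := h3 (2 * n - 1)
  rw [show 2 * n - 1 + 1 = w.length by omega, List.take_length] at h6 h7
  simp at h6 h7
  omega

end Words

/-! ### The boundary data of words -/

section OfWords

/-- The words `σ`, `π`, `τ` of length `2 * n` with their decompositions. -/
structure Factored (n a b : ℕ) (σ π τ u v σ' τ' : Word) : Prop where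
  hσ : σ ∈ dyckWords n
  hπ : π ∈ dyckWords n
  hτ : τ ∈ dyckWords n
  ha : u.count 0 + v.count 0 + a = n
  hb : u.count 1 + v.count 1 + b = n
  hσ_eq : σ = u ++ σ' ++ v
  hπ_eq : π = u ++ List.replicate b 1 ++ List.replicate a 0 ++ v
  hτ_eq : τ = List.replicate (n - a) 0 ++ τ' ++ List.replicate (n - b) 1

namespace Factored

variable {n a b : ℕ} {σ π τ u v σ' τ' : Word} (h : Factored n a b σ π τ u v σ' τ')
include h

theorem count_σ' : σ'.count 0 = a ∧ σ'.count 1 = b := by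
  have h1 := count_of_mem_dyckWords h.hσ
  rw [h.hσ_eq] at h1
  simp only [List.count_append] at h1
  have := h.ha
  have := h.hb
  omega

theorem count_τ' : τ'.count 0 = a ∧ τ'.count 1 = b := by
  have h1 := count_of_mem_dyckWords h.hτ
  rw [h.hτ_eq] at h1
  simp [List.count_append, List.count_replicate] at h1
  have := h.ha
  have := h.hb
  omega

theorem length_σ' : σ'.length = a + b := by
  rw [Word.length_eq, h.count_σ'.1, h.count_σ'.2]

theorem length_τ' : τ'.length = a + b := by
  rw [Word.length_eq, h.count_τ'.1, h.count_τ'.2]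

theorem length_eq : u.length + a + b + v.length = 2 * n := by
  have := h.ha
  have := h.hb
  rw [Word.length_eq u, Word.length_eq v]
  omega

theorem σ_mid {k : ℕ} (hk : k < a + b) : σ[u.length + k]? = σ'[k]? := by
  have := h.length_σ'
  rw [h.hσ_eq, List.append_assoc, List.getElem?_append_right (by omega), Nat.add_sub_cancel_left,
    List.getElem?_append_left (by omega)]

theorem τ_mid {k : ℕ} (hk : k < a + b) : τ[n - a + k]? = τ'[k]? := by
  have := h.length_τ'
  rw [h.hτ_eq, List.append_assoc, List.getElem?_append_right (by simp), List.length_replicate,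
    Nat.add_sub_cancel_left, List.getElem?_append_left (by omega)]

theorem π_left {p : ℕ} (hp : p < u.length) : π[p]? = u[p]? := by
  rw [h.hπ_eq, List.append_assoc, List.append_assoc, List.getElem?_append_left hp]

theorem σ_left {p : ℕ} (hp : p < u.length) : σ[p]? = u[p]? := by
  rw [h.hσ_eq, List.append_assoc, List.getElem?_append_left hp]

theorem π_right {p : ℕ} (hp : u.length + a + b ≤ p) : π[p]? = v[p - (u.length + a + b)]? := by
  rw [h.hπ_eq, List.getElem?_append_right (by simp; omega)]
  congr 1
  simp
  omega

theorem σ_right {p : ℕ} (hp : u.length + a + b ≤ p) : σ[p]? = v[p - (u.length + a + b)]? := by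
  have := h.length_σ'
  rw [h.hσ_eq, List.getElem?_append_right (by simp; omega)]
  congr 1
  simp
  omega

theorem take_left {p : ℕ} (hp : p ≤ u.length) : π.take p = u.take p := by
  rw [h.hπ_eq, List.append_assoc, List.append_assoc, List.take_append_of_le_length hp]

theorem count_take_right (x : Fin 2) {p : ℕ} (hp : u.length + a + b ≤ p) :
    (π.take p).count x = u.count x + (if x = 1 then b else a) +
      (v.take (p - (u.length + a + b))).count x := by
  rw [h.hπ_eq, List.take_append, List.take_of_length_le (by simp; omega), List.count_append]
  congr 1
  · fin_cases x <;> simp [List.count_append, List.count_replicate]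
  · congr 2
    simp
    omega

/-- The word `u 1 ⋯ 1` is a prefix of the Dyck word `π`. -/
theorem prefix_le : u.count 1 + b ≤ u.count 0 := by
  have h1 := h.hπ.2.2 (u.length + b)
  have h3 : π.take (u.length + b) = u ++ List.replicate b 1 := by
    rw [h.hπ_eq, List.append_assoc]
    exact List.take_left' (by simp)
  rw [h3] at h1
  simpa [List.count_append, List.count_replicate] using h1

/-- The number of letters `1` of `u` and `v` before a position. -/
def ones (a b : ℕ) (u v : Word) (p : ℕ) : ℕ :=
  (u.take p).count 1 + (v.take (p - (u.length + a + b))).count 1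

/-- The boundary data of words. -/
def datum (hu : u ≠ []) (hv : v ≠ []) : Datum where
  n := n
  U := u.length
  u0 := u.count 0
  u1 := u.count 1
  a := a
  b := b
  one p := π[p]? = some 1
  s p := σ[p]? = some 1
  z p := τ[p]? = some 0
  c := ones a b u v
  sc p := (σ.take p).count 1
  U_eq := Word.length_eq u
  U_pos := List.length_pos_iff.2 hu
  P_lt := by
    have := h.length_eq
    have := List.length_pos_iff.2 hv
    omega
  c_zero := by simp [ones]
  c_one p hp ho h1 := by
    unfold ones
    rcases ho with ho | ho
    · rw [h.π_left ho] at h1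
      rw [Word.count_take_succ h1, if_pos rfl, show p + 1 - (u.length + a + b) = 0 by omega,
        show p - (u.length + a + b) = 0 by omega]
      simp
    · rw [h.π_right ho] at h1
      rw [show p + 1 - (u.length + a + b) = p - (u.length + a + b) + 1 by omega,
        Word.count_take_succ h1, if_pos rfl, List.take_of_length_le (l := u) (i := p + 1) (by omega),
        List.take_of_length_le (l := u) (i := p) (by omega)]
      omega
  c_not p hp ho h1 := by
    have hl := h.length_eq
    unfold ones
    rcases ho with ho | ho
    · rw [h.π_left ho] at h1
      rw [Word.count_take_succ ((Word.ne_one_iff ho).2 h1), if_neg (by decide),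
        show p + 1 - (u.length + a + b) = 0 by omega, show p - (u.length + a + b) = 0 by omega]
      simp
    · rw [h.π_right ho] at h1
      rw [show p + 1 - (u.length + a + b) = p - (u.length + a + b) + 1 by omega,
        Word.count_take_succ ((Word.ne_one_iff (by omega)).2 h1), if_neg (by decide),
        List.take_of_length_le (l := u) (i := p + 1) (by omega),
        List.take_of_length_le (l := u) (i := p) (by omega), Nat.add_zero]
  c_mid p h1 h2 := by
    unfold ones
    rw [List.take_of_length_le (l := u) (i := p + 1) (by omega),
      List.take_of_length_le (l := u) (i := p) (by omega), show p + 1 - (u.length + a + b) = 0 by omega, show p - (u.length + a + b) = 0 by omega]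
  c_U := by simp [ones, show u.length - (u.length + a + b) = 0 by omega]
  c_end := by
    have hl := h.length_eq
    have := h.hb
    unfold ones
    rw [List.take_of_length_le (by omega), List.take_of_length_le (by omega)]
    omega
  dyck_left p hp := by
    have h1 := h.hπ.2.2 p
    rw [h.take_left hp] at h1
    have h2 := Word.count_take_add u hp
    unfold ones
    rw [show p - (u.length + a + b) = 0 by omega]
    simp
    omega
  dyck_right p hp hp' := by
    have h1 := h.hπ.2.2 p
    have h2 := Word.count_take_add π (hp'.trans h.hπ.1.ge)
    have h3 := h.count_take_right 1 hp
    rw [if_pos rfl] at h3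
    unfold ones
    rw [List.take_of_length_le (l := u) (i := p) (by omega)]
    omega
  dyck_mid := by
    have h1 := h.prefix_le
    have h2 := Word.length_eq u
    omega
  mid_one p h1 h2 := by
    rw [h.hπ_eq, List.append_assoc, List.append_assoc, List.getElem?_append_right h1,
      List.getElem?_append_left (by simp; omega), List.getElem?_replicate, if_pos (by omega)]
  mid_zero p h1 h2 := by
    rw [h.hπ_eq, List.append_assoc, List.getElem?_append_right (by simp; omega),
      List.getElem?_append_left (by simp; omega), List.getElem?_replicate, if_pos (by simp; omega)]
    simp
  s_iff p hp ho := by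
    rcases ho with ho | ho
    · rw [h.π_left ho, h.σ_left ho]
    · rw [h.π_right ho, h.σ_right ho]
  one_last := by
    have := List.length_pos_iff.2 hu
    have := h.length_eq
    exact last_of_mem_dyckWords h.hπ (by omega)
  z_left k hk := by
    rw [h.hτ_eq, List.append_assoc, List.getElem?_append_left (by simp; omega),
      List.getElem?_replicate, if_pos (by omega)]
  z_right k h1 h2 := by
    have := h.length_τ'
    have := h.ha
    have := h.hb
    rw [h.hτ_eq, List.getElem?_append_right (by simp; omega), List.getElem?_replicate,
      if_pos (by simp; omega)]
    simp
  sc_zero := by simp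
  sc_one p hp h1 := by rw [Word.count_take_succ h1, if_pos rfl]
  sc_not p hp h1 := by
    rw [Word.count_take_succ ((Word.ne_one_iff (by rw [h.hσ.1]; exact hp)).2 h1),
      if_neg (by decide), Nat.add_zero]
  sc_P := by
    have h1 := h.length_σ'
    have h2 := h.count_σ'
    rw [h.hσ_eq, Nat.add_assoc, ← h1, ← List.length_append, List.take_left, List.count_append,
      h2.2]
  card_eq := by
    rw [Word.ncard_positions, Word.ncard_positions, List.take_of_length_le h.hτ.1.le,
      List.take_of_length_le h.hσ.1.le, (count_of_mem_dyckWords h.hτ).1,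
      (count_of_mem_dyckWords h.hσ).2]

theorem pc_datum (hu : u ≠ []) (hv : v ≠ []) {q : ℕ} (hq : q ≤ 2 * n) :
    (h.datum hu hv).pc q = (π.take q).count 1 := by
  induction q with
  | zero => rw [Datum.pc_zero]; simp
  | succ q ih =>
    by_cases h1 : π[q]? = some 1
    · rw [(h.datum hu hv).pc_one (p := q) hq h1, ih (by omega), Word.count_take_succ h1, if_pos rfl]
    · rw [(h.datum hu hv).pc_not (p := q) hq h1, ih (by omega),
        Word.count_take_succ ((Word.ne_one_iff (by rw [h.hπ.1]; exact hq)).2 h1),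
        if_neg (by decide), Nat.add_zero]

theorem matched_iff (hu : u ≠ []) (hv : v ≠ []) {i j : ℕ} (hij : i < j) (hj : j < 2 * n) :
    Matched π i j ↔ (h.datum hu hv).Match i j := by
  have hl := h.hπ.1
  have hcount : ∀ q, i < q → ∀ x : Fin 2, ((π.take q).drop (i + 1)).count x +
      (π.take (i + 1)).count x = (π.take q).count x := by
    intro q hq x
    have h1 := List.take_append_drop (i + 1) (π.take q)
    rw [List.take_take, min_eq_left (by omega)] at h1
    conv_rhs => rw [← h1, List.count_append]
    omega
  have hadd : ∀ q, q ≤ j → (π.take q).count 0 + (π.take q).count 1 = q := fun q hq =>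
    Word.count_take_add π (by omega)
  have hpc : ∀ q, q ≤ j → (h.datum hu hv).pc q = (π.take q).count 1 := fun q hq =>
    h.pc_datum hu hv (by omega)
  have htake : ∀ k, ((π.take j).drop (i + 1)).take k = (π.take (min (i + 1 + k) j)).drop (i + 1) := by
    intro k
    rw [List.take_drop, List.take_take]
  unfold Matched Datum.Match IsBalanced
  refine and_congr_right fun _ => and_congr (Word.ne_one_iff (by omega)) (and_congr_right fun _ => ?_)
  rw [hpc (i + 1) hij, hpc _ le_rfl]
  have h0 := hadd (i + 1) hij
  refine and_congr ?_ ?_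
  · have h1 := hcount j hij 0
    have h2 := hcount j hij 1
    have h3 := hadd j le_rfl
    omega
  · constructor
    · intro h1 q hq hq'
      rw [hpc q hq']
      have h2 := h1 (q - (i + 1))
      rw [htake, show min (i + 1 + (q - (i + 1))) j = q by omega] at h2
      have := hcount q hq 0
      have := hcount q hq 1
      have := hadd q hq'
      omega
    · intro h1 k
      rw [htake]
      have h2 : i < min (i + 1 + k) j := by omega
      have h3 : min (i + 1 + k) j ≤ j := by omega
      have h4 := h1 _ h2 h3
      rw [hpc _ h3] at h4
      have := hcount _ h2 0
      have := hcount _ h2 1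
      have := hadd _ h3
      omega

/-- The count of configurations if `u` and `v` are nonempty. -/
theorem t_eq_det (hu : u ≠ []) (hv : v ≠ []) {i₀ j₀ : Fin a → ℕ} (hi₀ : StrictMono i₀)
    (hj₀ : StrictAnti j₀) (hi₀_range : Set.range i₀ = indexSet 0 σ')
    (hj₀_range : Set.range j₀ = indexSet 0 τ') :
    (t n σ π τ : ℤ) = (Matrix.of fun d e =>
      weight (2 * n - 1 - u.count 1) (i₀ d) (a + b + 1 - j₀ e)).det := by
  have hi : ∀ J, (∃ d, i₀ d = J) ↔ 1 ≤ J ∧ σ'[J - 1]? = some 0 := fun J => Set.ext_iff.1 hi₀_range J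
  have hj : ∀ J, (∃ d, j₀ d = J) ↔ 1 ≤ J ∧ τ'[J - 1]? = some 0 := fun J => Set.ext_iff.1 hj₀_range J
  have hσ' := h.length_σ'
  have hτ' := h.length_τ'
  have ha := h.ha
  have hjle : ∀ e, 1 ≤ j₀ e ∧ j₀ e ≤ a + b := fun e => by
    have := mem_indexSet_le (hj₀_range ▸ Set.mem_range_self e : j₀ e ∈ indexSet 0 τ')
    omega
  have hz : StrictMono fun e => a + b + 1 - j₀ e := fun d e hde => by
    have := hj₀ hde
    have := hjle d
    have := hjle e
    simp only
    omega
  rw [t_eq_ncard_bits h.hσ.1 h.hτ.1]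
  have hset : ∀ g : Bits, g.Linked n (fun i => σ[i]? = some 1) (fun i => τ[i]? = some 0) (Matched π) ↔
      g.Linked n (fun i => σ[i]? = some 1) (fun i => τ[i]? = some 0) (h.datum hu hv).Match := by
    intro g
    constructor
    · exact fun hg => ⟨fun i j hij hj => (hg.bottom i j hij hj).trans (h.matched_iff hu hv hij hj),
        hg.cross⟩
    · exact fun hg => ⟨fun i j hij hj => (hg.bottom i j hij hj).trans
        (h.matched_iff hu hv hij hj).symm, hg.cross⟩
  simp only [hset]
  refine ncard_linked (h.datum hu hv) hi₀ hz (fun J => ?_) fun J => ?_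
  · change _ ↔ 1 ≤ J ∧ J ≤ a + b ∧ ¬ σ[u.length + (J - 1)]? = some 1
    rw [hi]
    refine and_congr_right fun hJ => ?_
    constructor
    · intro h1
      have := (List.getElem?_eq_some_iff.1 h1).1
      refine ⟨by omega, ?_⟩
      rw [h.σ_mid (by omega)]
      exact (Word.ne_one_iff (by omega)).1 h1
    · rintro ⟨h1, h2⟩
      rw [h.σ_mid (by omega)] at h2
      exact (Word.ne_one_iff (by omega)).2 h2
  · change _ ↔ 1 ≤ J ∧ J ≤ a + b ∧ τ[n + b - J]? = some 0
    constructor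
    · rintro ⟨e, rfl⟩
      have h1 := hjle e
      refine ⟨by omega, by omega, ?_⟩
      rw [show n + b - (a + b + 1 - j₀ e) = n - a + (j₀ e - 1) by omega, h.τ_mid (by omega)]
      exact ((hj _).1 ⟨e, rfl⟩).2
    · rintro ⟨h1, h2, h3⟩
      rw [show n + b - J = n - a + (a + b - J) by omega, h.τ_mid (by omega)] at h3
      obtain ⟨e, he⟩ := (hj (a + b + 1 - J)).2 ⟨by omega, by
        rwa [show a + b + 1 - J - 1 = a + b - J by omega]⟩
      exact ⟨e, by rw [he]; omega⟩

end Factored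

end OfWords

/-! ### The degenerate decompositions -/

section Degenerate

theorem Word.eq_replicate_zero {w : Word} (h : w.count 1 = 0) :
    w = List.replicate (w.count 0) 0 := by
  have h1 := Word.length_eq w
  have h2 : w.count 0 = w.length := by omega
  rw [h2]
  exact List.eq_replicate_iff.2 ⟨rfl, fun x hx => (List.count_eq_length.1 h2 x hx).symm⟩

theorem Word.eq_replicate_one {w : Word} (h : w.count 0 = 0) :
    w = List.replicate (w.count 1) 1 := by
  have h1 := Word.length_eq w
  have h2 : w.count 1 = w.length := by omega
  rw [h2]
  exact List.eq_replicate_iff.2 ⟨rfl, fun x hx => (List.count_eq_length.1 h2 x hx).symm⟩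

/-- The only configuration of the empty triangle is the empty one. -/
theorem t_zero (σ π τ : Word) : t 0 σ π τ = 1 := by
  have h0 : ∀ p, ¬ InTriangle 0 p := fun p h => by
    obtain ⟨h1, h2, h3⟩ := h
    simp at h3
    omega
  have h : {f | IsTFPL 0 σ π τ f} = {⊥} := by
    ext f
    simp only [Set.mem_ofPred_eq, Set.mem_singleton_iff]
    constructor
    · intro hf
      rw [eq_bot_iff]
      intro p q hpq
      obtain ⟨-, h1 | ⟨i, hi, -⟩, -⟩ := hf.le hpq
      · exact absurd h1 (h0 p)
      · omega
    · rintro rfl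
      refine ⟨bot_le, ?_, fun p hp => absurd hp (h0 p), ?_, ?_, ?_, ?_, ?_, ?_⟩ <;> intros <;> omega
  rw [t, h, Set.ncard_singleton]

namespace Factored

variable {n a b : ℕ} {σ π τ u v σ' τ' : Word}

/-- If `σ = π`, the decomposition with a single letter `u` and an empty middle part leads to a
determinant of size zero. -/
theorem t_eq_one (hn : 0 < n) (hσ : σ ∈ dyckWords n)
    (hτ : List.replicate n 0 ++ List.replicate n 1 ∈ dyckWords n) :
    t n σ σ (List.replicate n 0 ++ List.replicate n 1) = 1 := by
  obtain ⟨x, w, rfl⟩ : ∃ x w, σ = x :: w := by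
    rcases σ with _ | ⟨x, w⟩
    · have := hσ.1
      simp at this
      omega
    · exact ⟨x, w, rfl⟩
  have hc := count_of_mem_dyckWords hσ
  have hw : w ≠ [] := by
    rintro rfl
    have := hσ.1
    simp at this
    omega
  have h : Factored n 0 0 (x :: w) (x :: w) (List.replicate n 0 ++ List.replicate n 1) [x] w [] [] :=
    ⟨hσ, hσ, hτ, by rw [← List.count_append]; exact hc.1, by rw [← List.count_append]; exact hc.2,
      rfl, rfl, by simp⟩
  have h1 := h.t_eq_det (List.cons_ne_nil _ _) hw (i₀ := Fin.elim0) (j₀ := Fin.elim0)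
    (fun d => d.elim0) (fun d => d.elim0) (by ext; simp [indexSet]) (by ext; simp [indexSet])
  rw [Matrix.det_isEmpty] at h1
  exact_mod_cast h1

/-- If `u` or `v` is empty, the middle part of `π` is `0 ⋯ 0` or `1 ⋯ 1`. Then `σ` and `π` agree, and
there is a single configuration. -/
theorem t_eq_one_of_nil (h : Factored n a b σ π τ u v σ' τ') (hn : 0 < n) (huv : u = [] ∨ v = []) :
    (a = 0 ∨ b = 0) ∧ t n σ π τ = 1 := by
  have h1 := h.prefix_le
  have ha := h.ha
  have hb := h.hb
  obtain ⟨hσ0, hσ1⟩ := h.count_σ'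
  obtain ⟨hτ0, hτ1⟩ := h.count_τ'
  have hτ := h.hτ
  rcases huv with rfl | rfl
  · obtain rfl : b = 0 := by simp at h1; omega
    refine ⟨Or.inr rfl, ?_⟩
    have h2 : σ = π := by
      rw [h.hσ_eq, h.hπ_eq, Word.eq_replicate_zero hσ1, hσ0]
      simp
    have h3 : τ = List.replicate n 0 ++ List.replicate n 1 := by
      rw [h.hτ_eq, Word.eq_replicate_zero hτ1, hτ0, ← List.replicate_add]
      congr 2
      omega
    rw [h3] at hτ ⊢
    rw [← h2]
    exact t_eq_one hn h.hσ hτ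
  · obtain rfl : a = 0 := by simp at ha hb; omega
    refine ⟨Or.inl rfl, ?_⟩
    have h2 : σ = π := by
      rw [h.hσ_eq, h.hπ_eq, Word.eq_replicate_one hσ0, hσ1]
      simp
    have h3 : τ = List.replicate n 0 ++ List.replicate n 1 := by
      rw [h.hτ_eq, Word.eq_replicate_one hτ0, hτ1, List.append_assoc, ← List.replicate_add]
      congr 2
      omega
    rw [h3] at hτ ⊢
    rw [← h2]
    exact t_eq_one hn h.hσ hτ

end Factored

theorem injective_sum_elim {a b : ℕ} {w : Word} {f : Fin a → ℕ} {g : Fin b → ℕ}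
    (hf : Function.Injective f) (hg : Function.Injective g) (hfr : Set.range f = indexSet 0 w)
    (hgr : Set.range g = indexSet 1 w) : Function.Injective (Sum.elim f g) := by
  refine hf.sumElim hg fun d e hde => ?_
  have h1 : f d ∈ indexSet 0 w := hfr ▸ Set.mem_range_self d
  have h2 : g e ∈ indexSet 1 w := hgr ▸ Set.mem_range_self e
  rw [hde] at h1
  have := h1.2.symm.trans h2.2
  simp at this

end Degenerate

end TFPL

theorem mainTheorem6 (n a b : ℕ) (σ π τ u v σ' τ' : TFPL.Word)
    (hσ : σ ∈ TFPL.dyckWords n) (hπ : π ∈ TFPL.dyckWords n) (hτ : τ ∈ TFPL.dyckWords n)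
    (ha : u.count 0 + v.count 0 + a = n) (hb : u.count 1 + v.count 1 + b = n)
    (hσ_eq : σ = u ++ σ' ++ v)
    (hπ_eq : π = u ++ List.replicate b 1 ++ List.replicate a 0 ++ v)
    (hτ_eq : τ = List.replicate (n - a) 0 ++ τ' ++ List.replicate (n - b) 1)
    (i₁ j₁ : Fin b → ℕ) (hi₁ : StrictMono i₁) (hj₁ : StrictAnti j₁)
    (hi₁_range : Set.range i₁ = TFPL.indexSet 1 σ')
    (hj₁_range : Set.range j₁ = TFPL.indexSet 1 τ')
    (i₀ j₀ : Fin a → ℕ) (hi₀ : StrictMono i₀) (hj₀ : StrictAnti j₀)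
    (hi₀_range : Set.range i₀ = TFPL.indexSet 0 σ')
    (hj₀_range : Set.range j₀ = TFPL.indexSet 0 τ') :
    let M₁ : Matrix (Fin b) (Fin b) ℤ := Matrix.of fun d e =>
      TFPL.binom (2 * (n : ℤ) - (u.count 1 : ℤ) - 2 - ((a : ℤ) + b) + j₁ e)
        ((i₁ d : ℤ) + j₁ e - ((a : ℤ) + b + 1))
    let M₀ : Matrix (Fin a) (Fin a) ℤ := Matrix.of fun d e =>
      TFPL.binom (2 * (n : ℤ) - (u.count 1 : ℤ) - 1 - i₀ d)
        ((a : ℤ) + b + 1 - i₀ d - j₀ e)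
    (TFPL.t n σ π τ : ℤ) = M₀.det ∧ M₀.det = M₁.det := by
  intro M₁ M₀
  have h : TFPL.Factored n a b σ π τ u v σ' τ' := ⟨hσ, hπ, hτ, ha, hb, hσ_eq, hπ_eq, hτ_eq⟩
  have hu := h.prefix_le
  rcases Nat.eq_zero_or_pos n with rfl | hn
  · obtain rfl : a = 0 := by omega
    obtain rfl : b = 0 := by omega
    rw [TFPL.t_zero, Matrix.det_isEmpty, Matrix.det_isEmpty]
    exact ⟨rfl, rfl⟩
  obtain ⟨T, hT⟩ : ∃ T, 2 * n - 1 - u.count 1 = T := ⟨_, rfl⟩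
  have hmT : a + b ≤ T := by omega
  have hi₀_le : ∀ d, 1 ≤ i₀ d ∧ i₀ d ≤ a + b := fun d =>
    h.length_σ' ▸ TFPL.mem_indexSet_le (hi₀_range ▸ Set.mem_range_self d)
  have hi₁_le : ∀ d, 1 ≤ i₁ d ∧ i₁ d ≤ a + b := fun d =>
    h.length_σ' ▸ TFPL.mem_indexSet_le (hi₁_range ▸ Set.mem_range_self d)
  have hj₀_le : ∀ d, 1 ≤ j₀ d ∧ j₀ d ≤ a + b := fun d =>
    h.length_τ' ▸ TFPL.mem_indexSet_le (hj₀_range ▸ Set.mem_range_self d)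
  have hj₁_le : ∀ d, 1 ≤ j₁ d ∧ j₁ d ≤ a + b := fun d =>
    h.length_τ' ▸ TFPL.mem_indexSet_le (hj₁_range ▸ Set.mem_range_self d)
  have hM₀ : M₀ = Matrix.of fun d e => TFPL.weight T (i₀ d) (a + b + 1 - j₀ e) := by
    ext d e
    have := hi₀_le d
    have := hj₀_le e
    exact TFPL.binom_eq_weight (by omega) _ _ (by omega) (by omega)
  have hM₁ : M₁ = Matrix.of fun d e => TFPL.weight T (a + b + 1 - j₁ e) (i₁ d) := by
    ext d e
    have := hi₁_le d
    have := hj₁_le e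
    exact TFPL.binom_eq_weight (by omega) _ _ (by omega) (by omega)
  have hanti : ∀ {k : ℕ} {j : Fin k → ℕ}, StrictAnti j → (∀ d, 1 ≤ j d ∧ j d ≤ a + b) →
      StrictMono fun d => a + b + 1 - j d := by
    intro k j hj hle d e hde
    have := hj hde
    have := hle d
    have := hle e
    simp only
    omega
  have hJ : Function.Injective (Sum.elim (fun d => a + b + 1 - j₀ d) fun d => a + b + 1 - j₁ d) := by
    have h1 := TFPL.injective_sum_elim hj₀.injective hj₁.injective hj₀_range hj₁_range
    intro x y hxy
    apply h1
    rcases x with x | x <;> rcases y with y | y <;> simp only [Sum.elim_inl, Sum.elim_inr] at hxy ⊢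
    · have := hj₀_le x; have := hj₀_le y; omega
    · have := hj₀_le x; have := hj₁_le y; omega
    · have := hj₁_le x; have := hj₀_le y; omega
    · have := hj₁_le x; have := hj₁_le y; omega
  have hdet : M₀.det = M₁.det := by
    rw [hM₀, hM₁]
    refine TFPL.det_weight_compl hmT hi₀ (hanti hj₀ hj₀_le) hi₁ (hanti hj₁ hj₁_le)
      (TFPL.injective_sum_elim hi₀.injective hi₁.injective hi₀_range hi₁_range) hJ ?_ ?_
    · rintro (x | x)
      · exact hi₀_le x
      · exact hi₁_le x
    · rintro (x | x)
      · have := hj₀_le x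
        simp only [Sum.elim_inl]; omega
      · have := hj₁_le x
        simp only [Sum.elim_inr]; omega
  refine ⟨?_, hdet⟩
  by_cases huv : u = [] ∨ v = []
  · obtain ⟨hab, ht⟩ := h.t_eq_one_of_nil hn huv
    rw [ht]
    rcases hab with rfl | rfl
    · rw [Matrix.det_isEmpty]; rfl
    · rw [hdet, Matrix.det_isEmpty]; rfl
  · rw [h.t_eq_det (fun hu => huv (Or.inl hu)) (fun hv => huv (Or.inr hv)) hi₀ hj₀ hi₀_range
      hj₀_range, hM₀, hT]
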